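/- Let $n\ge 1$, let $J_n$ be the $n\times n$ matrix with $1$'s on the antidiagonal and $0$'s elsewhere, $\Omega=\begin{pmatrix}0&J_n\\-J_n&0\end{pmatrix}$, and $G=Sp_{2n}=\{g\in GL_{2n}(\mathbb C): g^t\Omega g=\Omega\}$. Let $B\subset G$ be the subgroup of upper triangular matrices, $P\subset G$ the subgroup of matrices whose lower left $n\times n$ block is $0$, and $L\cong GL_n$ the subgroup of fixed points in $G$ of conjugation by $\mathrm{diag}(iI_n,-iI_n)$ (the block diagonal matrices of $G$). Then $L\subset P$; let $\pi:G/L\to G/P$ be the natural projection. The coset $gP$ is identified with the Lagrangian subspace $gE_n$, $E_n=\mathrm{span}(e_1,\dots,e_n)$. *Schubert cells.* For $I\subset[2n]$ with $|I|=n$ such that $i\in I$ implies $2n+1-i\notin I$, let $V_I=\mathrm{span}(e_i: i\in I)$, and let $C_I\subset G/P$ be the $B$-orbit of $V_I$. *Clans.* An $(n,n)$-clan is a string $\gamma=c_1\cdots c_{2n}$ of symbols $+$, $-$ and natural numbers, with as many $+$'s as $-$'s, in which each natural number that occurs does so exactly twice; strings are identified if their signs are the same and their pairs of equal numbers are in the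 same positions. It is skew-symmetric if reversing the string and exchanging $+$ and $-$ gives $\gamma$ again. The signature of position $i$ is $+$ if $c_i=+$ or $c_i$ is the second occurrence of a number, and $-$ if $c_i=-$ or $c_i$ is the first occurrence of a number. The base clan of $\gamma$ is the string of its signatures. Let $\gamma_I$ be the clan with $c_i=+$ for $i\in I$ and $c_i=-$ for $i\notin I$, and let the sect $\Sigma_I$ be the set of skew-symmetric $(n,n)$-clans with base clan $\gamma_I$. *Orbits.* For a skew-symmetric $(n,n)$-clan $\gamma$ let $\sigma\in S_{2n}$ be the permutation which, for each $i\le n$, fixes $i$ and $2n+1-i$ if position $i$ has signature $+$, and exchanges them if it has signature $-$. Let $g_\gamma$ be the matrix with columns $v_1,\dots,v_{2n}$, where $v_i=e_{\sigma(i)}$ if $c_i=-$; $v_i=e_{\sigma(i)}$ if $c_i=+$ and $i\le n$; $v_i=-e_{\sigma(i)}$ if $c_i=+$ and $i>n$; and, if $c_i=c_j$ is a number and $i<j$, $v_i=\pm\frac1{\sqrt2}(e_{\sigma(i)}+e_{\sigma(j)})$, with sign $+$ if $i\le n$ and $-$ if $i>n$, and $v_j=\frac1{\sqrt2}(e_{\sigma(i)}-e_{\sigma(j)})$.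 Then $g_\gamma\in G$; let $R_\gamma=Bg_\gamma^{-1}L/L$ be the $B$-orbit of $g_\gamma^{-1}L$ in $G/L$. **Theorem.** (1) For every $I$ as above, $$\pi^{-1}(C_I)=\bigsqcup_{\gamma\in\Sigma_I}R_\gamma ,$$ where the union is disjoint. (2) The sets $\bigsqcup_{\gamma\in\Sigma_I}R_\gamma$, indexed by the $I$ as above, form a cell decomposition of $G/L$: they are pairwise disjoint, their union is $G/L$, each of them is (as a locally closed subvariety) isomorphic to an affine space $\mathbb C^{m}$, where $m$ may depend on $I$, and they can be enumerated so that, for every $k$, the union of the first $k$ of them is Zariski closed in $G/L$. -/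

import Mathlib

open scoped Matrix

set_option linter.unusedSimpArgs false

noncomputable section

namespace CI

/-! ### The symmetric pair, the parabolic and the Borel subgroup -/

/-- `1` at the first `n` indices and `-1` at the last `n` indices. -/
def halfSign (n : ℕ) (i : Fin (2 * n)) : ℂ := if (i : ℕ) < n then 1 else -1

/-- The block matrix with blocks `0, J, -J, 0`, where `J` is the antidiagonal matrix of ones. -/
def Omega (n : ℕ) : Matrix (Fin (2 * n)) (Fin (2 * n)) ℂ :=
  Matrix.of fun i j => if j = i.rev then halfSign n i else 0

/-- The symplectic group `{g | gᵀ Ω g = Ω}`. -/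
def Sp (n : ℕ) : Subgroup (GL (Fin (2 * n)) ℂ) where
  carrier := {g | (g : Matrix (Fin (2 * n)) (Fin (2 * n)) ℂ)ᵀ * Omega n *
    (g : Matrix (Fin (2 * n)) (Fin (2 * n)) ℂ) = Omega n}
  one_mem' := by simp
  mul_mem' := by
    intro a b ha hb
    simp only [Set.mem_ofPred_eq, Units.val_mul, Matrix.transpose_mul] at *
    calc _ = (b.val)ᵀ * ((a.val)ᵀ * Omega n * a.val) * b.val := by
          simp only [Matrix.mul_assoc]
      _ = _ := by rw [ha, hb]
  inv_mem' := by
    intro a ha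
    simp only [Set.mem_ofPred_eq] at *
    have h1 : a.val * (a⁻¹).val = 1 := by rw [← Units.val_mul]; simp
    have h2 : ((a⁻¹).val)ᵀ * (a.val)ᵀ = 1 := by
      rw [← Matrix.transpose_mul, h1, Matrix.transpose_one]
    calc _ = ((a⁻¹).val)ᵀ * ((a.val)ᵀ * Omega n * a.val) * (a⁻¹).val := by rw [ha]
      _ = (((a⁻¹).val)ᵀ * (a.val)ᵀ) * Omega n * (a.val * (a⁻¹).val) := by
          simp only [Matrix.mul_assoc]
      _ = _ := by rw [h1, h2]; simp

/-- The underlying matrix of an element of the symplectic group. -/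
abbrev mat {n : ℕ} (g : Sp n) : Matrix (Fin (2 * n)) (Fin (2 * n)) ℂ := g.val.val

/-- The diagonal matrix `i I_{n,n}`, as an invertible matrix. -/
def iInn (n : ℕ) : GL (Fin (2 * n)) ℂ where
  val := Matrix.diagonal fun k => Complex.I * halfSign n k
  inv := Matrix.diagonal fun k => -Complex.I * halfSign n k
  val_inv := by
    rw [Matrix.diagonal_mul_diagonal, ← Matrix.diagonal_one]
    congr 1; funext k
    unfold halfSign
    split_ifs <;> simp
  inv_val := by
    rw [Matrix.diagonal_mul_diagonal, ← Matrix.diagonal_one]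
    congr 1; funext k
    unfold halfSign
    split_ifs <;> simp

/-- The involution `θ`, conjugation by `i I_{n,n}`. -/
def theta (n : ℕ) : MulAut (GL (Fin (2 * n)) ℂ) := MulAut.conj (iInn n)

/-- The symmetric subgroup `L = G^θ`, isomorphic to `GL_n`. -/
def L (n : ℕ) : Subgroup (Sp n) :=
  (MonoidHom.eqLocus (theta n).toMonoidHom (MonoidHom.id _)).subgroupOf (Sp n)

/-- A block upper triangular subgroup of the symplectic group. -/
def blockUpper (n : ℕ) {α : Type} [LinearOrder α] (b : Fin (2 * n) → α) : Subgroup (Sp n) where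
  carrier := {g | ∀ i j, b j < b i → mat g i j = 0}
  one_mem' := by
    intro i j hij
    have : i ≠ j := by rintro rfl; exact lt_irrefl _ hij
    simp [mat, this]
  mul_mem' := by
    intro x y hx hy i j hij
    have hx' : (mat x).BlockTriangular b := fun i j h => hx i j h
    have hy' : (mat y).BlockTriangular b := fun i j h => hy i j h
    exact (hx'.mul hy') hij
  inv_mem' := by
    intro x hx i j hij
    have hx' : (mat x).BlockTriangular b := fun i j h => hx i j h
    have : Invertible (mat x) := x.val.invertible
    have := Matrix.blockTriangular_inv_of_blockTriangular hx' hij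
    simpa [mat, Matrix.coe_units_inv] using this

/-- The Borel subgroup of upper triangular matrices in the symplectic group. -/
def B (n : ℕ) : Subgroup (Sp n) := blockUpper n id

/-- The parabolic subgroup of the matrices in the symplectic group whose lower left
`n × n` block is zero, the stabilizer of the span of the first `n` basis vectors. -/
def P (n : ℕ) : Subgroup (Sp n) := blockUpper n fun i => if (i : ℕ) < n then 0 else 1

theorem mem_B {n : ℕ} (g : Sp n) : g ∈ B n ↔ ∀ i j, j < i → mat g i j = 0 := Iff.rfl

theorem mem_P {n : ℕ} (g : Sp n) :
    g ∈ P n ↔ ∀ i j : Fin (2 * n), n ≤ (i : ℕ) → (j : ℕ) < n → mat g i j = 0 := by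
  constructor
  · intro h i j hi hj
    exact h i j (by simp [hj, not_lt.mpr hi])
  · intro h i j hij
    apply h i j
    · by_contra hi
      simp [not_le.mp hi] at hij
    · by_contra hj
      simp only [hj, if_false] at hij
      split_ifs at hij <;> simp at hij

theorem mem_L {n : ℕ} (g : Sp n) :
    g ∈ L n ↔ ∀ i j : Fin (2 * n), ¬((i : ℕ) < n ↔ (j : ℕ) < n) → mat g i j = 0 := by
  have key : g ∈ L n ↔ ∀ i j : Fin (2 * n),
      (Complex.I * halfSign n i) * mat g i j = mat g i j * (Complex.I * halfSign n j) := by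
    have : g ∈ L n ↔ iInn n * g.val * (iInn n)⁻¹ = g.val := Iff.rfl
    rw [this, mul_inv_eq_iff_eq_mul, Units.ext_iff, ← Matrix.ext_iff]
    simp [iInn, mat]
  rw [key]
  refine forall_congr' fun i => forall_congr' fun j => ?_
  have hI := Complex.I_ne_zero
  unfold halfSign
  by_cases hi : (i : ℕ) < n <;> by_cases hj : (j : ℕ) < n <;> simp [hi, hj, mul_comm]
  · rw [eq_neg_iff_add_eq_zero, ← two_mul]; simp
  · rw [neg_eq_iff_add_eq_zero, ← two_mul]; simp

theorem L_le_P (n : ℕ) : L n ≤ P n := by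
  intro g hg
  rw [mem_L] at hg
  rw [mem_P]
  intro i j hi hj
  exact hg i j (by simp [hj, not_lt.mpr hi])

/-- The natural projection `G/L → G/P`. -/
def proj (n : ℕ) : Sp n ⧸ L n → Sp n ⧸ P n := Subgroup.quotientMapOfLE (L_le_P n)

/-! ### Clans -/

/-- A symbol of a clan with `N` positions. Since clans are considered up to renaming the natural
numbers that occur in them, a natural number is recorded by the other position at which
it occurs. -/
inductive ClanSymbol (N : ℕ) : Type
  | plus : ClanSymbol N
  | minus : ClanSymbol N
  | num (mate : Fin N) : ClanSymbol N

/-- A string of `N` symbols among `+`, `-` and natural numbers, in which each natural number that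
appears does so exactly twice, up to renaming the natural numbers. -/
@[ext]
structure Clan (N : ℕ) where
  symbol : Fin N → ClanSymbol N
  matching : ∀ i j, symbol i = ClanSymbol.num j → j ≠ i ∧ symbol j = ClanSymbol.num i

/-- `γ` is a `(p, q)`-clan: it has `p + q` symbols and `p - q` more `+`'s than `-`'s. -/
def Clan.IsPQ {N : ℕ} (γ : Clan N) (p q : ℕ) : Prop :=
  N = p + q ∧
    (Nat.card {i // γ.symbol i = ClanSymbol.plus} : ℤ) -
      (Nat.card {i // γ.symbol i = ClanSymbol.minus} : ℤ) = (p : ℤ) - (q : ℤ)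

/-- Exchange `+` and `-`. -/
def ClanSymbol.neg {N : ℕ} : ClanSymbol N → ClanSymbol N
  | plus => minus
  | minus => plus
  | num j => num j

/-- The effect on a symbol of reversing the order of the positions. -/
def ClanSymbol.rev {N : ℕ} : ClanSymbol N → ClanSymbol N
  | plus => plus
  | minus => minus
  | num j => num j.rev

/-- The reversed clan. -/
def Clan.rev {N : ℕ} (γ : Clan N) : Clan N where
  symbol i := (γ.symbol i.rev).rev
  matching := by
    intro i j h
    cases hs : γ.symbol i.rev with
    | plus => simp [hs, ClanSymbol.rev] at h
    | minus => simp [hs, ClanSymbol.rev] at h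
    | num k =>
      simp only [hs, ClanSymbol.rev, ClanSymbol.num.injEq] at h
      subst h
      obtain ⟨h1, h2⟩ := γ.matching _ _ hs
      refine ⟨fun h => h1 (by rw [← h, Fin.rev_rev]), ?_⟩
      simp [h2, ClanSymbol.rev]

/-- The clan with `+` and `-` exchanged. -/
def Clan.neg {N : ℕ} (γ : Clan N) : Clan N where
  symbol i := (γ.symbol i).neg
  matching := by
    intro i j h
    cases hs : γ.symbol i with
    | plus => simp [hs, ClanSymbol.neg] at h
    | minus => simp [hs, ClanSymbol.neg] at h
    | num k =>
      simp only [hs, ClanSymbol.neg, ClanSymbol.num.injEq] at h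
      subst h
      obtain ⟨h1, h2⟩ := γ.matching _ _ hs
      exact ⟨h1, by simp [h2, ClanSymbol.neg]⟩

/-- Skew-symmetric `(n, n)`-clans. -/
@[ext]
structure SkewClan (n : ℕ) extends Clan (2 * n) where
  isPQ : toClan.IsPQ n n
  skew : toClan = toClan.rev.neg

/-- The position `i` has signature `+` in the default signed clan: the symbol there is `+`, or it
is the second occurrence of a natural number. -/
def Clan.SigPlus {N : ℕ} (γ : Clan N) (i : Fin N) : Prop :=
  match γ.symbol i with
  | ClanSymbol.plus => True
  | ClanSymbol.minus => False
  | ClanSymbol.num j => j < i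

/-- The clan that has `+` at the positions in a given set, and `-` elsewhere. -/
def Clan.ofSet {N : ℕ} (S : Set (Fin N)) : Clan N where
  symbol i := open Classical in if i ∈ S then ClanSymbol.plus else ClanSymbol.minus
  matching := by
    intro i j h
    split_ifs at h

/-- The base clan: each symbol of the default signed clan is replaced by its signature. -/
def Clan.base {N : ℕ} (γ : Clan N) : Clan N := Clan.ofSet {i | γ.SigPlus i}

/-- The default permutation `σ` of a clan: `i` and `2n+1-i` (for `i ≤ n`) are fixed if the
signature at `i` is `+` and exchanged if it is `-`. -/
def SkewClan.defaultPerm {n : ℕ} (γ : SkewClan n) (i : Fin (2 * n)) : Fin (2 * n) :=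
  open Classical in
  if (i : ℕ) < n then (if γ.toClan.SigPlus i then i else i.rev)
  else (if γ.toClan.SigPlus i.rev then i else i.rev)

/-- The `i`-th standard basis vector. -/
def e {n : ℕ} (i : Fin (2 * n)) : Fin (2 * n) → ℂ := Pi.single i 1

/-- The vectors `v_i` of the flag that represents a skew-symmetric clan. -/
def SkewClan.flagVec {n : ℕ} (γ : SkewClan n) (i : Fin (2 * n)) : Fin (2 * n) → ℂ :=
  match γ.symbol i with
  | ClanSymbol.minus => e (γ.defaultPerm i)
  | ClanSymbol.plus => if (i : ℕ) < n then e (γ.defaultPerm i) else -e (γ.defaultPerm i)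
  | ClanSymbol.num j =>
    if i < j then
      if (i : ℕ) < n then
        (1 / (Real.sqrt 2 : ℂ)) • (e (γ.defaultPerm i) + e (γ.defaultPerm j))
      else
        -(1 / (Real.sqrt 2 : ℂ)) • (e (γ.defaultPerm i) + e (γ.defaultPerm j))
    else
      (1 / (Real.sqrt 2 : ℂ)) • (e (γ.defaultPerm j) - e (γ.defaultPerm i))

/-- The matrix whose `i`-th column is `v_i`. -/
def SkewClan.repMatrix {n : ℕ} (γ : SkewClan n) : Matrix (Fin (2 * n)) (Fin (2 * n)) ℂ :=
  Matrix.of fun k i => γ.flagVec i k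

theorem SkewClan.symbol_rev {n : ℕ} (γ : SkewClan n) (i : Fin (2 * n)) :
    γ.symbol i.rev = (γ.symbol i).rev.neg := by
  have h := congrArg (fun c => Clan.symbol c i.rev) γ.skew
  simpa [Clan.neg, Clan.rev] using h

theorem SkewClan.sigPlus_rev {n : ℕ} (γ : SkewClan n) (i : Fin (2 * n)) :
    γ.toClan.SigPlus i.rev ↔ ¬ γ.toClan.SigPlus i := by
  unfold Clan.SigPlus
  rw [γ.symbol_rev i]
  cases h : γ.symbol i with
  | plus => simp [ClanSymbol.rev, ClanSymbol.neg]
  | minus => simp [ClanSymbol.rev, ClanSymbol.neg]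
  | num j =>
    have := (γ.matching _ _ h).1
    simp only [ClanSymbol.rev, ClanSymbol.neg, Fin.rev_lt_rev, not_lt]
    exact ⟨le_of_lt, fun h => lt_of_le_of_ne h this.symm⟩

theorem rev_lt_iff {n : ℕ} (i : Fin (2 * n)) : ((i.rev : Fin (2 * n)) : ℕ) < n ↔ ¬ (i : ℕ) < n := by
  have := i.isLt
  rw [Fin.val_rev]
  omega

theorem rev_ne {n : ℕ} (i : Fin (2 * n)) : i.rev ≠ i := by
  intro h
  have := rev_lt_iff i
  rw [h] at this
  tauto

theorem SkewClan.defaultPerm_rev {n : ℕ} (γ : SkewClan n) (i : Fin (2 * n)) :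
    γ.defaultPerm i.rev = (γ.defaultPerm i).rev := by
  have h := rev_lt_iff i
  unfold SkewClan.defaultPerm
  by_cases hi : (i : ℕ) < n
  · have h' : ¬ ((i.rev : Fin (2 * n)) : ℕ) < n := by tauto
    rw [if_neg h', if_pos hi, Fin.rev_rev]
    split_ifs <;> simp
  · have h' : ((i.rev : Fin (2 * n)) : ℕ) < n := by tauto
    rw [if_pos h', if_neg hi, Fin.rev_rev]
    split_ifs <;> simp

theorem SkewClan.defaultPerm_eq_or {n : ℕ} (γ : SkewClan n) (i : Fin (2 * n)) :
    γ.defaultPerm i = i ∨ γ.defaultPerm i = i.rev := by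
  unfold SkewClan.defaultPerm
  split_ifs <;> simp

theorem SkewClan.defaultPerm_eq_rev_iff {n : ℕ} (γ : SkewClan n) (i j : Fin (2 * n)) :
    γ.defaultPerm j = (γ.defaultPerm i).rev ↔ j = i.rev := by
  constructor
  · intro h
    by_contra hne
    have hj := γ.defaultPerm_eq_or j
    have hi := γ.defaultPerm_eq_or i
    have hji : j = i := by
      rcases hi with hi | hi <;> rcases hj with hj | hj <;> rw [hi, hj] at h
      · exact absurd h hne
      · exact Fin.rev_injective h
      · simpa using h
      · exact absurd (Fin.rev_injective h) hne
    subst hji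
    exact rev_ne _ h.symm
  · rintro rfl
    exact γ.defaultPerm_rev i

theorem SkewClan.defaultPerm_lt {n : ℕ} (γ : SkewClan n) (i : Fin (2 * n)) :
    (γ.defaultPerm i : ℕ) < n ↔ γ.toClan.SigPlus i := by
  have h1 := rev_lt_iff i
  have h2 := γ.sigPlus_rev i
  unfold SkewClan.defaultPerm
  rw [h2]
  by_cases hi : (i : ℕ) < n <;> by_cases hs : γ.toClan.SigPlus i <;>
    simp [hi, hs, -Fin.val_rev, h1]

/-- The symplectic form. -/
def form {n : ℕ} (u v : Fin (2 * n) → ℂ) : ℂ := u ⬝ᵥ (Omega n *ᵥ v)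

theorem SkewClan.form_e {n : ℕ} (γ : SkewClan n) (i j : Fin (2 * n)) :
    form (e (γ.defaultPerm i)) (e (γ.defaultPerm j)) =
      open Classical in if j = i.rev then (if γ.toClan.SigPlus i then 1 else -1) else 0 := by
  have h := γ.defaultPerm_lt i
  by_cases hs : γ.toClan.SigPlus i
  · simp [form, e, Omega, γ.defaultPerm_eq_rev_iff, halfSign, hs, h.mpr hs]
  · simp [form, e, Omega, γ.defaultPerm_eq_rev_iff, halfSign, hs, mt h.mp hs]

theorem form_add_left {n : ℕ} (u v w : Fin (2 * n) → ℂ) :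
    form (u + v) w = form u w + form v w := by simp [form, add_dotProduct]
theorem form_add_right {n : ℕ} (u v w : Fin (2 * n) → ℂ) :
    form w (u + v) = form w u + form w v := by simp [form, Matrix.mulVec_add]
theorem form_sub_left {n : ℕ} (u v w : Fin (2 * n) → ℂ) :
    form (u - v) w = form u w - form v w := by simp [form, sub_dotProduct]
theorem form_sub_right {n : ℕ} (u v w : Fin (2 * n) → ℂ) :
    form w (u - v) = form w u - form w v := by simp [form, Matrix.mulVec_sub]
theorem form_neg_left {n : ℕ} (u w : Fin (2 * n) → ℂ) : form (-u) w = -form u w := by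
  simp [form]
theorem form_neg_right {n : ℕ} (u w : Fin (2 * n) → ℂ) : form w (-u) = -form w u := by
  simp [form, Matrix.mulVec_neg]
theorem form_smul_left {n : ℕ} (c : ℂ) (u w : Fin (2 * n) → ℂ) :
    form (c • u) w = c * form u w := by simp [form]
theorem form_smul_right {n : ℕ} (c : ℂ) (u w : Fin (2 * n) → ℂ) :
    form w (c • u) = c * form w u := by simp [form, Matrix.mulVec_smul]

theorem SkewClan.form_flagVec {n : ℕ} (γ : SkewClan n) (i j : Fin (2 * n)) :
    form (γ.flagVec i) (γ.flagVec j) = Omega n i j := by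
  have hc : (1 / (Real.sqrt 2 : ℂ)) * (1 / (Real.sqrt 2 : ℂ)) = 1 / 2 := by
    rw [div_mul_div_comm, one_mul, ← Complex.ofReal_mul,
      Real.mul_self_sqrt (by norm_num : (0 : ℝ) ≤ 2)]
    norm_num
  have hsi := γ.symbol_rev i
  have hri := rev_lt_iff i
  have hinv : ∀ a b : Fin (2 * n), a = b.rev ↔ b = a.rev := by
    intro a b; constructor <;> (rintro rfl; simp)
  generalize hcc : (1 / (Real.sqrt 2 : ℂ)) = c at hc
  cases hi : γ.symbol i with
  | plus =>
    have si : γ.toClan.SigPlus i := by simp [Clan.SigPlus, hi]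
    cases hj : γ.symbol j with
    | plus =>
      have : j ≠ i.rev := by rintro rfl; simp [hi, hj, ClanSymbol.rev, ClanSymbol.neg] at hsi
      simp only [SkewClan.flagVec, hi, hj]
      split_ifs <;> simp [form_neg_left, form_neg_right, form_e, this, Omega]
    | minus =>
      simp only [SkewClan.flagVec, hi, hj]
      split_ifs with h <;> simp [form_neg_left, form_e, Omega, halfSign, h, si]
      split_ifs <;> simp
    | num k =>
      have h1 : j ≠ i.rev := by rintro rfl; simp [hi, hj, ClanSymbol.rev, ClanSymbol.neg] at hsi
      have h2 : k ≠ i.rev := by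
        rintro rfl
        simp [hi, (γ.matching _ _ hj).2, ClanSymbol.rev, ClanSymbol.neg] at hsi
      simp only [SkewClan.flagVec, hi, hj]
      split_ifs <;> simp [form_neg_left, form_neg_right, form_smul_right, form_add_right,
        form_sub_right, form_e, h1, h2, Omega]
  | minus =>
    have si : ¬ γ.toClan.SigPlus i := by simp [Clan.SigPlus, hi]
    cases hj : γ.symbol j with
    | plus =>
      simp only [SkewClan.flagVec, hi, hj]
      by_cases hij : j = i.rev
      · subst hij
        by_cases h : (i : ℕ) < n <;>
          simp [form_neg_right, form_e, Omega, halfSign, h, si, hri, -Fin.val_rev]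
      · split_ifs <;> simp [form_neg_right, form_e, hij, Omega]
    | minus =>
      have : j ≠ i.rev := by rintro rfl; simp [hi, hj, ClanSymbol.rev, ClanSymbol.neg] at hsi
      simp [SkewClan.flagVec, hi, hj, form_e, this, Omega]
    | num k =>
      have h1 : j ≠ i.rev := by rintro rfl; simp [hi, hj, ClanSymbol.rev, ClanSymbol.neg] at hsi
      have h2 : k ≠ i.rev := by
        rintro rfl
        simp [hi, (γ.matching _ _ hj).2, ClanSymbol.rev, ClanSymbol.neg] at hsi
      simp only [SkewClan.flagVec, hi, hj]
      split_ifs <;> simp [form_neg_right, form_smul_right, form_add_right,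
        form_sub_right, form_e, h1, h2, Omega]
  | num l =>
    have hl := γ.matching _ _ hi
    have hsl := γ.symbol_rev l
    cases hj : γ.symbol j with
    | plus =>
      have h1 : j ≠ i.rev := by rintro rfl; simp [hi, hj, ClanSymbol.rev, ClanSymbol.neg] at hsi
      have h2 : j ≠ l.rev := by rintro rfl; simp [hl, hj, ClanSymbol.rev, ClanSymbol.neg] at hsl
      simp only [SkewClan.flagVec, hi, hj]
      split_ifs <;> simp [form_neg_left, form_neg_right, form_smul_left, form_add_left,
        form_sub_left, form_e, h1, h2, Omega]
    | minus =>
      have h1 : j ≠ i.rev := by rintro rfl; simp [hi, hj, ClanSymbol.rev, ClanSymbol.neg] at hsi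
      have h2 : j ≠ l.rev := by rintro rfl; simp [hl, hj, ClanSymbol.rev, ClanSymbol.neg] at hsl
      simp only [SkewClan.flagVec, hi, hj]
      split_ifs <;> simp [form_neg_left, form_smul_left, form_add_left,
        form_sub_left, form_e, h1, h2, Omega]
    | num k =>
      have hk := γ.matching _ _ hj
      have si : γ.toClan.SigPlus i ↔ l < i := by simp [Clan.SigPlus, hi]
      have sl : γ.toClan.SigPlus l ↔ i < l := by simp [Clan.SigPlus, hl.2]
      have hrl := rev_lt_iff l
      by_cases h1 : j = i.rev
      · subst h1
        have hkl : k = l.rev := by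
          have := hj.symm.trans hsi
          simpa [hi, ClanSymbol.rev, ClanSymbol.neg] using this
        subst hkl
        have e1 : (l.rev = i.rev) ↔ l = i := by simp
        have e2 : (i.rev = l.rev) ↔ i = l := by simp
        have hne : i ≠ l := fun h => hl.1 h.symm
        simp only [SkewClan.flagVec, hi, hj, hcc, Fin.rev_lt_rev, hri]
        rcases lt_or_gt_of_ne hne with hlt | hlt
        · by_cases hin : (i : ℕ) < n <;>
            simp [hlt, hlt.not_gt, hin, form_neg_left, form_neg_right, form_smul_left,
              form_smul_right, form_add_left, form_add_right, form_sub_left, form_sub_right,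
              form_e, Omega, halfSign, si, sl, hne, hl.1] <;>
            first
              | linear_combination 2 * hc
              | linear_combination -2 * hc
        · by_cases hin : (i : ℕ) < n <;>
            simp [hlt, hlt.not_gt, hin, form_neg_left, form_neg_right, form_smul_left,
              form_smul_right, form_add_left, form_add_right, form_sub_left, form_sub_right,
              form_e, Omega, halfSign, si, sl, hne, hl.1] <;>
            first
              | linear_combination 2 * hc
              | linear_combination -2 * hc
      · by_cases h2 : j = l.rev
        · subst h2
          have hkl : k = i.rev := by
            have := hj.symm.trans hsl
            simpa [hl.2, ClanSymbol.rev, ClanSymbol.neg] using this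
          subst hkl
          have hne : i ≠ l := fun h => hl.1 h.symm
          simp only [SkewClan.flagVec, hi, hj, hcc, Fin.rev_lt_rev, hrl]
          rcases lt_or_gt_of_ne hne with hlt | hlt
          · by_cases hin : (i : ℕ) < n <;> by_cases hln : (l : ℕ) < n <;>
              simp [hlt, hlt.not_gt, hin, hln, form_neg_left, form_neg_right, form_smul_left,
                form_smul_right, form_add_left, form_add_right, form_sub_left, form_sub_right,
                form_e, Omega, halfSign, si, sl, hne, hl.1]
          · by_cases hin : (i : ℕ) < n <;> by_cases hln : (l : ℕ) < n <;>
              simp [hlt, hlt.not_gt, hin, hln, form_neg_left, form_neg_right, form_smul_left,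
                form_smul_right, form_add_left, form_add_right, form_sub_left, form_sub_right,
                form_e, Omega, halfSign, si, sl, hne, hl.1]
        · have h3 : k ≠ i.rev := by
            rintro rfl
            apply h2
            have := hk.2.symm.trans hsi
            simpa [hi, ClanSymbol.rev, ClanSymbol.neg] using this
          have h4 : k ≠ l.rev := by
            rintro rfl
            apply h1
            have := hk.2.symm.trans hsl
            simpa [hl.2, ClanSymbol.rev, ClanSymbol.neg] using this
          simp only [SkewClan.flagVec, hi, hj]
          split_ifs <;> simp [form_neg_left, form_neg_right, form_smul_left,
              form_smul_right, form_add_left, form_add_right, form_sub_left, form_sub_right,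
              form_e, Omega, h1, h2, h3, h4]

theorem SkewClan.repMatrix_symplectic {n : ℕ} (γ : SkewClan n) :
    γ.repMatrixᵀ * Omega n * γ.repMatrix = Omega n := by
  ext i j
  rw [← γ.form_flagVec i j, Matrix.mul_assoc]
  rfl

theorem Omega_mul_Omega (n : ℕ) : Omega n * Omega n = -1 := by
  ext i j
  have h := rev_lt_iff i
  rw [Matrix.mul_apply, Finset.sum_eq_single i.rev]
  · by_cases hij : j = i
    · subst hij
      by_cases hi : (j : ℕ) < n <;> simp [Omega, halfSign, h, hi, -Fin.val_rev]
    · simp [Omega, hij, Matrix.one_apply, Ne.symm hij]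
  · intro b _ hb
    simp [Omega, hb]
  · simp

/-- The matrix `g_γ` of the flag that represents a skew-symmetric clan `γ`, as an element
of the symplectic group. -/
def SkewClan.rep {n : ℕ} (γ : SkewClan n) : Sp n :=
  have h : -(Omega n * γ.repMatrixᵀ * Omega n) * γ.repMatrix = 1 := by
    rw [neg_mul, Matrix.mul_assoc, Matrix.mul_assoc, ← Matrix.mul_assoc γ.repMatrixᵀ,
      γ.repMatrix_symplectic, Omega_mul_Omega, neg_neg]
  ⟨⟨γ.repMatrix, -(Omega n * γ.repMatrixᵀ * Omega n), mul_eq_one_comm.mp h, h⟩,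
    γ.repMatrix_symplectic⟩

/-- The `B`-orbit `R_γ = B g_γ⁻¹ L / L` in `G/L`. -/
def SkewClan.orbit {n : ℕ} (γ : SkewClan n) : Set (Sp n ⧸ L n) :=
  MulAction.orbit (B n) ((γ.rep⁻¹ : Sp n) : Sp n ⧸ L n)

/-! ### Schubert cells and sects -/

/-- The subsets `I` of the `2n` indices with `n` elements, no two of which are opposite. -/
def CellIndex (n : ℕ) : Type :=
  {I : Finset (Fin (2 * n)) // I.card = n ∧ ∀ i ∈ I, i.rev ∉ I}

/-- The coordinate subspace `V_I`, spanned by the basis vectors with index in `I`. -/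
def coordSpace {n : ℕ} (I : Set (Fin (2 * n))) : Submodule ℂ (Fin (2 * n) → ℂ) :=
  Submodule.span ℂ (e '' I)

/-- The image of a subspace under an element of the symplectic group. -/
def act {n : ℕ} (g : Sp n) (V : Submodule ℂ (Fin (2 * n) → ℂ)) :
    Submodule ℂ (Fin (2 * n) → ℂ) :=
  V.map (Matrix.mulVecLin (mat g))

/-- The Schubert cell `C_I` in `G/P`: the `B`-orbit of the Lagrangian subspace `V_I`, where the
coset `gP` is identified with the subspace `g E_n`, the image under `g` of the span `E_n` of the
first `n` basis vectors. -/
def schubertCell {n : ℕ} (I : CellIndex n) : Set (Sp n ⧸ P n) :=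
  {x | ∃ g : Sp n, x = (g : Sp n ⧸ P n) ∧
    ∃ b ∈ B n, act g (coordSpace {i | (i : ℕ) < n}) = act b (coordSpace {i | i ∈ I.val})}

/-- The base clan `γ_I`, with `+` at the positions in `I` and `-` elsewhere. -/
def baseClan {n : ℕ} (I : CellIndex n) : Clan (2 * n) := Clan.ofSet {i | i ∈ I.val}

/-- The sect `Σ_I`: the skew-symmetric clans with base clan `γ_I`. -/
def sect {n : ℕ} (I : CellIndex n) : Set (SkewClan n) := {γ | γ.toClan.base = baseClan I}

/-! ### Cell decompositions of `G/L` -/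

/-- The value at `g` of a polynomial in the matrix entries. -/
def evalAt {n : ℕ} (f : MvPolynomial (Fin (2 * n) × Fin (2 * n)) ℂ) (g : Sp n) : ℂ :=
  MvPolynomial.eval (fun ij => mat g ij.1 ij.2) f

/-- Closed subsets of `G/L` in the Zariski topology, which is the quotient of the Zariski
topology of `G`. -/
def IsZariskiClosed {n : ℕ} (Z : Set (Sp n ⧸ L n)) : Prop :=
  ∃ F : Set (MvPolynomial (Fin (2 * n) × Fin (2 * n)) ℂ),
    ∀ g : Sp n, (g : Sp n ⧸ L n) ∈ Z ↔ ∀ f ∈ F, evalAt f g = 0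

/-- A function is regular on a (locally closed) subset `Z` of `G/L` if its pullback to the
preimage of `Z` in `G` is locally a quotient of polynomials in the matrix entries. -/
def IsRegularOn {n : ℕ} (Z : Set (Sp n ⧸ L n)) (u : Sp n ⧸ L n → ℂ) : Prop :=
  ∀ g₀ : Sp n, (g₀ : Sp n ⧸ L n) ∈ Z →
    ∃ p q : MvPolynomial (Fin (2 * n) × Fin (2 * n)) ℂ, evalAt q g₀ ≠ 0 ∧
      ∀ g : Sp n, (g : Sp n ⧸ L n) ∈ Z → evalAt q g ≠ 0 → u g = evalAt p g / evalAt q g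

/-- A (locally closed) subset `Z` of `G/L` is isomorphic to an affine space `ℂ^m`: there
are a morphism `x ↦ Φ(x)L` from `ℂ^m` onto `Z`, where the entries of `Φ(x) ∈ G` are polynomials
in `x`, and an inverse of it whose coordinates are regular functions on `Z`. -/
def IsAffineCell {n : ℕ} (Z : Set (Sp n ⧸ L n)) : Prop :=
  ∃ (m : ℕ) (Φ : (Fin m → ℂ) → Sp n) (ψ : Sp n ⧸ L n → Fin m → ℂ),
    (∀ i j, ∃ p : MvPolynomial (Fin m) ℂ, ∀ x, mat (Φ x) i j = MvPolynomial.eval x p) ∧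
    Set.range (fun x => (Φ x : Sp n ⧸ L n)) = Z ∧
    (∀ x, ψ (Φ x : Sp n ⧸ L n) = x) ∧
    ∀ k, IsRegularOn Z (fun y => ψ y k)

/-- A cell decomposition of `G/L`: a partition into finitely many subsets isomorphic to affine
spaces that can be enumerated so that the union of the first `k` of them is Zariski closed
for every `k` (so that each of them is locally closed). -/
def IsCellDecomposition {n : ℕ} {ι : Type} (C : ι → Set (Sp n ⧸ L n)) : Prop :=
  Finite ι ∧ Pairwise (fun i j => Disjoint (C i) (C j)) ∧ ⋃ i, C i = Set.univ ∧
    (∀ i, IsAffineCell (C i)) ∧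
    ∃ r : ι → ℕ, Function.Injective r ∧ ∀ k, IsZariskiClosed (⋃ i ∈ {i | r i < k}, C i)

end CI

end

noncomputable section

namespace CI

variable {n : ℕ}

/-! ### Symplectic matrices -/

/-! Let s be `stdInvol n`. Since L is the centralizer of s, a coset gL is the same as the involution
X = g s g⁻¹, that is, an ordered pair of complementary Lagrangians; π forgets the (-1)-eigenspace.

Write V_I' for the coordinate complement of V_I. Points of C_I are reached by unipotents 1 + A with
A : V_I → V_I' strictly upper triangular and ΩA symmetric. The Lagrangian complements of V_I are
reached by 1 + D with D : V_I' → V_I and ΩD symmetric. So each point over C_I has the form (1 + A)(1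
+ D) w_I L (`exists_normal_form`). Here A and D are unique: the entries of A are ratios of Plücker
coordinates and those of D are, up to a factor, entries of X. Hence the preimage of C_I is an affine
space (`isAffineCell_preimage`). Give the row index i the weight 2^i. Over C_I the coordinate of I
does not vanish, while all coordinates of larger weight do. So the coordinates of weight at least k
cut out the union of the preimages of the cells of weight below k (`isZariskiClosed_union`), and
binary expansions show that distinct cells have distinct weights. This gives (2) as soon as (1) is
known.

For (1), let γ be in Σ_I. The involution M of g_γ⁻¹L is monomial. Let E and F be its parts that send
first occurrences to second ones and back. First occurrences lie outside I and second ones in I, and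
M = (1 + F)(`I.invol` + E)(1 - F) (`SkewClan.conj_involMat`). As F is strictly upper triangular, 1 +
F is in B; so R_γ lies over C_I and contains the normal form with A = 0, D = -E/2. Conversely, B
removes A from any normal form. A Levi part of B then acts on ΩD by congruence with upper triangular
matrices, and complex symmetric matrices are thereby reduced to partial matchings
(`exists_congruence_isMatching`). Entries of D above the diagonal are absorbed by B, and what
remains is -E/2 for a clan in Σ_I (`exists_mem_orbit`). Finally, if an element of B conjugates the
monomial matrix of one clan into that of another, triangularity forces equal pairings, as in the
uniqueness part of the Bruhat decomposition (`SkewClan.eq_of_mem_orbit`). -/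

theorem halfSign_mul_self (i : Fin (2 * n)) : halfSign n i * halfSign n i = 1 := by
  unfold halfSign; split_ifs <;> simp

theorem halfSign_ne_zero (i : Fin (2 * n)) : halfSign n i ≠ 0 := by
  unfold halfSign; split_ifs <;> simp

theorem halfSign_rev (i : Fin (2 * n)) : halfSign n i.rev = -halfSign n i := by
  have h := rev_lt_iff i
  unfold halfSign
  by_cases hi : (i : ℕ) < n <;> simp [h, hi, -Fin.val_rev]

theorem eq_rev_comm (a b : Fin (2 * n)) : a = b.rev ↔ b = a.rev := by
  constructor <;> (rintro rfl; simp)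

theorem Omega_mul_apply (M : Matrix (Fin (2 * n)) (Fin (2 * n)) ℂ) (i j) :
    (Omega n * M) i j = halfSign n i * M i.rev j := by
  rw [Matrix.mul_apply, Finset.sum_eq_single i.rev]
  · simp [Omega]
  · intro b _ hb; simp [Omega, hb]
  · simp

theorem mul_Omega_apply (M : Matrix (Fin (2 * n)) (Fin (2 * n)) ℂ) (i j) :
    (M * Omega n) i j = -halfSign n j * M i j.rev := by
  rw [Matrix.mul_apply, Finset.sum_eq_single j.rev]
  · simp [Omega, halfSign_rev, mul_comm]
  · intro b _ hb
    have : j ≠ b.rev := fun h => hb ((eq_rev_comm j b).mp h)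
    simp [Omega, this]
  · simp

theorem Omega_transpose (n : ℕ) : (Omega n)ᵀ = -Omega n := by
  ext i j
  by_cases h : i = j.rev
  · subst h; simp [Omega, halfSign_rev]
  · have : j ≠ i.rev := fun h' => h ((eq_rev_comm j i).mp h')
    simp [Omega, h, this]

theorem Omega_mul_Omega_mul (M : Matrix (Fin (2 * n)) (Fin (2 * n)) ℂ) :
    Omega n * (Omega n * M) = -M := by
  rw [← Matrix.mul_assoc, Omega_mul_Omega]; simp

/-- The element of the symplectic group with a given matrix. -/
def ofMat (M : Matrix (Fin (2 * n)) (Fin (2 * n)) ℂ) (hM : Mᵀ * Omega n * M = Omega n) : Sp n :=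
  have h : -(Omega n * Mᵀ * Omega n) * M = 1 := by
    rw [neg_mul, Matrix.mul_assoc, Matrix.mul_assoc, ← Matrix.mul_assoc Mᵀ, hM, Omega_mul_Omega,
      neg_neg]
  ⟨⟨M, -(Omega n * Mᵀ * Omega n), mul_eq_one_comm.mp h, h⟩, hM⟩

theorem mat_injective {g h : Sp n} (H : mat g = mat h) : g = h :=
  Subtype.ext (Units.ext H)

theorem mat_mul (g h : Sp n) : mat (g * h) = mat g * mat h := rfl

theorem mat_one : mat (1 : Sp n) = 1 := rfl

theorem mat_mul_mat_inv (g : Sp n) : mat g * mat g⁻¹ = 1 := by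
  rw [← mat_mul, mul_inv_cancel, mat_one]

theorem mat_inv_mul_mat (g : Sp n) : mat g⁻¹ * mat g = 1 := by
  rw [← mat_mul, inv_mul_cancel, mat_one]

theorem transpose_mul_Omega_mul (g : Sp n) : (mat g)ᵀ * Omega n * mat g = Omega n := g.2

theorem mat_inv (g : Sp n) : mat g⁻¹ = -(Omega n * (mat g)ᵀ * Omega n) := by
  have h : -(Omega n * (mat g)ᵀ * Omega n) * mat g = 1 := by
    rw [neg_mul, Matrix.mul_assoc, Matrix.mul_assoc, ← Matrix.mul_assoc (mat g)ᵀ,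
      transpose_mul_Omega_mul, Omega_mul_Omega, neg_neg]
  exact (left_inv_eq_right_inv h (mat_mul_mat_inv g)).symm

/-! ### The involution attached to a point of `G/L` -/

/-- The matrix of the involution that is `1` on `E_n` and `-1` on the opposite coordinate
subspace. -/
def stdInvol (n : ℕ) : Matrix (Fin (2 * n)) (Fin (2 * n)) ℂ := Matrix.diagonal (halfSign n)

theorem mem_L_iff_commute (g : Sp n) : g ∈ L n ↔ stdInvol n * mat g = mat g * stdInvol n := by
  rw [mem_L, ← Matrix.ext_iff]
  refine forall_congr' fun i => forall_congr' fun j => ?_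
  rw [stdInvol, Matrix.diagonal_mul, Matrix.mul_diagonal]
  unfold halfSign
  by_cases hi : (i : ℕ) < n <;> by_cases hj : (j : ℕ) < n <;> simp [hi, hj]
  · rw [eq_neg_iff_add_eq_zero, ← two_mul]; simp
  · rw [neg_eq_iff_add_eq_zero, ← two_mul]; simp

/-- The involution with eigenspaces `g E_n` and `g E_n'`. -/
def invol (g : Sp n) : Matrix (Fin (2 * n)) (Fin (2 * n)) ℂ := mat g * stdInvol n * mat g⁻¹

theorem invol_mul (b g : Sp n) : invol (b * g) = mat b * invol g * mat b⁻¹ := by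
  simp only [invol, mul_inv_rev, mat_mul, Matrix.mul_assoc]

theorem invol_mul_mat (g : Sp n) : invol g * mat g = mat g * stdInvol n := by
  rw [invol, Matrix.mul_assoc, mat_inv_mul_mat, Matrix.mul_one]

theorem invol_eq_of_mul_eq {g : Sp n} {X : Matrix (Fin (2 * n)) (Fin (2 * n)) ℂ}
    (h : X * mat g = mat g * stdInvol n) : invol g = X := by
  rw [invol, ← h, Matrix.mul_assoc, mat_mul_mat_inv, Matrix.mul_one]

/-- Holds because L is the centralizer of `stdInvol n`. It replaces every later comparison of cosets
by an identity of matrices. -/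
theorem mk_eq_mk_iff (g h : Sp n) :
    (g : Sp n ⧸ L n) = (h : Sp n ⧸ L n) ↔ invol g = invol h := by
  rw [QuotientGroup.eq, mem_L_iff_commute]
  constructor
  · intro H
    have : h = g * (g⁻¹ * h) := by group
    refine (invol_eq_of_mul_eq ?_).symm
    rw [this, mat_mul, ← Matrix.mul_assoc, invol_mul_mat, Matrix.mul_assoc, H, Matrix.mul_assoc]
  · intro H
    have h1 := invol_mul_mat h
    rw [← H, invol] at h1
    have h2 := congrArg (fun M => mat g⁻¹ * M) h1
    simp only [← Matrix.mul_assoc, mat_inv_mul_mat, Matrix.one_mul] at h2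
    rw [mat_mul, ← Matrix.mul_assoc, h2]

theorem stdInvol_mul_Omega (n : ℕ) : stdInvol n * Omega n = -(Omega n * stdInvol n) := by
  ext i j
  rw [mul_Omega_apply, Matrix.neg_apply, Omega_mul_apply, stdInvol]
  by_cases h : i = j.rev
  · subst h; simp [halfSign_rev]
  · have : i.rev ≠ j := fun h' => h ((eq_rev_comm j i).mp h'.symm)
    simp [h, this]

/-- The inverse of a symplectic matrix is linear in its entries, so the involution is quadratic in
g; this makes its entries polynomial functions on G. -/
theorem invol_eq (g : Sp n) : invol g = mat g * (Omega n * stdInvol n) * (mat g)ᵀ * Omega n := by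
  rw [invol, mat_inv]
  simp only [Matrix.mul_neg, Matrix.mul_assoc]
  rw [← Matrix.mul_assoc (stdInvol n), stdInvol_mul_Omega]
  simp [Matrix.mul_assoc]

/-- In other words, the involution lies in the symplectic Lie algebra: its two eigenspaces are
Lagrangian. -/
theorem Omega_mul_invol_isSymm (g : Sp n) : (Omega n * invol g).IsSymm := by
  rw [Matrix.IsSymm, invol_eq]
  have h : (stdInvol n)ᵀ = stdInvol n := Matrix.diagonal_transpose _
  simp only [Matrix.transpose_mul, Matrix.transpose_transpose, Omega_transpose, h,
    Matrix.mul_neg, Matrix.neg_mul, neg_neg, Matrix.mul_assoc]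
  rw [← Matrix.mul_assoc (stdInvol n), stdInvol_mul_Omega]
  simp [Matrix.mul_assoc]

/-! ### Unipotent elements of square zero -/

/-- The element `1 + A` of the symplectic group, where `A` is in the symplectic Lie algebra and
`A ^ 2 = 0`. -/
def unip (A : Matrix (Fin (2 * n)) (Fin (2 * n)) ℂ) (hA : (Omega n * A).IsSymm) (hA2 : A * A = 0) :
    Sp n :=
  ofMat (1 + A) (by
    have h : Aᵀ * Omega n = -(Omega n * A) := by
      have := hA.eq
      rw [Matrix.transpose_mul, Omega_transpose, Matrix.mul_neg] at this
      rw [← this, neg_neg]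
    rw [Matrix.transpose_add, Matrix.transpose_one, Matrix.add_mul, h]
    simp only [Matrix.one_mul, Matrix.mul_add, Matrix.add_mul, Matrix.mul_one, Matrix.neg_mul,
      Matrix.mul_assoc, hA2]
    simp)

@[simp] theorem mat_unip (A : Matrix (Fin (2 * n)) (Fin (2 * n)) ℂ) (hA hA2) :
    mat (unip A hA hA2) = 1 + A := rfl

theorem mat_unip_inv (A : Matrix (Fin (2 * n)) (Fin (2 * n)) ℂ) (hA hA2) :
    mat (unip A hA hA2)⁻¹ = 1 - A := by
  have h : (1 - A) * mat (unip A hA hA2) = 1 := by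
    rw [mat_unip, Matrix.sub_mul, Matrix.mul_add, Matrix.mul_add, hA2]; simp
  exact (left_inv_eq_right_inv h (mat_mul_mat_inv _)).symm

theorem unip_mem_B (A : Matrix (Fin (2 * n)) (Fin (2 * n)) ℂ) (hA hA2)
    (h : ∀ i j, A i j ≠ 0 → i < j) : unip A hA hA2 ∈ B n := by
  rw [mem_B]
  intro i j hij
  have h1 : A i j = 0 := by
    by_contra H; exact absurd (h i j H) hij.not_gt
  simp [h1, hij.ne']

/-! ### Coordinate Lagrangian subspaces -/

/-- I and its reversal are disjoint and have n elements each, so together they exhaust the 2n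
indices. -/
theorem CellIndex.mem_rev (I : CellIndex n) (i : Fin (2 * n)) : i.rev ∈ I.val ↔ i ∉ I.val := by
  refine ⟨fun h h' => I.2.2 _ h' h, fun h => ?_⟩
  have hd : Disjoint I.val (I.val.map Fin.revPerm.toEmbedding) := by
    rw [Finset.disjoint_left]
    intro a ha hb
    obtain ⟨b, hb', rfl⟩ := Finset.mem_map.mp hb
    exact I.2.2 b hb' ha
  have hu : I.val ∪ I.val.map Fin.revPerm.toEmbedding = Finset.univ := by
    apply Finset.eq_univ_of_card
    rw [Finset.card_union_of_disjoint hd, Finset.card_map, I.2.1, Fintype.card_fin, two_mul]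
  have := hu ▸ Finset.mem_univ i
  rcases Finset.mem_union.mp this with h1 | h1
  · exact absurd h1 h
  · obtain ⟨b, hb, rfl⟩ := Finset.mem_map.mp h1
    simpa using hb

/-- The projection onto `V_I` along the complementary coordinate subspace. -/
def CellIndex.ind (I : CellIndex n) : Matrix (Fin (2 * n)) (Fin (2 * n)) ℂ :=
  Matrix.diagonal fun i => if i ∈ I.val then 1 else 0

theorem CellIndex.ind_mul_apply (I : CellIndex n) (M : Matrix (Fin (2 * n)) (Fin (2 * n)) ℂ) (i j) :
    (I.ind * M) i j = if i ∈ I.val then M i j else 0 := by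
  simp [CellIndex.ind]

theorem CellIndex.mul_ind_apply (I : CellIndex n) (M : Matrix (Fin (2 * n)) (Fin (2 * n)) ℂ) (i j) :
    (M * I.ind) i j = if j ∈ I.val then M i j else 0 := by
  simp [CellIndex.ind]

/-- The permutation of the indices that exchanges `i` and `2n+1-i` if necessary, so that the
first `n` indices are mapped to `I`. -/
def CellIndex.perm (I : CellIndex n) (i : Fin (2 * n)) : Fin (2 * n) :=
  if i ∈ I.val ↔ (i : ℕ) < n then i else i.rev

theorem CellIndex.perm_mem (I : CellIndex n) (i : Fin (2 * n)) :
    I.perm i ∈ I.val ↔ (i : ℕ) < n := by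
  unfold CellIndex.perm
  have := I.mem_rev i
  split_ifs with h <;> tauto

theorem CellIndex.perm_rev (I : CellIndex n) (i : Fin (2 * n)) :
    I.perm i.rev = (I.perm i).rev := by
  have h1 := I.mem_rev i
  have h2 := rev_lt_iff i
  unfold CellIndex.perm
  by_cases h : i ∈ I.val ↔ (i : ℕ) < n
  · rw [if_pos h, if_pos (by tauto)]
  · rw [if_neg h, if_neg (by tauto)]

theorem CellIndex.perm_lt (I : CellIndex n) (i : Fin (2 * n)) :
    (I.perm i : ℕ) < n ↔ i ∈ I.val := by
  have h2 := rev_lt_iff i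
  unfold CellIndex.perm
  split_ifs with h <;> tauto

theorem CellIndex.perm_perm (I : CellIndex n) (i : Fin (2 * n)) : I.perm (I.perm i) = i := by
  by_cases h : i ∈ I.val ↔ (i : ℕ) < n
  · have : I.perm i = i := if_pos h
    rw [this, this]
  · have h' : I.perm i = i.rev := if_neg h
    rw [h', I.perm_rev, h', Fin.rev_rev]

theorem CellIndex.perm_injective (I : CellIndex n) : Function.Injective I.perm :=
  Function.LeftInverse.injective I.perm_perm

/-- The sign of the nonzero entry in a column of the matrix `w_I`. -/
def CellIndex.sign (I : CellIndex n) (i : Fin (2 * n)) : ℂ :=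
  if n ≤ (i : ℕ) ∧ i ∈ I.val then -1 else 1

/-- The sign condition under which the monomial matrix `wMatrix` preserves Ω. -/
theorem CellIndex.sign_mul_sign_rev (I : CellIndex n) (i : Fin (2 * n)) :
    I.sign i * (halfSign n (I.perm i) * I.sign i.rev) = halfSign n i := by
  have h1 := I.mem_rev i
  have h2 := rev_lt_iff i
  have h3 := I.perm_lt i
  unfold CellIndex.sign halfSign
  by_cases hi : (i : ℕ) < n <;> by_cases hI : i ∈ I.val <;>
    simp [hi, hI, h1, h2, h3, not_lt.mp, -Fin.val_rev, ← not_lt]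

/-- The monomial matrix that represents `w_I`. -/
def CellIndex.wMatrix (I : CellIndex n) : Matrix (Fin (2 * n)) (Fin (2 * n)) ℂ :=
  Matrix.of fun k i => if k = I.perm i then I.sign i else 0

theorem CellIndex.mul_wMatrix_apply {α : Type} [Fintype α] (I : CellIndex n)
    (M : Matrix α (Fin (2 * n)) ℂ) (i j) :
    (M * I.wMatrix) i j = M i (I.perm j) * I.sign j := by
  rw [Matrix.mul_apply, Finset.sum_eq_single (I.perm j)]
  · simp [CellIndex.wMatrix]
  · intro b _ hb; simp [CellIndex.wMatrix, hb]
  · simp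

theorem CellIndex.wMatrix_symplectic (I : CellIndex n) :
    I.wMatrixᵀ * Omega n * I.wMatrix = Omega n := by
  ext i j
  rw [I.mul_wMatrix_apply, mul_Omega_apply, Matrix.transpose_apply, ← I.perm_rev]
  by_cases h : j = i.rev
  · subst h
    have := I.sign_mul_sign_rev i
    simp only [CellIndex.wMatrix, Omega, Matrix.of_apply, I.perm_rev, halfSign_rev, Fin.rev_rev,
      if_true, neg_neg]
    rw [← this]; ring
  · have h' : I.perm j.rev ≠ I.perm i := fun H =>
      h ((eq_rev_comm i j).mp (I.perm_injective H).symm)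
    simp [CellIndex.wMatrix, Omega, h, h']

/-- The element `w_I` of the symplectic group, which maps `E_n` to `V_I`. -/
def CellIndex.w (I : CellIndex n) : Sp n := ofMat I.wMatrix I.wMatrix_symplectic

/-- The involution that is `1` on `V_I` and `-1` on the complementary coordinate subspace. -/
def CellIndex.invol (I : CellIndex n) : Matrix (Fin (2 * n)) (Fin (2 * n)) ℂ := 2 * I.ind - 1

theorem CellIndex.invol_w (I : CellIndex n) : CI.invol I.w = I.invol := by
  apply invol_eq_of_mul_eq
  ext i j
  have h1 : mat I.w = I.wMatrix := rfl
  have h2 := I.perm_mem j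
  rw [h1, stdInvol, Matrix.mul_diagonal, I.mul_wMatrix_apply]
  simp only [CellIndex.invol, CellIndex.ind, CellIndex.wMatrix, Matrix.of_apply, two_mul]
  by_cases h : i = I.perm j
  · subst h
    by_cases hj : (j : ℕ) < n <;> simp [h2, hj, halfSign]
  · simp [h]

/-! ### Plücker coordinates -/

/-- The inclusion of the first `n` indices. -/
def firstIdx (n : ℕ) (c : Fin n) : Fin (2 * n) := ⟨c, by have := c.isLt; omega⟩

theorem firstIdx_injective (n : ℕ) : Function.Injective (firstIdx n) := by
  intro a b h
  simpa [firstIdx, Fin.ext_iff] using h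

/-- The Plücker coordinate of the Lagrangian subspace `g E_n` for the rows listed by `f`. -/
def plu (f : Fin n → Fin (2 * n)) (g : Sp n) : ℂ := ((mat g).submatrix f (firstIdx n)).det

/-- The weight of a list of rows; Plücker coordinates are compared by their weights. -/
def weight (f : Fin n → Fin (2 * n)) : ℕ := ∑ a, 2 ^ (f a : ℕ)

theorem sum_eq_sum_first (F : Fin (2 * n) → ℂ) (hF : ∀ i : Fin (2 * n), n ≤ (i : ℕ) → F i = 0) :
    ∑ i, F i = ∑ c, F (firstIdx n c) := by
  refine Eq.trans ?_ (Finset.sum_map Finset.univ ⟨firstIdx n, firstIdx_injective n⟩ F)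
  symm
  apply Finset.sum_subset (Finset.subset_univ _)
  intro i _ hi
  apply hF
  by_contra h
  exact hi (Finset.mem_map.mpr ⟨⟨i, not_le.mp h⟩, Finset.mem_univ _, rfl⟩)

/-- Right multiplication by P recombines the first n columns among themselves. Hence all Plücker
coordinates are scaled by one common factor. -/
theorem submatrix_mul_mem_P {α : Type} (f : α → Fin (2 * n)) (g p : Sp n) (hp : p ∈ P n) :
    (mat (g * p)).submatrix f (firstIdx n) =
      (mat g).submatrix f (firstIdx n) * (mat p).submatrix (firstIdx n) (firstIdx n) := by
  ext a c
  rw [mat_mul, Matrix.submatrix_apply, Matrix.mul_apply, sum_eq_sum_first, Matrix.mul_apply]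
  · rfl
  · intro i hi
    rw [(mem_P p).mp hp i (firstIdx n c) hi c.isLt, mul_zero]

theorem plu_mul_mem_P (f : Fin n → Fin (2 * n)) (g p : Sp n) (hp : p ∈ P n) :
    plu f (g * p) = plu f g * plu (firstIdx n) p := by
  rw [plu, submatrix_mul_mem_P f g p hp, Matrix.det_mul]; rfl

theorem plu_firstIdx_one : plu (firstIdx n) (1 : Sp n) = 1 := by
  rw [plu, mat_one, Matrix.submatrix_one _ (firstIdx_injective n), Matrix.det_one]

theorem plu_firstIdx_ne_zero (p : Sp n) (hp : p ∈ P n) : plu (firstIdx n) p ≠ 0 := by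
  intro h
  have := plu_mul_mem_P (firstIdx n) p p⁻¹ ((P n).inv_mem hp)
  rw [mul_inv_cancel, plu_firstIdx_one, h, zero_mul] at this
  exact one_ne_zero this

/-- The enumeration of `I` by the columns of `w_I`. -/
def CellIndex.enum (I : CellIndex n) (c : Fin n) : Fin (2 * n) := I.perm (firstIdx n c)

theorem CellIndex.enum_injective (I : CellIndex n) : Function.Injective I.enum :=
  I.perm_injective.comp (firstIdx_injective n)

theorem CellIndex.enum_mem (I : CellIndex n) (c : Fin n) : I.enum c ∈ I.val :=
  (I.perm_mem _).mpr c.isLt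

theorem CellIndex.image_enum (I : CellIndex n) : Finset.univ.image I.enum = I.val := by
  apply Finset.eq_of_subset_of_card_le
  · intro i hi
    obtain ⟨c, _, rfl⟩ := Finset.mem_image.mp hi
    exact I.enum_mem c
  · rw [Finset.card_image_of_injective _ I.enum_injective, I.2.1]; simp

theorem CellIndex.sign_firstIdx (I : CellIndex n) (c : Fin n) : I.sign (firstIdx n c) = 1 :=
  if_neg fun h => absurd h.1 (not_le.mpr c.isLt)

theorem plu_mul_w (f : Fin n → Fin (2 * n)) (g : Sp n) (I : CellIndex n) :
    plu f (g * I.w) = ((mat g).submatrix f I.enum).det := by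
  rw [plu]
  congr 1
  ext a c
  have : mat (g * I.w) = mat g * I.wMatrix := rfl
  rw [this, Matrix.submatrix_apply, I.mul_wMatrix_apply, I.sign_firstIdx, mul_one]; rfl

/-- A determinant that does not vanish has a permutation with nonvanishing term. -/
theorem exists_perm_of_det_ne_zero {m : ℕ} {M : Matrix (Fin m) (Fin m) ℂ} (h : M.det ≠ 0) :
    ∃ s : Equiv.Perm (Fin m), ∀ i, M (s i) i ≠ 0 := by
  by_contra! H
  apply h
  rw [Matrix.det_apply]
  apply Finset.sum_eq_zero
  intro s _
  obtain ⟨i, hi⟩ := H s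
  have h0 : ∏ i, M (s i) i = 0 := Finset.prod_eq_zero (Finset.mem_univ i) hi
  rw [h0, smul_zero]

/-- A permutation preserves the sum of the values of f, so no term can drop strictly. -/
theorem perm_eq_one_of_le {α : Type} [Fintype α] {N : ℕ} {f : α → Fin N}
    (hf : Function.Injective f) {s : Equiv.Perm α} (h : ∀ c, f (s c) ≤ f c) : s = 1 := by
  have h1 : ∑ c, (f (s c)).val = ∑ c, (f c).val := Equiv.sum_comp s fun c => (f c).val
  have h2 := (Finset.sum_eq_sum_iff_of_le (f := fun c => (f (s c)).val) (g := fun c => (f c).val)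
    fun c _ => h c).mp h1
  ext c
  have := hf (Fin.ext (h2 c (Finset.mem_univ c)))
  rw [this]; rfl

/-- Up to a scalar the coordinate is a minor of b with columns in I. A nonzero term of its expansion
matches each row with a column that is at least as large, as b is upper triangular. -/
theorem weight_le_of_plu_ne_zero {f : Fin n → Fin (2 * n)} {b p : Sp n} (hb : b ∈ B n)
    (hp : p ∈ P n) {I : CellIndex n} (h : plu f (b * I.w * p) ≠ 0) : weight f ≤ weight I.enum := by
  rw [plu_mul_mem_P f _ p hp, plu_mul_w] at h
  obtain ⟨s, hs⟩ := exists_perm_of_det_ne_zero (left_ne_zero_of_mul h)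
  rw [weight, ← Equiv.sum_comp s]
  refine Finset.sum_le_sum fun c _ => Nat.pow_le_pow_right (by norm_num) ?_
  by_contra hc
  exact hs c ((mem_B b).mp hb _ _ (not_le.mp hc))

theorem diag_ne_zero {b : Sp n} (hb : b ∈ B n) (i : Fin (2 * n)) : mat b i i ≠ 0 := by
  have h : (mat b).BlockTriangular id := fun i j hij => (mem_B b).mp hb i j hij
  have h1 := Matrix.det_of_isUpperTriangular h
  have h2 : (mat b).det ≠ 0 := by
    intro h0
    have := congrArg Matrix.det (mat_mul_mat_inv b)
    rw [Matrix.det_mul, h0, zero_mul, Matrix.det_one] at this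
    exact zero_ne_one this
  rw [h1] at h2
  exact (Finset.prod_ne_zero_iff.mp h2) i (Finset.mem_univ i)

/-- Only the identity permutation contributes to this minor of b, and it contributes a product of
diagonal entries. -/
theorem plu_enum_ne_zero {b p : Sp n} (hb : b ∈ B n) (hp : p ∈ P n) (I : CellIndex n) :
    plu I.enum (b * I.w * p) ≠ 0 := by
  rw [plu_mul_mem_P _ _ p hp, plu_mul_w]
  refine mul_ne_zero ?_ (plu_firstIdx_ne_zero p hp)
  rw [Matrix.det_apply, Finset.sum_eq_single 1]
  · simp only [Equiv.Perm.sign_one, one_smul, Equiv.Perm.one_apply, Matrix.submatrix_apply]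
    exact Finset.prod_ne_zero_iff.mpr fun c _ => diag_ne_zero hb _
  · intro s _ hs
    have : ∃ c, I.enum c < I.enum (s c) := by
      by_contra! H
      exact hs (perm_eq_one_of_le I.enum_injective H)
    obtain ⟨c, hc⟩ := this
    rw [Finset.prod_eq_zero (Finset.mem_univ c) ((mem_B b).mp hb _ _ hc), smul_zero]
  · simp

theorem weight_enum (I : CellIndex n) : weight I.enum = ∑ i ∈ I.val, 2 ^ (i : ℕ) := by
  rw [← I.image_enum, Finset.sum_image fun a _ b _ h => I.enum_injective h]; rfl

/-- Uniqueness of binary expansions. -/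
theorem weight_enum_injective : Function.Injective fun I : CellIndex n => weight I.enum := by
  intro I J h
  simp only [weight_enum] at h
  have key : ∀ K : CellIndex n, ∑ i ∈ K.val, 2 ^ (i : ℕ) =
      ∑ k ∈ K.val.map Fin.valEmbedding, 2 ^ k := by
    intro K; rw [Finset.sum_map]; rfl
  rw [key, key] at h
  exact Subtype.ext (Finset.map_injective _ (Finset.geomSum_injective le_rfl h))

/-! ### Schubert cells -/

theorem act_mul (g h : Sp n) (V : Submodule ℂ (Fin (2 * n) → ℂ)) : act (g * h) V = act g (act h V) := by
  rw [act, act, act, ← Submodule.map_comp, mat_mul, Matrix.mulVecLin_mul]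

theorem act_one (V : Submodule ℂ (Fin (2 * n) → ℂ)) : act 1 V = V := by
  rw [act, mat_one, Matrix.mulVecLin_one, Submodule.map_id]

theorem mem_coordSpace (I : Set (Fin (2 * n))) (v : Fin (2 * n) → ℂ) :
    v ∈ coordSpace I ↔ ∀ i, i ∉ I → v i = 0 := by
  constructor
  · intro hv i hi
    induction hv using Submodule.span_induction with
    | mem x hx =>
      obtain ⟨j, hj, rfl⟩ := hx
      exact Pi.single_eq_of_ne (by rintro rfl; exact hi hj) _
    | zero => rfl
    | add x y _ _ hx hy => simp [hx, hy]
    | smul a x _ hx => simp [hx]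
  · intro h
    rw [pi_eq_sum_univ' v]
    refine Submodule.sum_mem _ fun i _ => ?_
    by_cases hi : i ∈ I
    · refine Submodule.smul_mem _ _ (Submodule.subset_span ⟨i, hi, ?_⟩)
      ext j; simp [e, Pi.single_apply, eq_comm]
    · rw [h i hi, zero_smul]; exact Submodule.zero_mem _

theorem mat_mulVec_e (g : Sp n) (j : Fin (2 * n)) : mat g *ᵥ e j = fun i => mat g i j := by
  ext i; simp [e]

theorem act_w (I : CellIndex n) :
    act I.w (coordSpace {i | (i : ℕ) < n}) = coordSpace {i | i ∈ I.val} := by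
  apply le_antisymm
  · rw [act, coordSpace, Submodule.map_span_le]
    rintro _ ⟨j, hj, rfl⟩
    rw [Matrix.mulVecLin_apply, mat_mulVec_e, mem_coordSpace]
    intro i hi
    refine if_neg ?_
    rintro rfl
    exact hi ((I.perm_mem j).mpr hj)
  · rw [coordSpace, Submodule.span_le]
    rintro _ ⟨j, hj, rfl⟩
    refine ⟨e (I.perm j), Submodule.subset_span ⟨_, (I.perm_lt j).mpr hj, rfl⟩, ?_⟩
    rw [Matrix.mulVecLin_apply, mat_mulVec_e]
    have h1 : I.sign (I.perm j) = 1 :=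
      if_neg fun h => absurd h.1 (not_le.mpr ((I.perm_lt j).mpr hj))
    ext i
    have : mat I.w i (I.perm j) = if i = I.perm (I.perm j) then I.sign (I.perm j) else 0 := rfl
    rw [this, h1, I.perm_perm]
    simp [e, Pi.single_apply]

theorem mem_P_iff_act (p : Sp n) :
    p ∈ P n ↔ act p (coordSpace {i | (i : ℕ) < n}) = coordSpace {i | (i : ℕ) < n} := by
  have key : ∀ p ∈ P n, act p (coordSpace {i | (i : ℕ) < n}) ≤ coordSpace {i | (i : ℕ) < n} := by
    intro p hp
    rw [act]
    conv_lhs => rw [coordSpace]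
    rw [Submodule.map_span_le]
    rintro _ ⟨j, hj, rfl⟩
    rw [Matrix.mulVecLin_apply, mat_mulVec_e, mem_coordSpace]
    intro i hi
    exact (mem_P p).mp hp i j (not_lt.mp hi) hj
  constructor
  · intro hp
    refine le_antisymm (key p hp) ?_
    have := Submodule.map_mono (f := Matrix.mulVecLin (mat p)) (key p⁻¹ ((P n).inv_mem hp))
    change act p (act p⁻¹ _) ≤ _ at this
    rwa [← act_mul, mul_inv_cancel, act_one] at this
  · intro h
    rw [mem_P]
    intro i j hi hj
    have h1 : mat p *ᵥ e j ∈ coordSpace {i : Fin (2 * n) | (i : ℕ) < n} := by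
      rw [← h]
      exact ⟨e j, Submodule.subset_span ⟨j, hj, rfl⟩, rfl⟩
    rw [mat_mulVec_e, mem_coordSpace] at h1
    exact h1 i (not_lt.mpr hi)

/-- The preimage in `G` of a Schubert cell is a double coset. -/
theorem mk_mem_preimage_schubertCell (g : Sp n) (I : CellIndex n) :
    (g : Sp n ⧸ L n) ∈ proj n ⁻¹' schubertCell I ↔ ∃ b ∈ B n, ∃ p ∈ P n, g = b * I.w * p := by
  have h0 : proj n (g : Sp n ⧸ L n) = (g : Sp n ⧸ P n) := rfl
  rw [Set.mem_preimage, h0]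
  constructor
  · rintro ⟨g', hg, b, hb, h⟩
    refine ⟨b, hb, (b * I.w)⁻¹ * g, ?_, by group⟩
    have h1 : g'⁻¹ * g ∈ P n := QuotientGroup.eq.mp hg.symm
    have h2 : (b * I.w)⁻¹ * g' ∈ P n := by
      rw [mem_P_iff_act, act_mul, h, ← act_w I, ← act_mul, ← act_mul]
      rw [mul_assoc, inv_mul_cancel, act_one]
    have := (P n).mul_mem h2 h1
    rwa [show (b * I.w)⁻¹ * g' * (g'⁻¹ * g) = (b * I.w)⁻¹ * g by group] at this
  · rintro ⟨b, hb, p, hp, rfl⟩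
    refine ⟨_, rfl, b, hb, ?_⟩
    rw [act_mul, (mem_P_iff_act p).mp hp, act_mul, act_w]

/-! ### Echelon form -/

/-- Cauchy–Binet in a weak form: 1 is the determinant of the product of the first n rows of g⁻¹ with
the first n columns of g. Multilinear expansion in the rows writes it as a combination of Plücker
coordinates of g. -/
theorem exists_plu_ne_zero (g : Sp n) : ∃ f, plu f g ≠ 0 := by
  by_contra! H
  have h : ((mat g⁻¹).submatrix (firstIdx n) id * (mat g).submatrix id (firstIdx n)).det = 1 := by
    have : (mat g⁻¹).submatrix (firstIdx n) id * (mat g).submatrix id (firstIdx n) =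
        (mat g⁻¹ * mat g).submatrix (firstIdx n) (firstIdx n) := rfl
    rw [this, mat_inv_mul_mat, Matrix.submatrix_one _ (firstIdx_injective n), Matrix.det_one]
  have h2 : (mat g⁻¹).submatrix (firstIdx n) id * (mat g).submatrix id (firstIdx n) =
      fun a => ∑ k, mat g⁻¹ (firstIdx n a) k • fun c => mat g k (firstIdx n c) := by
    ext a c
    simp [Matrix.mul_apply]
  have h3 := (Matrix.detRowAlternating (R := ℂ) (n := Fin n)).toMultilinearMap.map_sum
    (fun a k => mat g⁻¹ (firstIdx n a) k • fun c => mat g k (firstIdx n c))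
  rw [h2] at h
  change Matrix.detRowAlternating _ = (1 : ℂ) at h
  refine zero_ne_one (α := ℂ) ?_
  rw [← h]
  refine (h3.trans (Finset.sum_eq_zero fun f _ => ?_)).symm
  rw [MultilinearMap.map_smul_univ]
  have := H f
  rw [plu] at this
  change _ • ((mat g).submatrix f (firstIdx n)).det = 0
  rw [this, smul_zero]

theorem det_one_updateRow {m : ℕ} (b : Fin m) (v : Fin m → ℂ) :
    ((1 : Matrix (Fin m) (Fin m) ℂ).updateRow b v).det = v b := by
  rw [← Matrix.cramer_transpose_apply, Matrix.transpose_one, Matrix.cramer_one]; rfl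

/-- Recovers the entries of the reduced matrix N as ratios of Plücker coordinates: exchanging one
row of an identity block for row k of N gives determinant `N k b`. -/
theorem plu_of_factor {f : Fin n → Fin (2 * n)} {g : Sp n} {N : Matrix (Fin (2 * n)) (Fin n) ℂ}
    {C : Matrix (Fin n) (Fin n) ℂ} (h : (mat g).submatrix id (firstIdx n) = N * C)
    (hN : N.submatrix f id = 1) :
    plu f g = C.det ∧ ∀ b k, plu (Function.update f b k) g = N k b * C.det := by
  have key : ∀ f', plu f' g = (N.submatrix f' id).det * C.det := by
    intro f'
    rw [← Matrix.det_mul]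
    have : (mat g).submatrix f' (firstIdx n) =
      ((mat g).submatrix id (firstIdx n)).submatrix f' id := rfl
    rw [plu, this, h]; rfl
  refine ⟨by rw [key, hN, Matrix.det_one, one_mul], fun b k => ?_⟩
  have : N.submatrix (Function.update f b k) id =
      (1 : Matrix (Fin n) (Fin n) ℂ).updateRow b (N k) := by
    ext a c
    by_cases hab : a = b
    · subst hab; simp
    · rw [Matrix.updateRow_ne hab, ← hN]; simp [hab]
  rw [key, this, det_one_updateRow]

theorem weight_update_lt {f : Fin n → Fin (2 * n)} {b : Fin n} {k : Fin (2 * n)} (h : f b < k) :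
    weight f < weight (Function.update f b k) := by
  refine Finset.sum_lt_sum (fun a _ => ?_) ⟨b, Finset.mem_univ b, ?_⟩
  · by_cases hab : a = b
    · subst hab
      rw [Function.update_self]
      exact Nat.pow_le_pow_right (by norm_num) h.le
    · rw [Function.update_of_ne hab]
  · rw [Function.update_self]
    exact Nat.pow_lt_pow_right (by norm_num) h

/-- Matrices that map `V_I` to the complementary coordinate subspace, and the latter to zero. -/
def CellIndex.Lower (I : CellIndex n) (A : Matrix (Fin (2 * n)) (Fin (2 * n)) ℂ) : Prop :=
  ∀ i j, A i j ≠ 0 → i ∉ I.val ∧ j ∈ I.val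

/-- Matrices that map `V_I` to zero, and the complementary coordinate subspace to `V_I`. -/
def CellIndex.Upper (I : CellIndex n) (D : Matrix (Fin (2 * n)) (Fin (2 * n)) ℂ) : Prop :=
  ∀ i j, D i j ≠ 0 → i ∈ I.val ∧ j ∉ I.val

theorem CellIndex.Lower.ind_mul {I : CellIndex n} {A} (h : I.Lower A) : I.ind * A = 0 := by
  ext i j
  rw [I.ind_mul_apply]
  split_ifs with hi
  · by_contra H; exact (h i j H).1 hi
  · rfl

theorem CellIndex.Lower.mul_ind {I : CellIndex n} {A} (h : I.Lower A) : A * I.ind = A := by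
  ext i j
  rw [I.mul_ind_apply]
  split_ifs with hi
  · rfl
  · by_contra H; exact hi (h i j (Ne.symm H)).2

theorem CellIndex.Upper.ind_mul {I : CellIndex n} {D} (h : I.Upper D) : I.ind * D = D := by
  ext i j
  rw [I.ind_mul_apply]
  split_ifs with hi
  · rfl
  · by_contra H; exact hi (h i j (Ne.symm H)).1

theorem CellIndex.Upper.mul_ind {I : CellIndex n} {D} (h : I.Upper D) : D * I.ind = 0 := by
  ext i j
  rw [I.mul_ind_apply]
  split_ifs with hi
  · by_contra H; exact (h i j H).2 hi
  · rfl

theorem CellIndex.Lower.mul_self {I : CellIndex n} {A} (h : I.Lower A) : A * A = 0 := by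
  calc A * A = A * (I.ind * A) := by rw [← Matrix.mul_assoc, h.mul_ind]
    _ = 0 := by rw [h.ind_mul, Matrix.mul_zero]

theorem CellIndex.Upper.mul_self {I : CellIndex n} {D} (h : I.Upper D) : D * D = 0 := by
  calc D * D = D * I.ind * D := by rw [Matrix.mul_assoc, h.ind_mul]
    _ = 0 := by rw [h.mul_ind, Matrix.zero_mul]

theorem form_cols (g : Sp n) (i j : Fin (2 * n)) :
    form (fun k => mat g k i) (fun k => mat g k j) = Omega n i j := by
  rw [← transpose_mul_Omega_mul g, Matrix.mul_assoc]; rfl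

theorem form_eq_sum (u v : Fin (2 * n) → ℂ) :
    form u v = ∑ k, halfSign n k * (u k * v k.rev) := by
  have h : ∀ k, (Omega n *ᵥ v) k = halfSign n k * v k.rev := by
    intro k
    have := Omega_mul_apply (Matrix.of fun a (_ : Fin (2 * n)) => v a) k k
    simpa [Matrix.mul_apply, Matrix.mulVec, dotProduct] using this
  rw [form, dotProduct]
  refine Finset.sum_congr rfl fun k _ => ?_
  rw [h]; ring

/-- Echelon form of the matrix of the first `n` columns of a symplectic matrix: the rows of a
nonvanishing Plücker coordinate of maximal weight are the index set of a Schubert cell. -/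
theorem exists_echelon {f : Fin n → Fin (2 * n)} {g : Sp n} (hf : plu f g ≠ 0)
    (hmax : ∀ f', weight f < weight f' → plu f' g = 0) :
    ∃ I : CellIndex n, I.val = Finset.univ.image f ∧
      ∃ (A : _) (hA : (Omega n * A).IsSymm) (hl : I.Lower A), (∀ i j, A i j ≠ 0 → i < j) ∧
        ∃ p ∈ P n, g = unip A hA hl.mul_self * I.w * p := by
  set M := (mat g).submatrix id (firstIdx n) with hM
  set C := (mat g).submatrix f (firstIdx n) with hC
  have hu : IsUnit C.det := isUnit_iff_ne_zero.mpr hf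
  set N := M * C⁻¹ with hN
  have hNC : M = N * C := by rw [hN, Matrix.mul_assoc, Matrix.nonsing_inv_mul _ hu, Matrix.mul_one]
  have hNf : N.submatrix f id = 1 := by
    have : N.submatrix f id = C * C⁻¹ := rfl
    rw [this, Matrix.mul_nonsing_inv _ hu]
  have hNf' : ∀ a b, N (f a) b = if a = b then 1 else 0 := by
    intro a b
    have := congrFun (congrFun hNf a) b
    rwa [Matrix.one_apply] at this
  have hfac := plu_of_factor hNC hNf
  -- Moving row f b to a larger k raises the weight, so by maximality that coordinate vanishes, and
  -- with it the entry of N.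
  have hNz : ∀ k b, N k b ≠ 0 → k ≤ f b := by
    intro k b hk
    by_contra h
    have h1 := hmax _ (weight_update_lt (not_le.mp h))
    rw [hfac.2, ← hfac.1] at h1
    exact (mul_ne_zero hk hf) h1
  have hinj : Function.Injective f := by
    intro a b hab
    by_contra hne
    exact hf (Matrix.det_zero_of_row_eq hne (by ext c; simp [hab]))
  -- The columns of N span the same Lagrangian subspace as the first n columns of g.
  have hiso : ∀ b c, form (fun k => N k b) (fun k => N k c) = 0 := by
    intro b c
    have h1 : Mᵀ * (Omega n * M) = 0 := by
      ext a d
      have := form_cols g (firstIdx n a) (firstIdx n d)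
      have h2 : firstIdx n d ≠ (firstIdx n a).rev := by
        intro h
        have := (rev_lt_iff (firstIdx n a)).mp (h ▸ d.isLt)
        exact this a.isLt
      rw [Omega, Matrix.of_apply, if_neg h2] at this
      exact this
    have h2 : Nᵀ * (Omega n * N) = 0 := by
      rw [hN, Matrix.transpose_mul, Matrix.mul_assoc, ← Matrix.mul_assoc (Omega n),
        ← Matrix.mul_assoc Mᵀ, h1, Matrix.zero_mul, Matrix.mul_zero]
    exact congrFun (congrFun h2 b) c
  -- If f c were opposite to f b, the triangular shape of N would leave only the term k = f b in the
  -- form, and that term is ±1, contradicting isotropy.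
  have hrev : ∀ b c, f c ≠ (f b).rev := by
    intro b c h
    have h1 := hiso b c
    rw [form_eq_sum, Finset.sum_eq_single (f b)] at h1
    · rw [← h, hNf', hNf'] at h1
      simp [halfSign_ne_zero] at h1
    · intro k _ hk
      by_contra H
      have h2 := hNz k b fun h => H (by rw [h]; ring)
      have h3 := hNz k.rev c fun h => H (by rw [h]; ring)
      rw [h, Fin.rev_le_rev] at h3
      exact hk (le_antisymm h2 h3)
    · simp
  let I : CellIndex n := ⟨Finset.univ.image f, by
    rw [Finset.card_image_of_injective _ hinj]; simp, by
    intro i hi hr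
    obtain ⟨b, _, rfl⟩ := Finset.mem_image.mp hi
    obtain ⟨c, _, hc⟩ := Finset.mem_image.mp hr
    exact hrev b c hc⟩
  have hmem : ∀ i, i ∈ I.val ↔ ∃ b, f b = i := by
    intro i
    change i ∈ Finset.univ.image f ↔ _
    simp
  refine ⟨I, rfl, ?_⟩
  -- the matrix with column `N b` at the place `f b`, minus the projection to `V_I`
  let A : Matrix (Fin (2 * n)) (Fin (2 * n)) ℂ := Matrix.of fun k j =>
    open Classical in if h : ∃ b, f b = j then (if k ∈ I.val then 0 else N k h.choose) else 0
  have hAf : ∀ k b, A k (f b) = if k ∈ I.val then 0 else N k b := by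
    intro k b
    have h : ∃ b', f b' = f b := ⟨b, rfl⟩
    have h2 : h.choose = b := hinj h.choose_spec
    have : A k (f b) = if k ∈ I.val then 0 else N k h.choose := dif_pos h
    rw [this, h2]
  have hl : I.Lower A := by
    intro i j hij
    by_cases h : ∃ b, f b = j
    · refine ⟨fun hi => hij ?_, (hmem j).mpr h⟩
      obtain ⟨b, rfl⟩ := h
      rw [hAf, if_pos hi]
    · exact absurd (dif_neg h) hij
  have hN' : ∀ k b, N k b = A k (f b) + if k = f b then 1 else 0 := by
    intro k b
    rw [hAf]
    by_cases hk : k ∈ I.val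
    · obtain ⟨a, rfl⟩ := (hmem k).mp hk
      rw [if_pos hk, hNf', zero_add]
      simp [hinj.eq_iff]
    · have : k ≠ f b := fun h => hk ((hmem k).mpr ⟨b, h.symm⟩)
      simp [hk, this]
  have hA : (Omega n * A).IsSymm := by
    have key : ∀ i j, (Omega n * A) i j ≠ 0 → i ∈ I.val ∧ j ∈ I.val := by
      intro i j h
      rw [Omega_mul_apply] at h
      have := hl _ _ (right_ne_zero_of_mul h)
      rw [I.mem_rev, not_not] at this
      exact this
    ext i j
    rw [Matrix.transpose_apply]
    by_cases hij : i ∈ I.val ∧ j ∈ I.val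
    · obtain ⟨⟨b, rfl⟩, ⟨c, rfl⟩⟩ := And.intro ((hmem i).mp hij.1) ((hmem j).mp hij.2)
      -- Each column of N is a column of A plus a basis vector. Both V_I and its complement are
      -- isotropic, so only the two cross terms survive, and their cancellation is the symmetry of
      -- ΩA.
      have h1 := hiso b c
      have e1 : (fun k => N k b) = (fun k => A k (f b)) + e (f b) := by
        ext k; simp [hN', e, Pi.single_apply]
      have e2 : (fun k => N k c) = (fun k => A k (f c)) + e (f c) := by
        ext k; simp [hN', e, Pi.single_apply]
      have z : ∀ k i j, A k i * A k.rev j = 0 := by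
        intro k i j
        by_contra H
        have h1 := (hl _ _ (left_ne_zero_of_mul H)).1
        have h2 := (hl _ _ (right_ne_zero_of_mul H)).1
        rw [I.mem_rev] at h2
        exact h2 h1
      have f1 : form (fun k => A k (f b)) (fun k => A k (f c)) = 0 := by
        rw [form_eq_sum]
        exact Finset.sum_eq_zero fun k _ => by rw [z, mul_zero]
      have f2 : form (e (f b)) (e (f c)) = 0 := by
        simp [form, e, Omega, hrev b c]
      have f3 : form (e (f b)) (fun k => A k (f c)) = (Omega n * A) (f b) (f c) := by
        rw [form_eq_sum, Omega_mul_apply, Finset.sum_eq_single (f b)]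
        · simp [e]
        · intro k _ hk; simp [e, hk]
        · simp
      have f4 : form (fun k => A k (f b)) (e (f c)) = -(Omega n * A) (f c) (f b) := by
        rw [form_eq_sum, Omega_mul_apply, Finset.sum_eq_single (f c).rev]
        · simp [e, halfSign_rev]
        · intro k _ hk
          have : k.rev ≠ f c := fun h => hk (by rw [← h, Fin.rev_rev])
          simp [e, this]
        · simp
      rw [e1, e2, form_add_left, form_add_right, form_add_right, f1, f2, f3, f4] at h1
      linear_combination -h1
    · have z1 : (Omega n * A) i j = 0 := by
        by_contra H; exact hij (key i j H)
      have z2 : (Omega n * A) j i = 0 := by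
        by_contra H; exact hij (key j i H).symm
      rw [z1, z2]
  refine ⟨A, hA, hl, ?_, (unip A hA hl.mul_self * I.w)⁻¹ * g, ?_, by group⟩
  · intro i j hij
    obtain ⟨b, rfl⟩ := (hmem j).mp (hl i j hij).2
    have hi := (hl i _ hij).1
    rw [hAf, if_neg hi] at hij
    refine lt_of_le_of_ne (hNz i b hij) ?_
    rintro rfl
    exact hi ((hmem _).mpr ⟨b, rfl⟩)
  · have hred : ∀ i (c : Fin n), i ∉ I.val → ((1 - A) * mat g) i (firstIdx n c) = 0 := by
      intro i c hi
      have h1 : ((1 - A) * mat g) i (firstIdx n c) = ((1 - A) * (N * C) : Matrix (Fin (2 * n)) (Fin n) ℂ) i c := by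
        rw [← hNC]; rfl
      have h2 : ((1 - A) * N : Matrix (Fin (2 * n)) (Fin n) ℂ) i = 0 := by
        ext b
        have h3 : (A * N) i b = A i (f b) := by
          rw [Matrix.mul_apply, Finset.sum_eq_single (f b)]
          · rw [hNf', if_pos rfl, mul_one]
          · intro k _ hk
            by_contra H
            obtain ⟨a, rfl⟩ := (hmem k).mp (hl _ _ (left_ne_zero_of_mul H)).2
            rw [hNf', if_neg (fun h => hk (by rw [h]))] at H
            simp at H
          · simp
        have h4 : i ≠ f b := fun h => hi ((hmem i).mpr ⟨b, h.symm⟩)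
        rw [Matrix.sub_mul, Matrix.one_mul, Matrix.sub_apply, h3, hN', if_neg h4]; simp
      rw [h1, ← Matrix.mul_assoc, Matrix.mul_apply]
      exact Finset.sum_eq_zero fun b _ => by rw [congrFun h2 b]; simp
    rw [mem_P]
    intro i j hi hj
    have e1 : mat ((unip A hA hl.mul_self * I.w)⁻¹ * g) =
        -(Omega n * (I.wMatrixᵀ * (Omega n * ((1 - A) * mat g)))) := by
      have : mat I.w = I.wMatrix := rfl
      rw [mul_inv_rev, mat_mul, mat_mul, mat_unip_inv, mat_inv, this]
      simp only [Matrix.neg_mul, Matrix.mul_assoc]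
    have e2 : ∀ X : Matrix (Fin (2 * n)) (Fin (2 * n)) ℂ, ∀ i j,
        (I.wMatrixᵀ * X) i j = I.sign i * X (I.perm i) j := by
      intro X i j
      rw [← Matrix.transpose_transpose X, ← Matrix.transpose_mul, Matrix.transpose_apply,
        I.mul_wMatrix_apply, mul_comm]; rfl
    have hi' : I.perm i ∉ I.val := by rw [I.perm_mem]; exact not_lt.mpr hi
    have hz : ((1 - A) * mat g) (I.perm i) j = 0 := hred _ ⟨j, hj⟩ hi'
    rw [e1, Matrix.neg_apply, Omega_mul_apply, e2, Omega_mul_apply, I.perm_rev, Fin.rev_rev, hz]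
    simp

/-! ### Normal form in the fibre over a Schubert cell -/

/-- The involution of an element of `w_I P`. -/
theorem exists_upper_of_mem_P (I : CellIndex n) {p : Sp n} (hp : p ∈ P n) :
    ∃ D, (Omega n * D).IsSymm ∧ I.Upper D ∧ CI.invol (I.w * p) = I.invol - 2 • D := by
  set X := CI.invol (I.w * p) with hX
  have hpi : p⁻¹ ∈ P n := (P n).inv_mem hp
  -- `V_I` is fixed
  have hp0 : ∀ i j : Fin (2 * n), (j : ℕ) < n → CI.invol p i j = if i = j then 1 else 0 := by
    intro i j hj
    rw [CI.invol, Matrix.mul_apply, ← Matrix.one_apply, ← mat_mul_mat_inv p, Matrix.mul_apply]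
    refine Finset.sum_congr rfl fun k _ => ?_
    by_cases hk : (k : ℕ) < n
    · simp [stdInvol, halfSign, hk]
    · rw [(mem_P _).mp hpi k j (not_lt.mp hk) hj]; simp
  have hw : X * I.wMatrix = I.wMatrix * CI.invol p := by
    have h1 : mat I.w = I.wMatrix := rfl
    rw [hX, invol_mul, ← h1, Matrix.mul_assoc, mat_inv_mul_mat, Matrix.mul_one]
  have h1 : ∀ i j, j ∈ I.val → X i j = if i = j then 1 else 0 := by
    intro i j hj
    have hj' := (I.perm_lt j).mpr hj
    have h2 := congrFun (congrFun hw i) (I.perm j)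
    have h3 : I.sign (I.perm j) = 1 := if_neg fun h => absurd h.1 (not_le.mpr hj')
    rw [I.mul_wMatrix_apply, I.perm_perm, h3, mul_one] at h2
    rw [h2, Matrix.mul_apply, Finset.sum_eq_single (I.perm j)]
    · rw [hp0 _ _ hj', if_pos rfl, mul_one]
      simp only [CellIndex.wMatrix, Matrix.of_apply, I.perm_perm, h3]
    · intro k _ hk
      rw [hp0 _ _ hj', if_neg hk, mul_zero]
    · simp
  have hs : ∀ i j, halfSign n i * X i.rev j = halfSign n j * X j.rev i := by
    intro i j
    have := congrFun (congrFun (Omega_mul_invol_isSymm (I.w * p)) j) i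
    rwa [Matrix.transpose_apply, Omega_mul_apply, Omega_mul_apply] at this
  -- Symmetry of ΩX determines the block on the complement of I from the block on I.
  have h2 : ∀ i j, i ∉ I.val → j ∉ I.val → X i j = if i = j then -1 else 0 := by
    intro i j hi hj
    have h3 := hs i.rev j
    rw [Fin.rev_rev, halfSign_rev, h1 _ _ ((I.mem_rev i).mpr hi)] at h3
    by_cases hij : i = j
    · subst hij
      rw [if_pos rfl] at h3 ⊢
      have := halfSign_ne_zero i
      have h4 : halfSign n i * (X i i + 1) = 0 := by linear_combination -h3
      have := (mul_eq_zero.mp h4).resolve_left this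
      linear_combination this
    · have : j.rev ≠ i.rev := fun h => hij (Fin.rev_injective h).symm
      rw [if_neg this, mul_zero] at h3
      rw [if_neg hij]
      have h4 := neg_ne_zero.mpr (halfSign_ne_zero i)
      exact (mul_eq_zero.mp h3).resolve_left h4
  -- The factor -1/2 anticipates that conjugating `I.invol` by 1 + D adds -2D.
  let D : Matrix (Fin (2 * n)) (Fin (2 * n)) ℂ := Matrix.of fun i j =>
    if i ∈ I.val ∧ j ∉ I.val then -X i j / 2 else 0
  refine ⟨D, ?_, ?_, ?_⟩
  · ext i j
    rw [Matrix.transpose_apply, Omega_mul_apply, Omega_mul_apply]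
    have a1 := I.mem_rev i
    have a2 := I.mem_rev j
    have h3 := hs i j
    simp only [D, Matrix.of_apply, a1, a2]
    by_cases hi : i ∈ I.val <;> by_cases hj : j ∈ I.val <;> simp [hi, hj]
    linear_combination h3 / 2
  · intro i j hij
    by_contra h
    exact hij (if_neg h)
  · ext i j
    have hJ : I.invol i j = if i = j then (if i ∈ I.val then 1 else -1) else 0 := by
      simp only [CellIndex.invol, CellIndex.ind, two_mul]
      by_cases hij : i = j
      · subst hij; by_cases hi : i ∈ I.val <;> simp [hi]
      · simp [hij]
    rw [Matrix.sub_apply, Matrix.smul_apply, hJ]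
    by_cases hj : j ∈ I.val
    · rw [h1 i j hj]
      by_cases hij : i = j
      · subst hij; simp [D, hj]
      · simp [D, hj, hij]
    · by_cases hi : i ∈ I.val
      · have : i ≠ j := by rintro rfl; exact hj hi
        simp [D, hi, hj, this]
        ring
      · rw [h2 i j hi hj]
        by_cases hij : i = j
        · subst hij; simp [D, hi]
        · simp [D, hi, hij]

/-- With J = `I.invol` one has JD = D, DJ = -D and D² = 0, so that (1 + D) J (1 - D) = J - 2D. -/
theorem CellIndex.Upper.invol_unip {I : CellIndex n} {D hD} (h : I.Upper D) :
    CI.invol (unip D hD h.mul_self * I.w) = I.invol - 2 • D := by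
  have h1 := h.ind_mul
  have h2 := h.mul_ind
  have h3 := h.mul_self
  rw [invol_mul, I.invol_w, mat_unip, mat_unip_inv, CellIndex.invol]
  have : (1 + D) * (2 * I.ind - 1) * (1 - D) = 2 * I.ind - 1 + 2 * (D * I.ind) - D
      - 2 * (I.ind * D) + D - 2 * (D * I.ind) * D + D * D := by noncomm_ring
  rw [this, h1, h2, h3]
  simp only [mul_zero, zero_mul]
  noncomm_ring

/-- Every point over the Schubert cell of `I` is `(1 + A) (1 + D) w_I L`. -/
theorem exists_normal_form {f : Fin n → Fin (2 * n)} {g : Sp n} (hf : plu f g ≠ 0)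
    (hmax : ∀ f', weight f < weight f' → plu f' g = 0) :
    ∃ I : CellIndex n, I.val = Finset.univ.image f ∧
      ∃ (A : _) (hA : (Omega n * A).IsSymm) (hl : I.Lower A), (∀ i j, A i j ≠ 0 → i < j) ∧
        ∃ (D : _) (hD : (Omega n * D).IsSymm) (hu : I.Upper D),
          (g : Sp n ⧸ L n) = ((unip A hA hl.mul_self * unip D hD hu.mul_self * I.w : Sp n) :
            Sp n ⧸ L n) := by
  obtain ⟨I, hI, A, hA, hl, hlt, p, hp, rfl⟩ := exists_echelon hf hmax
  obtain ⟨D, hD, hu, h⟩ := exists_upper_of_mem_P I hp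
  refine ⟨I, hI, A, hA, hl, hlt, D, hD, hu, ?_⟩
  rw [mk_eq_mk_iff, mul_assoc, mul_assoc, invol_mul, h, invol_mul, hu.invol_unip]

/-! ### The partition into preimages of Schubert cells -/

theorem plu_eq_zero_of_weight_lt {g : Sp n} {I : CellIndex n}
    (hg : (g : Sp n ⧸ L n) ∈ proj n ⁻¹' schubertCell I) {f : Fin n → Fin (2 * n)}
    (h : weight I.enum < weight f) : plu f g = 0 := by
  obtain ⟨b, hb, p, hp, rfl⟩ := (mk_mem_preimage_schubertCell g I).mp hg
  by_contra H
  exact absurd (weight_le_of_plu_ne_zero hb hp H) (not_le.mpr h)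

theorem plu_enum_ne_zero_of_mem {g : Sp n} {I : CellIndex n}
    (hg : (g : Sp n ⧸ L n) ∈ proj n ⁻¹' schubertCell I) : plu I.enum g ≠ 0 := by
  obtain ⟨b, hb, p, hp, rfl⟩ := (mk_mem_preimage_schubertCell g I).mp hg
  exact plu_enum_ne_zero hb hp I

/-- The cell is read off from a nonvanishing Plücker coordinate of maximal weight. -/
theorem exists_mem_preimage_schubertCell (x : Sp n ⧸ L n) :
    ∃ I : CellIndex n, x ∈ proj n ⁻¹' schubertCell I := by
  obtain ⟨g, rfl⟩ := QuotientGroup.mk_surjective x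
  classical
  obtain ⟨f₀, hf₀⟩ := exists_plu_ne_zero g
  obtain ⟨f, hf, hmax⟩ := Finset.exists_max_image (Finset.univ.filter fun f => plu f g ≠ 0) weight
    ⟨f₀, by simpa using hf₀⟩
  simp only [Finset.mem_filter, Finset.mem_univ, true_and] at hf hmax
  obtain ⟨I, _, A, hA, hl, hlt, p, hp, h⟩ := exists_echelon hf fun f' hf' => by
    by_contra H; exact absurd (hmax f' H) (not_le.mpr hf')
  exact ⟨I, (mk_mem_preimage_schubertCell g I).mpr ⟨_, unip_mem_B A hA _ hlt, p, hp, h⟩⟩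

/-- The weight of I is the largest weight of a nonvanishing Plücker coordinate of g, and it
determines I. -/
theorem cellIndex_unique {x : Sp n ⧸ L n} {I J : CellIndex n}
    (hI : x ∈ proj n ⁻¹' schubertCell I) (hJ : x ∈ proj n ⁻¹' schubertCell J) : I = J := by
  obtain ⟨g, rfl⟩ := QuotientGroup.mk_surjective x
  apply weight_enum_injective
  have key : ∀ {I J : CellIndex n}, (g : Sp n ⧸ L n) ∈ proj n ⁻¹' schubertCell I →
      (g : Sp n ⧸ L n) ∈ proj n ⁻¹' schubertCell J → weight I.enum ≤ weight J.enum := by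
    intro I J hI hJ
    by_contra h
    exact plu_enum_ne_zero_of_mem hI (plu_eq_zero_of_weight_lt hJ (not_le.mp h))
  exact le_antisymm (key hI hJ) (key hJ hI)

theorem exists_normal_form_of_mem {g : Sp n} {I : CellIndex n}
    (hg : (g : Sp n ⧸ L n) ∈ proj n ⁻¹' schubertCell I) :
    ∃ (A : _) (hA : (Omega n * A).IsSymm) (hl : I.Lower A), (∀ i j, A i j ≠ 0 → i < j) ∧
      ∃ (D : _) (hD : (Omega n * D).IsSymm) (hu : I.Upper D),
        (g : Sp n ⧸ L n) = ((unip A hA hl.mul_self * unip D hD hu.mul_self * I.w : Sp n) :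
          Sp n ⧸ L n) := by
  obtain ⟨J, hJ, h⟩ := exists_normal_form (plu_enum_ne_zero_of_mem hg)
    fun f hf => plu_eq_zero_of_weight_lt hg hf
  obtain rfl : J = I := Subtype.ext (hJ.trans I.image_enum)
  exact h

/-- 1 + D stabilizes V_I, the image of E_n under w_I. Hence changing D moves a point only within its
fibre over G/P. -/
theorem CellIndex.Upper.w_inv_mul_mem_P {I : CellIndex n} {D hD} (h : I.Upper D) :
    I.w⁻¹ * unip D hD h.mul_self * I.w ∈ P n := by
  have h1 : act (unip D hD h.mul_self) (coordSpace {i | i ∈ I.val}) ≤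
      coordSpace {i | i ∈ I.val} := by
    rw [act]
    conv_lhs => rw [coordSpace]
    rw [Submodule.map_span_le]
    rintro _ ⟨j, hj, rfl⟩
    rw [Matrix.mulVecLin_apply, mat_mulVec_e, mem_coordSpace]
    intro i hi
    have h2 : i ≠ j := by rintro rfl; exact hi hj
    have h3 : D i j = 0 := by
      by_contra H; exact hi (h i j H).1
    simp [h2, h3]
  rw [mem_P]
  intro i j hi hj
  have h2 : mat (unip D hD h.mul_self * I.w) *ᵥ e j ∈ coordSpace {i | i ∈ I.val} := by
    apply h1
    rw [← act_w, ← act_mul]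
    exact ⟨e j, Submodule.subset_span ⟨j, hj, rfl⟩, rfl⟩
  rw [← act_w] at h2
  obtain ⟨v, hv, hv2⟩ := h2
  have h3 : mat (I.w⁻¹ * unip D hD h.mul_self * I.w) *ᵥ e j = v := by
    rw [mul_assoc, mat_mul, ← Matrix.mulVec_mulVec, ← hv2, Matrix.mulVecLin_apply,
      Matrix.mulVec_mulVec, mat_inv_mul_mat, Matrix.one_mulVec]
  rw [mat_mulVec_e] at h3
  have := (mem_coordSpace _ v).mp hv i (not_lt.mpr hi)
  rw [← h3] at this
  exact this

theorem mk_mem_preimage_of_mem_B {b : Sp n} (hb : b ∈ B n) {I : CellIndex n} {D hD}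
    (h : I.Upper D) : ((b * unip D hD h.mul_self * I.w : Sp n) : Sp n ⧸ L n) ∈
      proj n ⁻¹' schubertCell I :=
  (mk_mem_preimage_schubertCell _ I).mpr ⟨b, hb, _, h.w_inv_mul_mem_P (hD := hD), by group⟩

/-! ### Closedness -/

/-- The matrix of coordinate functions. -/
def genMat (n : ℕ) : Matrix (Fin (2 * n)) (Fin (2 * n))
    (MvPolynomial (Fin (2 * n) × Fin (2 * n)) ℂ) := Matrix.of fun i j => MvPolynomial.X (i, j)

/-- Evaluation of polynomials at an element of the symplectic group, as a homomorphism. -/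
def evalHom (g : Sp n) : MvPolynomial (Fin (2 * n) × Fin (2 * n)) ℂ →+* ℂ :=
  MvPolynomial.eval fun ij => mat g ij.1 ij.2

theorem map_genMat (g : Sp n) : (genMat n).map (evalHom g) = mat g := by
  ext i j; simp [genMat, evalHom]

theorem map_C (g : Sp n) (M : Matrix (Fin (2 * n)) (Fin (2 * n)) ℂ) :
    (M.map (MvPolynomial.C (σ := Fin (2 * n) × Fin (2 * n)))).map (evalHom g) = M := by
  ext i j; simp [evalHom]

theorem exists_evalAt_eq_plu (f : Fin n → Fin (2 * n)) : ∃ q, ∀ g : Sp n, evalAt q g = plu f g := by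
  refine ⟨((genMat n).submatrix f (firstIdx n)).det, fun g => ?_⟩
  change evalHom g _ = _
  rw [RingHom.map_det, plu, ← map_genMat g]; rfl

theorem exists_evalAt_eq_invol (i j : Fin (2 * n)) :
    ∃ q, ∀ g : Sp n, evalAt q g = invol g i j := by
  refine ⟨(genMat n * (Omega n * stdInvol n).map MvPolynomial.C * (genMat n)ᵀ *
    (Omega n).map MvPolynomial.C : Matrix (Fin (2 * n)) (Fin (2 * n)) _) i j, fun g => ?_⟩
  change evalHom g _ = _
  rw [← Matrix.map_apply (f := evalHom g), Matrix.map_mul, Matrix.map_mul, Matrix.map_mul, map_C,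
    map_C, Matrix.transpose_map, map_genMat, invol_eq]

/-- The equations are the vanishing of all Plücker coordinates of weight at least k. A point over a
cell of weight at least k violates the equation that belongs to the cell itself. -/
theorem isZariskiClosed_union (k : ℕ) :
    IsZariskiClosed (⋃ I ∈ {I : CellIndex n | weight I.enum < k}, proj n ⁻¹' schubertCell I) := by
  choose q hq using exists_evalAt_eq_plu (n := n)
  refine ⟨q '' {f | k ≤ weight f}, fun g => ?_⟩
  constructor
  · rintro hg _ ⟨f, hf, rfl⟩
    obtain ⟨I, hI, hgI⟩ := Set.mem_iUnion₂.mp hg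
    rw [hq]
    exact plu_eq_zero_of_weight_lt hgI (lt_of_lt_of_le hI hf)
  · intro h
    obtain ⟨I, hI⟩ := exists_mem_preimage_schubertCell (g : Sp n ⧸ L n)
    refine Set.mem_iUnion₂.mpr ⟨I, ?_, hI⟩
    by_contra hk
    have := h _ ⟨I.enum, (not_lt.mp hk : k ≤ weight I.enum), rfl⟩
    rw [hq] at this
    exact plu_enum_ne_zero_of_mem hI this

/-! ### Parametrization of the preimage of a Schubert cell by an affine space -/

/-- The places of the free entries of the symmetric matrix `Omega * (A + D)`, where
`(1 + A) (1 + D) w_I` is a normal form over the Schubert cell of `I`. -/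
def CellIndex.Free (I : CellIndex n) (a b : Fin (2 * n)) : Prop :=
  (a ∈ I.val ∧ b ∈ I.val ∧ a.rev < b) ∨ (a ∉ I.val ∧ b ∉ I.val)

/-- The entry of ΩA at (a, b) is, up to sign, the entry of A at (a.rev, b). The condition a.rev < b
thus says that A is strictly upper triangular, and reversal of order makes it symmetric in a and b.
-/
theorem CellIndex.Free.symm {I : CellIndex n} {a b : Fin (2 * n)} (h : I.Free a b) :
    I.Free b a := by
  rcases h with ⟨h1, h2, h3⟩ | ⟨h1, h2⟩
  · exact Or.inl ⟨h2, h1, by rwa [← Fin.rev_lt_rev, Fin.rev_rev]⟩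
  · exact Or.inr ⟨h2, h1⟩

/-- The index set of the coordinates of the preimage of a Schubert cell. -/
def CellIndex.Coord (I : CellIndex n) : Type :=
  {z : Sym2 (Fin (2 * n)) // z ∈ Sym2.fromRel (r := I.Free) ⟨fun _ _ h => h.symm⟩}

instance (I : CellIndex n) : Finite I.Coord := Subtype.finite

/-- The dimension of the preimage of a Schubert cell. -/
def CellIndex.dim (I : CellIndex n) : ℕ := Nat.card I.Coord

/-- An enumeration of the coordinates. -/
def CellIndex.coordEquiv (I : CellIndex n) : I.Coord ≃ Fin I.dim := Finite.equivFin _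

open Classical in
/-- The coordinate at a free place, as a polynomial, and zero at the other places. -/
def CellIndex.coordPoly (I : CellIndex n) (a b : Fin (2 * n)) : MvPolynomial (Fin I.dim) ℂ :=
  if h : I.Free a b then MvPolynomial.X (I.coordEquiv ⟨s(a, b), h⟩) else 0

theorem CellIndex.coordPoly_symm (I : CellIndex n) (a b : Fin (2 * n)) :
    I.coordPoly a b = I.coordPoly b a := by
  unfold CellIndex.coordPoly
  by_cases h : I.Free a b
  · rw [dif_pos h, dif_pos h.symm]
    congr 2
    exact Subtype.ext Sym2.eq_swap
  · rw [dif_neg h, dif_neg fun h' => h h'.symm]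

/-- The generic lower matrix. -/
def CellIndex.lowerPoly (I : CellIndex n) (i j : Fin (2 * n)) : MvPolynomial (Fin I.dim) ℂ :=
  if i ∉ I.val ∧ j ∈ I.val then MvPolynomial.C (-halfSign n i) * I.coordPoly i.rev j else 0

/-- The generic upper matrix. -/
def CellIndex.upperPoly (I : CellIndex n) (i j : Fin (2 * n)) : MvPolynomial (Fin I.dim) ℂ :=
  if i ∈ I.val ∧ j ∉ I.val then MvPolynomial.C (-halfSign n i) * I.coordPoly i.rev j else 0

/-- The lower matrix with given coordinates. -/
def CellIndex.lowerMat (I : CellIndex n) (x : Fin I.dim → ℂ) :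
    Matrix (Fin (2 * n)) (Fin (2 * n)) ℂ :=
  Matrix.of fun i j => MvPolynomial.eval x (I.lowerPoly i j)

/-- The upper matrix with given coordinates. -/
def CellIndex.upperMat (I : CellIndex n) (x : Fin I.dim → ℂ) :
    Matrix (Fin (2 * n)) (Fin (2 * n)) ℂ :=
  Matrix.of fun i j => MvPolynomial.eval x (I.upperPoly i j)

/-- The factor `-halfSign n i` in `lowerPoly` and `upperPoly` undoes multiplication by Ω, since Ω² =
-1. -/
theorem CellIndex.Omega_mul_lowerMat (I : CellIndex n) (x : Fin I.dim → ℂ) (i j) :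
    (Omega n * I.lowerMat x) i j =
      if i ∈ I.val ∧ j ∈ I.val then MvPolynomial.eval x (I.coordPoly i j) else 0 := by
  rw [Omega_mul_apply]
  simp only [CellIndex.lowerMat, CellIndex.lowerPoly, Matrix.of_apply, I.mem_rev, not_not,
    Fin.rev_rev, halfSign_rev, neg_neg]
  split_ifs
  · simp [← mul_assoc, halfSign_mul_self]
  · simp

theorem CellIndex.Omega_mul_upperMat (I : CellIndex n) (x : Fin I.dim → ℂ) (i j) :
    (Omega n * I.upperMat x) i j =
      if i ∉ I.val ∧ j ∉ I.val then MvPolynomial.eval x (I.coordPoly i j) else 0 := by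
  rw [Omega_mul_apply]
  simp only [CellIndex.upperMat, CellIndex.upperPoly, Matrix.of_apply, I.mem_rev,
    Fin.rev_rev, halfSign_rev, neg_neg]
  split_ifs
  · simp [← mul_assoc, halfSign_mul_self]
  · simp

theorem CellIndex.lowerMat_isSymm (I : CellIndex n) (x : Fin I.dim → ℂ) :
    (Omega n * I.lowerMat x).IsSymm := by
  ext i j
  rw [Matrix.transpose_apply, I.Omega_mul_lowerMat, I.Omega_mul_lowerMat, I.coordPoly_symm]
  simp only [and_comm]

theorem CellIndex.upperMat_isSymm (I : CellIndex n) (x : Fin I.dim → ℂ) :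
    (Omega n * I.upperMat x).IsSymm := by
  ext i j
  rw [Matrix.transpose_apply, I.Omega_mul_upperMat, I.Omega_mul_upperMat, I.coordPoly_symm]
  simp only [and_comm]

theorem CellIndex.lower_lowerMat (I : CellIndex n) (x : Fin I.dim → ℂ) :
    I.Lower (I.lowerMat x) := by
  intro i j h
  by_contra H
  exact h (by rw [lowerMat, Matrix.of_apply, lowerPoly, if_neg H, map_zero])

theorem CellIndex.upper_upperMat (I : CellIndex n) (x : Fin I.dim → ℂ) :
    I.Upper (I.upperMat x) := by
  intro i j h
  by_contra H
  exact h (by rw [upperMat, Matrix.of_apply, upperPoly, if_neg H, map_zero])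

theorem CellIndex.lt_of_lowerMat (I : CellIndex n) (x : Fin I.dim → ℂ) (i j)
    (h : I.lowerMat x i j ≠ 0) : i < j := by
  obtain ⟨hi, hj⟩ := I.lower_lowerMat x i j h
  rw [CellIndex.lowerMat, Matrix.of_apply, CellIndex.lowerPoly, if_pos ⟨hi, hj⟩, map_mul] at h
  by_contra hlt
  apply right_ne_zero_of_mul h
  rw [CellIndex.coordPoly, dif_neg, map_zero]
  rintro (⟨_, _, h3⟩ | ⟨_, h2⟩)
  · rw [Fin.rev_rev] at h3; exact hlt h3
  · exact h2 hj

/-- The parametrization `x ↦ (1 + A) (1 + D) w_I` of the preimage of a Schubert cell. -/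
def CellIndex.param (I : CellIndex n) (x : Fin I.dim → ℂ) : Sp n :=
  unip (I.lowerMat x) (I.lowerMat_isSymm x) (I.lower_lowerMat x).mul_self *
    unip (I.upperMat x) (I.upperMat_isSymm x) (I.upper_upperMat x).mul_self * I.w

theorem CellIndex.exists_poly_param (I : CellIndex n) (i j : Fin (2 * n)) :
    ∃ p : MvPolynomial (Fin I.dim) ℂ, ∀ x, mat (I.param x) i j = MvPolynomial.eval x p := by
  refine ⟨((1 + Matrix.of I.lowerPoly) * (1 + Matrix.of I.upperPoly) *
    I.wMatrix.map MvPolynomial.C : Matrix (Fin (2 * n)) (Fin (2 * n)) _) i j, fun x => ?_⟩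
  have h1 : ∀ M : Matrix (Fin (2 * n)) (Fin (2 * n)) (MvPolynomial (Fin I.dim) ℂ),
      (1 + M).map (MvPolynomial.eval x) = 1 + M.map (MvPolynomial.eval x) := by
    intro M
    rw [Matrix.map_add _ (map_add _), Matrix.map_one _ (map_zero _) (map_one _)]
  have h2 : (I.wMatrix.map MvPolynomial.C).map (MvPolynomial.eval x) = I.wMatrix := by
    ext i j; simp
  rw [← Matrix.map_apply (f := MvPolynomial.eval x), Matrix.map_mul, Matrix.map_mul, h1, h1, h2]
  rfl

/-- The image lies over C_I because 1 + A is in B and 1 + D stabilizes V_I. It is everything over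
C_I by the existence of normal forms. -/
theorem CellIndex.range_param (I : CellIndex n) :
    Set.range (fun x => (I.param x : Sp n ⧸ L n)) = proj n ⁻¹' schubertCell I := by
  apply le_antisymm
  · rintro _ ⟨x, rfl⟩
    exact mk_mem_preimage_of_mem_B (unip_mem_B _ _ _ (I.lt_of_lowerMat x))
      (I.upper_upperMat x)
  · intro y hy
    obtain ⟨g, rfl⟩ := QuotientGroup.mk_surjective y
    obtain ⟨A, hA, hl, hlt, D, hD, hu, h⟩ := exists_normal_form_of_mem hy
    -- One symmetric matrix stores both parameters: ΩA occupies the block on I, ΩD the block on the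
    -- complement.
    let S := Omega n * (A + D)
    have hS : ∀ a b, S a b = S b a := by
      intro a b
      have : S.IsSymm := by
        simp only [S, Matrix.mul_add]; exact hA.add hD
      exact this.apply b a
    let x : Fin I.dim → ℂ := fun k =>
      Sym2.lift ⟨fun a b => S a b, hS⟩ (I.coordEquiv.symm k).1
    have hx : ∀ a b, I.Free a b → MvPolynomial.eval x (I.coordPoly a b) = S a b := by
      intro a b h
      rw [CellIndex.coordPoly, dif_pos h, MvPolynomial.eval_X]
      exact congrArg (fun z : I.Coord => Sym2.lift ⟨fun a b => S a b, hS⟩ z.1)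
        (I.coordEquiv.symm_apply_apply ⟨s(a, b), h⟩)
    have hSe : ∀ i j, S i.rev j = -halfSign n i * (A i j + D i j) := by
      intro i j
      simp only [S]
      rw [Omega_mul_apply, Fin.rev_rev, halfSign_rev, Matrix.add_apply]
    have eA : I.lowerMat x = A := by
      ext i j
      by_cases hij : i ∉ I.val ∧ j ∈ I.val
      · have h0 : D i j = 0 := by
          by_contra H; exact (hu i j H).2 hij.2
        rw [CellIndex.lowerMat, Matrix.of_apply, CellIndex.lowerPoly, if_pos hij, map_mul,
          MvPolynomial.eval_C]
        by_cases hlt' : i < j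
        · rw [hx _ _ (Or.inl ⟨(I.mem_rev i).mpr hij.1, hij.2, by rwa [Fin.rev_rev]⟩), hSe, h0,
            ← mul_assoc, neg_mul_neg, halfSign_mul_self]
          simp
        · have h1 : ¬ I.Free i.rev j := by
            rintro (⟨_, _, h3⟩ | ⟨_, h2⟩)
            · rw [Fin.rev_rev] at h3; exact hlt' h3
            · exact h2 hij.2
          have h2 : A i j = 0 := by
            by_contra H; exact hlt' (hlt i j H)
          rw [CellIndex.coordPoly, dif_neg h1, h2]; simp
      · have h1 : A i j = 0 := by
          by_contra H; exact hij (hl i j H)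
        rw [CellIndex.lowerMat, Matrix.of_apply, CellIndex.lowerPoly, if_neg hij, map_zero, h1]
    have eD : I.upperMat x = D := by
      ext i j
      by_cases hij : i ∈ I.val ∧ j ∉ I.val
      · have h0 : A i j = 0 := by
          by_contra H; exact hij.2 (hl i j H).2
        have h1 : i.rev ∉ I.val := fun h => (I.mem_rev i).mp h hij.1
        rw [CellIndex.upperMat, Matrix.of_apply, CellIndex.upperPoly, if_pos hij, map_mul,
          MvPolynomial.eval_C, hx _ _ (Or.inr ⟨h1, hij.2⟩), hSe, h0, ← mul_assoc, neg_mul_neg,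
          halfSign_mul_self]
        simp
      · have h1 : D i j = 0 := by
          by_contra H; exact hij (hu i j H)
        rw [CellIndex.upperMat, Matrix.of_apply, CellIndex.upperPoly, if_neg hij, map_zero, h1]
    refine ⟨x, ?_⟩
    rw [h]
    simp only [CellIndex.param, eA, eD]

theorem CellIndex.exists_enum_eq (I : CellIndex n) {i : Fin (2 * n)} (hi : i ∈ I.val) :
    ∃ c, I.enum c = i := by
  rw [← I.image_enum] at hi
  simpa using hi

/-- The factors to the right of (1 + A) w_I combine to an element of P, which does not affect ratios
of Plücker coordinates. The first n columns of (1 + A) w_I have the identity in the rows I and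
entries of A in the other rows. -/
theorem CellIndex.plu_param_mul (I : CellIndex n) (x : Fin I.dim → ℂ) {l : Sp n} (hl : l ∈ L n)
    (c : Fin n) {k : Fin (2 * n)} (hk : k ∉ I.val) :
    plu (Function.update I.enum c k) (I.param x * l) =
      I.lowerMat x k (I.enum c) * plu I.enum (I.param x * l) := by
  set A := I.lowerMat x
  have hA := I.lower_lowerMat x
  set u := unip (I.lowerMat x) (I.lowerMat_isSymm x) hA.mul_self
  set p := I.w⁻¹ * unip (I.upperMat x) (I.upperMat_isSymm x) (I.upper_upperMat x).mul_self * I.w * l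
  have hp : p ∈ P n := (P n).mul_mem (I.upper_upperMat x).w_inv_mul_mem_P (L_le_P n hl)
  have hg : I.param x * l = u * I.w * p := by
    simp only [u, p, CellIndex.param]; group
  have key := submatrix_mul_mem_P id (u * I.w) p hp
  have hN : ∀ i b, (mat (u * I.w)).submatrix id (firstIdx n) i b =
      A i (I.enum b) + if i = I.enum b then 1 else 0 := by
    intro i b
    have : mat (u * I.w) = (1 + A) * I.wMatrix := rfl
    rw [Matrix.submatrix_apply, this, I.mul_wMatrix_apply, I.sign_firstIdx, mul_one,
      Matrix.add_apply, Matrix.one_apply, add_comm]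
    rfl
  have hN1 : ((mat (u * I.w)).submatrix id (firstIdx n)).submatrix I.enum id = 1 := by
    ext a b
    have h0 : A (I.enum a) (I.enum b) = 0 := by
      by_contra H; exact (hA _ _ H).1 (I.enum_mem a)
    rw [Matrix.submatrix_apply, id, hN, h0, Matrix.one_apply]
    simp [I.enum_injective.eq_iff]
  obtain ⟨h1, h2⟩ := plu_of_factor key hN1
  have h3 : k ≠ I.enum c := fun h => hk (h ▸ I.enum_mem c)
  rw [hg, h1, h2, hN, if_neg h3, add_zero]

/-- Conjugation by 1 + A leaves this block of `I.invol` - 2D alone, since A has zero rows in I and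
zero columns outside I. -/
theorem CellIndex.invol_param (I : CellIndex n) (x : Fin I.dim → ℂ) {i j : Fin (2 * n)}
    (hi : i ∈ I.val) (hj : j ∉ I.val) : CI.invol (I.param x) i j = -2 * I.upperMat x i j := by
  have hA := I.lower_lowerMat x
  rw [CellIndex.param, mul_assoc, invol_mul, (I.upper_upperMat x).invol_unip, mat_unip,
    mat_unip_inv]
  set A := I.lowerMat x
  set D := I.upperMat x
  have h1 : ∀ M : Matrix (Fin (2 * n)) (Fin (2 * n)) ℂ, (A * M) i j = 0 := by
    intro M
    have : (I.ind * (A * M)) i j = 0 := by rw [← Matrix.mul_assoc, hA.ind_mul]; simp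
    rwa [I.ind_mul_apply, if_pos hi] at this
  have h2 : ∀ M : Matrix (Fin (2 * n)) (Fin (2 * n)) ℂ, (M * A) i j = 0 := by
    intro M
    rw [← hA.mul_ind, ← Matrix.mul_assoc, I.mul_ind_apply, if_neg hj]
  have h3 : I.invol i j = 0 := by
    have : i ≠ j := by rintro rfl; exact hj hi
    simp [CellIndex.invol, CellIndex.ind, two_mul, this]
  rw [Matrix.mul_sub, Matrix.mul_one, Matrix.sub_apply, h2, Matrix.add_mul, Matrix.add_apply, h1,
    Matrix.one_mul, Matrix.sub_apply, Matrix.smul_apply, h3]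
  simp

/-- Coordinates of A are ratios of Plücker coordinates, those of D are multiples of entries of the
involution. Allowing any representative g makes this serve for injectivity of the parametrization
and for regularity of its inverse. -/
theorem CellIndex.exists_coord_eq (I : CellIndex n) (k : Fin I.dim) :
    ∃ p q, ∀ (g : Sp n) (x : Fin I.dim → ℂ), (g : Sp n ⧸ L n) = (I.param x : Sp n ⧸ L n) →
      evalAt q g ≠ 0 ∧ x k = evalAt p g / evalAt q g := by
  obtain ⟨⟨z, hz⟩, rfl⟩ := I.coordEquiv.surjective k
  induction z using Sym2.ind with | _ a b =>
  have hf : I.Free a b := hz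
  have hc : ∀ x : Fin I.dim → ℂ,
      MvPolynomial.eval x (I.coordPoly a b) = x (I.coordEquiv ⟨s(a, b), hz⟩) := by
    intro x
    rw [CellIndex.coordPoly, dif_pos hf, MvPolynomial.eval_X]
  rcases hf with ⟨ha, hb, _⟩ | ⟨ha, hb⟩
  · obtain ⟨c, rfl⟩ := I.exists_enum_eq hb
    obtain ⟨q, hq⟩ := exists_evalAt_eq_plu I.enum
    obtain ⟨p, hp⟩ := exists_evalAt_eq_plu (Function.update I.enum c a.rev)
    refine ⟨MvPolynomial.C (halfSign n a) * p, q, fun g x h => ?_⟩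
    have h1 : plu I.enum g ≠ 0 := by
      apply plu_enum_ne_zero_of_mem
      rw [h, ← I.range_param]
      exact ⟨x, rfl⟩
    have hl : (I.param x)⁻¹ * g ∈ L n := QuotientGroup.eq.mp h.symm
    have h2 := I.plu_param_mul x hl c (fun h => (I.mem_rev a).mp h ha)
    rw [mul_inv_cancel_left] at h2
    have h3 : evalAt (MvPolynomial.C (halfSign n a) * p) g =
        halfSign n a * plu (Function.update I.enum c a.rev) g := by
      rw [← hp]; simp [evalAt]
    refine ⟨by rwa [hq], ?_⟩
    have h4 := I.Omega_mul_lowerMat x a (I.enum c)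
    rw [if_pos ⟨ha, hb⟩, hc, Omega_mul_apply] at h4
    rw [h3, hq, h2, ← h4]
    field_simp
  · obtain ⟨p, hp⟩ := exists_evalAt_eq_invol a.rev b
    -- The coordinate is `halfSign n a` times the entry of D at (a.rev, b), and the involution has
    -- -2 times that entry.
    refine ⟨MvPolynomial.C (-halfSign n a / 2) * p, 1, fun g x h => ?_⟩
    have h3 : evalAt (MvPolynomial.C (-halfSign n a / 2) * p) g =
        -halfSign n a / 2 * CI.invol g a.rev b := by
      rw [← hp]; simp [evalAt]
    have h4 := I.Omega_mul_upperMat x a b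
    rw [if_pos ⟨ha, hb⟩, hc, Omega_mul_apply] at h4
    refine ⟨by simp [evalAt], ?_⟩
    rw [h3, (mk_eq_mk_iff _ _).mp h, I.invol_param x ((I.mem_rev a).mpr ha) hb, ← h4]
    simp [evalAt]
    ring

theorem CellIndex.param_injective (I : CellIndex n) :
    Function.Injective fun x => (I.param x : Sp n ⧸ L n) := by
  intro x y h
  ext k
  obtain ⟨p, q, hpq⟩ := I.exists_coord_eq k
  rw [(hpq (I.param x) x rfl).2, (hpq (I.param x) y h).2]

/-- Each coordinate of the inverse is a single global quotient whose denominator vanishes nowhere on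
the cell, so no localization is needed. -/
theorem isAffineCell_preimage (I : CellIndex n) :
    IsAffineCell (proj n ⁻¹' schubertCell I) := by
  refine ⟨I.dim, I.param, Function.invFun fun x => (I.param x : Sp n ⧸ L n), I.exists_poly_param,
    I.range_param, Function.leftInverse_invFun I.param_injective, fun k g₀ hg₀ => ?_⟩
  obtain ⟨p, q, hpq⟩ := I.exists_coord_eq k
  have key : ∀ g : Sp n, (g : Sp n ⧸ L n) ∈ proj n ⁻¹' schubertCell I → evalAt q g ≠ 0 ∧
      Function.invFun (fun x => (I.param x : Sp n ⧸ L n)) g k = evalAt p g / evalAt q g := by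
    intro g hg
    rw [← I.range_param] at hg
    obtain ⟨x, hx⟩ := hg
    have h1 : Function.invFun (fun x => (I.param x : Sp n ⧸ L n)) g = x := by
      rw [← hx]; exact Function.leftInverse_invFun I.param_injective x
    rw [h1]
    exact hpq g x hx.symm
  exact ⟨p, q, (key g₀ hg₀).1, fun g hg _ => (key g hg).2⟩

/-! ### The involution of a clan -/

/-- The position of the other occurrence of the number at a position, or the position itself
if the symbol there is a sign. -/
def Clan.mate {N : ℕ} (γ : Clan N) (i : Fin N) : Fin N :=
  match γ.symbol i with
  | ClanSymbol.plus => i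
  | ClanSymbol.minus => i
  | ClanSymbol.num j => j

theorem Clan.mate_mate {N : ℕ} (γ : Clan N) (i : Fin N) : γ.mate (γ.mate i) = i := by
  cases h : γ.symbol i with
  | plus => simp [Clan.mate, h]
  | minus => simp [Clan.mate, h]
  | num j => simp [Clan.mate, h, (γ.matching _ _ h).2]

open Classical in
-- A clan is determined by its pairing and its signatures; within one sect only the pairing has to
-- be compared.
theorem Clan.symbol_eq {N : ℕ} (γ : Clan N) (i : Fin N) :
    γ.symbol i = if γ.mate i ≠ i then ClanSymbol.num (γ.mate i) else
      if γ.SigPlus i then ClanSymbol.plus else ClanSymbol.minus := by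
  cases h : γ.symbol i with
  | plus => simp [Clan.mate, Clan.SigPlus, h]
  | minus => simp [Clan.mate, Clan.SigPlus, h]
  | num j => simp [Clan.mate, h, (γ.matching _ _ h).1]

/-- The matrix of the involution of the point of `G/L` that represents a clan. -/
def Clan.involMat (γ : Clan (2 * n)) : Matrix (Fin (2 * n)) (Fin (2 * n)) ℂ :=
  Matrix.of fun k i =>
    match γ.symbol i with
    | ClanSymbol.plus => if k = i then 1 else 0
    | ClanSymbol.minus => if k = i then -1 else 0
    | ClanSymbol.num j => if k = j then (if i < j then -halfSign n i else -halfSign n j) else 0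

theorem Clan.involMat_ne_zero (γ : Clan (2 * n)) (k i : Fin (2 * n)) :
    γ.involMat k i ≠ 0 ↔ k = γ.mate i := by
  have h1 := halfSign_ne_zero i
  have h2 := halfSign_ne_zero (γ.mate i)
  cases h : γ.symbol i with
  | plus => simp [Clan.mate, Clan.involMat, h]
  | minus => simp [Clan.mate, Clan.involMat, h]
  | num j =>
    simp only [Clan.mate, h] at h2
    by_cases hij : i < j <;> simp [Clan.mate, Clan.involMat, h, h1, h2, hij]

theorem halfSign_mul_e (l j : Fin (2 * n)) : halfSign n l * e j l = halfSign n j * e j l := by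
  by_cases h : l = j
  · rw [h]
  · simp [e, h]

open Classical in
theorem SkewClan.halfSign_defaultPerm (γ : SkewClan n) (i : Fin (2 * n)) :
    halfSign n (γ.defaultPerm i) = if γ.toClan.SigPlus i then 1 else -1 := by
  unfold halfSign
  simp only [γ.defaultPerm_lt]

/-- The vector with index σ(i) is an eigenvector of s whose eigenvalue is the signature of i. The
two occurrences of a number have opposite signatures, so s exchanges the sum and difference vectors
up to sign; that sign comes from the half in which the first occurrence lies. -/
theorem SkewClan.stdInvol_mul_repMatrix (γ : SkewClan n) :
    stdInvol n * γ.repMatrix = γ.repMatrix * γ.toClan.involMat := by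
  ext l i
  have hs := γ.halfSign_defaultPerm
  have he : ∀ j, halfSign n l * e (γ.defaultPerm j) l =
      halfSign n (γ.defaultPerm j) * e (γ.defaultPerm j) l := fun j => halfSign_mul_e _ _
  have hR : (γ.repMatrix * γ.toClan.involMat) l i =
      γ.flagVec (γ.mate i) l * γ.toClan.involMat (γ.mate i) i := by
    rw [Matrix.mul_apply, Finset.sum_eq_single (γ.mate i)]
    · rfl
    · intro k _ hk
      have : γ.toClan.involMat k i = 0 := by
        by_contra H; exact hk ((γ.involMat_ne_zero k i).mp H)
      rw [this, mul_zero]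
    · simp
  have hL : (stdInvol n * γ.repMatrix) l i = halfSign n l * γ.flagVec i l := by
    rw [stdInvol, Matrix.diagonal_mul]; rfl
  rw [hR, hL]
  generalize hcc : (1 / (Real.sqrt 2 : ℂ)) = c
  cases h : γ.symbol i with
  | plus =>
    have si : γ.toClan.SigPlus i := by simp [Clan.SigPlus, h]
    have := he i
    rw [hs, if_pos si] at this
    simp only [SkewClan.flagVec, Clan.mate, Clan.involMat, h, Matrix.of_apply]
    split_ifs <;> simp [this]
  | minus =>
    have si : ¬ γ.toClan.SigPlus i := by simp [Clan.SigPlus, h]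
    have := he i
    rw [hs, if_neg si] at this
    simp only [SkewClan.flagVec, Clan.mate, Clan.involMat, h, Matrix.of_apply]
    simp [this]
  | num j =>
    obtain ⟨hne, hj⟩ := γ.matching _ _ h
    have h1 := he i
    have h2 := he j
    have si : γ.toClan.SigPlus i ↔ j < i := by simp [Clan.SigPlus, h]
    have sj : γ.toClan.SigPlus j ↔ i < j := by simp [Clan.SigPlus, hj]
    rw [hs] at h1 h2
    simp only [SkewClan.flagVec, Clan.mate, Clan.involMat, h, hj, Matrix.of_apply, hcc, if_true]
    rcases lt_or_gt_of_ne hne.symm with hlt | hlt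
    · rw [if_neg (by rw [si]; exact hlt.not_gt)] at h1
      rw [if_pos (by rw [sj]; exact hlt)] at h2
      generalize halfSign n l = t at h1 h2 ⊢
      by_cases hin : (i : ℕ) < n
      · have hi : halfSign n i = 1 := if_pos hin
        simp [hlt, hlt.not_gt, hin, hi]
        linear_combination c * h1 + c * h2
      · have hi : halfSign n i = -1 := if_neg hin
        simp [hlt, hlt.not_gt, hin, hi]
        linear_combination -c * h1 - c * h2
    · rw [if_pos (by rw [si]; exact hlt)] at h1
      rw [if_neg (by rw [sj]; exact hlt.not_gt)] at h2
      generalize halfSign n l = t at h1 h2 ⊢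
      by_cases hin : (j : ℕ) < n
      · have hi : halfSign n j = 1 := if_pos hin
        simp [hlt, hlt.not_gt, hin, hi]
        linear_combination c * h2 - c * h1
      · have hi : halfSign n j = -1 := if_neg hin
        simp [hlt, hlt.not_gt, hin, hi]
        linear_combination c * h2 - c * h1

theorem SkewClan.invol_rep_inv (γ : SkewClan n) : invol γ.rep⁻¹ = γ.toClan.involMat := by
  apply invol_eq_of_mul_eq
  have h : mat γ.rep = γ.repMatrix := rfl
  calc _ = mat γ.rep⁻¹ * (mat γ.rep * γ.toClan.involMat) * mat γ.rep⁻¹ := by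
        rw [← Matrix.mul_assoc, mat_inv_mul_mat, Matrix.one_mul]
    _ = mat γ.rep⁻¹ * stdInvol n * (mat γ.rep * mat γ.rep⁻¹) := by
        rw [h, ← γ.stdInvol_mul_repMatrix]; simp only [Matrix.mul_assoc]
    _ = _ := by rw [mat_mul_mat_inv, Matrix.mul_one]

/-! ### Sects -/

theorem mem_sect_iff (γ : SkewClan n) (I : CellIndex n) :
    γ ∈ sect I ↔ ∀ i, i ∈ I.val ↔ γ.toClan.SigPlus i := by
  have h : γ ∈ sect I ↔ γ.toClan.base = baseClan I := Iff.rfl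
  rw [h, Clan.base, baseClan, Clan.ext_iff, funext_iff]
  refine forall_congr' fun i => ?_
  by_cases h1 : γ.toClan.SigPlus i <;> by_cases h2 : i ∈ I.val <;> simp [Clan.ofSet, h1, h2]

/-- An upper triangular matrix that intertwines two monomial involutions forces the product of their
pairings to lower every index weakly. Such a permutation is the identity, so the pairings agree, and
the common base clan fixes the remaining signs. -/
theorem SkewClan.eq_of_mem_orbit {γ δ : SkewClan n} {I : CellIndex n} (hγ : γ ∈ sect I)
    (hδ : δ ∈ sect I) {b : Sp n} (hb : b ∈ B n)
    (h : ((b * γ.rep⁻¹ : Sp n) : Sp n ⧸ L n) = ((δ.rep⁻¹ : Sp n) : Sp n ⧸ L n)) : γ = δ := by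
  rw [mk_eq_mk_iff, invol_mul, γ.invol_rep_inv, δ.invol_rep_inv] at h
  have h1 : mat b * γ.toClan.involMat = δ.toClan.involMat * mat b := by
    rw [← h, Matrix.mul_assoc, mat_inv_mul_mat, Matrix.mul_one]
  have hle : ∀ j, δ.mate (γ.mate j) ≤ j := by
    intro j
    -- At this place the left-hand side contains a diagonal entry of b, hence is nonzero, and the
    -- right-hand side contains the entry of b in row `δ.mate (γ.mate j)` and column j.
    have h2 := congrFun (congrFun h1 (γ.mate j)) j
    rw [Matrix.mul_apply, Matrix.mul_apply, Finset.sum_eq_single (γ.mate j),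
      Finset.sum_eq_single (δ.mate (γ.mate j))] at h2
    · have h3 : mat b (γ.mate j) (γ.mate j) * γ.toClan.involMat (γ.mate j) j ≠ 0 :=
        mul_ne_zero (diag_ne_zero hb _) ((γ.involMat_ne_zero _ _).mpr rfl)
      rw [h2] at h3
      by_contra hlt
      exact right_ne_zero_of_mul h3 ((mem_B b).mp hb _ _ (not_le.mp hlt))
    · intro k _ hk
      have : δ.toClan.involMat (γ.mate j) k = 0 := by
        by_contra H
        have := (δ.involMat_ne_zero _ _).mp H
        exact hk (by rw [this, δ.mate_mate])
      rw [this, zero_mul]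
    · simp
    · intro k _ hk
      have : γ.toClan.involMat k j = 0 := by
        by_contra H; exact hk ((γ.involMat_ne_zero _ _).mp H)
      rw [this, mul_zero]
    · simp
  let s : Equiv.Perm (Fin (2 * n)) :=
    (Function.Involutive.toPerm γ.mate γ.mate_mate).trans
      (Function.Involutive.toPerm δ.mate δ.mate_mate)
  have hs : s = 1 := perm_eq_one_of_le (f := id) Function.injective_id hle
  have hm : γ.mate = δ.mate := by
    funext j
    have : δ.mate (γ.mate j) = j := congrArg (fun t : Equiv.Perm _ => t j) hs
    rw [← this, δ.mate_mate, this]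
  apply SkewClan.ext
  funext i
  rw [γ.symbol_eq, δ.symbol_eq, hm]
  have : γ.toClan.SigPlus i ↔ δ.toClan.SigPlus i :=
    ((mem_sect_iff γ I).mp hγ i).symm.trans ((mem_sect_iff δ I).mp hδ i)
  by_cases hp : δ.toClan.SigPlus i
  · rw [if_pos hp, if_pos (this.mpr hp)]
  · rw [if_neg hp, if_neg (fun h => hp (this.mp h))]

theorem mem_orbit_iff (γ : SkewClan n) (x : Sp n ⧸ L n) :
    x ∈ γ.orbit ↔ ∃ b ∈ B n, x = ((b * γ.rep⁻¹ : Sp n) : Sp n ⧸ L n) := by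
  constructor
  · rintro ⟨b, rfl⟩
    exact ⟨b, b.2, rfl⟩
  · rintro ⟨b, hb, rfl⟩
    exact ⟨⟨b, hb⟩, rfl⟩

theorem sect_pairwiseDisjoint (I : CellIndex n) : (sect I).PairwiseDisjoint SkewClan.orbit := by
  intro γ hγ δ hδ hne
  rw [Function.onFun, Set.disjoint_left]
  intro x hx hy
  obtain ⟨b, hb, rfl⟩ := (mem_orbit_iff γ x).mp hx
  obtain ⟨c, hc, h⟩ := (mem_orbit_iff δ _).mp hy
  refine hne (SkewClan.eq_of_mem_orbit hγ hδ ((B n).mul_mem ((B n).inv_mem hc) hb) ?_)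
  have := congrArg (fun y : Sp n ⧸ L n => c⁻¹ • y) h
  simpa [MulAction.Quotient.smul_mk, mul_assoc] using this

open Classical in
/-- The part of the matrix of the involution of a clan that maps first occurrences of numbers to
second ones. -/
def Clan.firstToSecond (γ : Clan (2 * n)) : Matrix (Fin (2 * n)) (Fin (2 * n)) ℂ :=
  Matrix.of fun k i => if γ.symbol i = ClanSymbol.num k ∧ i < k then -halfSign n i else 0

open Classical in
/-- The part of the matrix of the involution of a clan that maps second occurrences of numbers to
first ones. -/
def Clan.secondToFirst (γ : Clan (2 * n)) : Matrix (Fin (2 * n)) (Fin (2 * n)) ℂ :=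
  Matrix.of fun k i => if γ.symbol i = ClanSymbol.num k ∧ k < i then -halfSign n k else 0

open Classical in
/-- The part of the matrix of the involution of a clan that comes from the signs `+`. -/
def Clan.plusPart (γ : Clan (2 * n)) : Matrix (Fin (2 * n)) (Fin (2 * n)) ℂ :=
  Matrix.diagonal fun i => if γ.symbol i = ClanSymbol.plus then 1 else 0

open Classical in
/-- The part of the matrix of the involution of a clan that comes from the signs `-`. -/
def Clan.minusPart (γ : Clan (2 * n)) : Matrix (Fin (2 * n)) (Fin (2 * n)) ℂ :=
  Matrix.diagonal fun i => if γ.symbol i = ClanSymbol.minus then -1 else 0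

open Classical in
theorem Clan.involMat_eq (γ : Clan (2 * n)) :
    γ.involMat = γ.plusPart + γ.minusPart + γ.firstToSecond + γ.secondToFirst := by
  ext k i
  simp only [Matrix.add_apply, Clan.plusPart, Clan.minusPart, Clan.firstToSecond,
    Clan.secondToFirst, Clan.involMat, Matrix.of_apply]
  cases h : γ.symbol i with
  | plus => by_cases hk : k = i <;> simp [hk, h]
  | minus => by_cases hk : k = i <;> simp [hk, h]
  | num j =>
    have hne := (γ.matching _ _ h).1
    have hd : (Matrix.diagonal (fun i => if γ.symbol i = ClanSymbol.plus then (1 : ℂ) else 0)) k i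
        = 0 := by by_cases hk : k = i <;> simp [hk, h]
    have hd' : (Matrix.diagonal (fun i => if γ.symbol i = ClanSymbol.minus then (-1 : ℂ) else 0)) k i
        = 0 := by by_cases hk : k = i <;> simp [hk, h]
    rw [hd, hd']
    by_cases hk : k = j
    · subst hk
      rcases lt_or_gt_of_ne hne with hlt | hlt <;> simp [hlt, hlt.not_gt]
    · have : j ≠ k := Ne.symm hk
      simp [hk, this]

theorem Clan.firstToSecond_ne_zero {γ : Clan (2 * n)} {k i : Fin (2 * n)}
    (h : γ.firstToSecond k i ≠ 0) : γ.symbol i = ClanSymbol.num k ∧ i < k := by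
  by_contra H; exact h (if_neg H)

theorem Clan.secondToFirst_ne_zero {γ : Clan (2 * n)} {k i : Fin (2 * n)}
    (h : γ.secondToFirst k i ≠ 0) : γ.symbol i = ClanSymbol.num k ∧ k < i := by
  by_contra H; exact h (if_neg H)

section

variable {γ : SkewClan n} {I : CellIndex n}

/-- In a clan of the sect, first occurrences lie outside I and second occurrences in I. -/
theorem SkewClan.firstToSecond_upper (hγ : γ ∈ sect I) : I.Upper γ.toClan.firstToSecond := by
  intro k i h
  obtain ⟨h1, h2⟩ := Clan.firstToSecond_ne_zero h
  rw [(mem_sect_iff γ I).mp hγ, (mem_sect_iff γ I).mp hγ]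
  simp [Clan.SigPlus, h1, (γ.matching _ _ h1).2, h2, h2.not_gt]

theorem SkewClan.secondToFirst_lower (hγ : γ ∈ sect I) : I.Lower γ.toClan.secondToFirst := by
  intro k i h
  obtain ⟨h1, h2⟩ := Clan.secondToFirst_ne_zero h
  rw [(mem_sect_iff γ I).mp hγ, (mem_sect_iff γ I).mp hγ]
  simp [Clan.SigPlus, h1, (γ.matching _ _ h1).2, h2, h2.not_gt]

/-- A round trip starting at a first occurrence has coefficient 1, so the product is the projection
onto the first occurrences, which are the indices outside I that carry no minus sign. -/
theorem SkewClan.secondToFirst_mul_firstToSecond (hγ : γ ∈ sect I) :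
    γ.toClan.secondToFirst * γ.toClan.firstToSecond = 1 - I.ind + γ.toClan.minusPart := by
  ext k i
  have hI := (mem_sect_iff γ I).mp hγ i
  rw [Matrix.mul_apply]
  simp only [Matrix.add_apply, Matrix.sub_apply, CellIndex.ind, Clan.minusPart]
  cases h : γ.symbol i with
  | plus =>
    rw [Finset.sum_eq_zero]
    · by_cases hk : k = i
      · subst hk; simp [hI, Clan.SigPlus, h]
      · simp [hk]
    · intro l _; simp [Clan.firstToSecond, h]
  | minus =>
    rw [Finset.sum_eq_zero]
    · by_cases hk : k = i
      · subst hk; simp [hI, Clan.SigPlus, h]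
      · simp [hk]
    · intro l _; simp [Clan.firstToSecond, h]
  | num j =>
    obtain ⟨hne, hj⟩ := γ.matching _ _ h
    rw [Finset.sum_eq_single j]
    · by_cases hk : k = i
      · subst hk
        have hs := halfSign_mul_self k
        rcases lt_or_gt_of_ne hne with hlt | hlt <;>
          simp [Clan.firstToSecond, Clan.secondToFirst, h, hj, hI, Clan.SigPlus, hlt, hlt.not_gt, hs]
      · have : i ≠ k := Ne.symm hk
        simp [hk, Clan.secondToFirst, hj, this]
    · intro l _ hl
      have : j ≠ l := Ne.symm hl
      simp [Clan.firstToSecond, h, this]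
    · simp

theorem SkewClan.firstToSecond_mul_secondToFirst (hγ : γ ∈ sect I) :
    γ.toClan.firstToSecond * γ.toClan.secondToFirst = I.ind - γ.toClan.plusPart := by
  ext k i
  have hI := (mem_sect_iff γ I).mp hγ i
  rw [Matrix.mul_apply]
  simp only [Matrix.sub_apply, CellIndex.ind, Clan.plusPart]
  cases h : γ.symbol i with
  | plus =>
    rw [Finset.sum_eq_zero]
    · by_cases hk : k = i
      · subst hk; simp [hI, Clan.SigPlus, h]
      · simp [hk]
    · intro l _; simp [Clan.secondToFirst, h]
  | minus =>
    rw [Finset.sum_eq_zero]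
    · by_cases hk : k = i
      · subst hk; simp [hI, Clan.SigPlus, h]
      · simp [hk]
    · intro l _; simp [Clan.secondToFirst, h]
  | num j =>
    obtain ⟨hne, hj⟩ := γ.matching _ _ h
    rw [Finset.sum_eq_single j]
    · by_cases hk : k = i
      · subst hk
        have hs := halfSign_mul_self j
        rcases lt_or_gt_of_ne hne with hlt | hlt <;>
          simp [Clan.firstToSecond, Clan.secondToFirst, h, hj, hI, Clan.SigPlus, hlt, hlt.not_gt, hs]
      · have : i ≠ k := Ne.symm hk
        simp [hk, Clan.firstToSecond, hj, this]
    · intro l _ hl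
      have : j ≠ l := Ne.symm hl
      simp [Clan.secondToFirst, h, this]
    · simp

theorem SkewClan.secondToFirst_mul_plusPart :
    γ.toClan.secondToFirst * γ.toClan.plusPart = 0 := by
  ext k i
  rw [Clan.plusPart, Matrix.mul_diagonal]
  by_cases h : γ.symbol i = ClanSymbol.plus <;> simp [h, Clan.secondToFirst]

/-- The involution of a clan is conjugate, by an upper triangular unipotent matrix, to an
involution that is the identity on a coordinate subspace. -/
theorem SkewClan.conj_involMat (hγ : γ ∈ sect I) :
    (1 + γ.toClan.secondToFirst) * (I.invol + γ.toClan.firstToSecond) *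
      (1 - γ.toClan.secondToFirst) = γ.toClan.involMat := by
  have hF := SkewClan.secondToFirst_lower hγ
  have hEF := SkewClan.firstToSecond_mul_secondToFirst hγ
  have hFE := SkewClan.secondToFirst_mul_firstToSecond hγ
  have h0 := SkewClan.secondToFirst_mul_plusPart (γ := γ)
  rw [γ.toClan.involMat_eq, CellIndex.invol]
  have h1 := hF.ind_mul
  have h2 := hF.mul_ind
  have h3 := hF.mul_self
  set F := γ.toClan.secondToFirst
  set E := γ.toClan.firstToSecond
  set q := γ.toClan.plusPart
  -- EF is the projection onto the second occurrences, and F vanishes on all other basis vectors.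
  have h4 : F * (E * F) = F := by rw [hEF, Matrix.mul_sub, h2, h0, sub_zero]
  have : (1 + F) * (2 * I.ind - 1 + E) * (1 - F) = 2 * I.ind - 1 + E + 2 * (F * I.ind) - F + F * E
      - 2 * (I.ind * F) + F - E * F - 2 * (F * I.ind) * F + F * F - F * (E * F) := by noncomm_ring
  rw [this, h1, h4, h2, h3, hFE, hEF]
  simp only [mul_zero, Matrix.mul_assoc, h3]
  noncomm_ring

end

theorem SkewClan.symbol_rev_eq_num {γ : SkewClan n} {i j : Fin (2 * n)} :
    γ.symbol i.rev = ClanSymbol.num j ↔ γ.symbol i = ClanSymbol.num j.rev := by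
  rw [γ.symbol_rev]
  cases γ.symbol i with
  | plus => simp [ClanSymbol.rev, ClanSymbol.neg]
  | minus => simp [ClanSymbol.rev, ClanSymbol.neg]
  | num k => simpa [ClanSymbol.rev, ClanSymbol.neg] using (eq_comm.trans (eq_rev_comm j k)).trans Iff.rfl

theorem SkewClan.symbol_eq_num_comm {γ : SkewClan n} {i j : Fin (2 * n)} :
    γ.symbol i = ClanSymbol.num j ↔ γ.symbol j = ClanSymbol.num i :=
  ⟨fun h => (γ.matching _ _ h).2, fun h => (γ.matching _ _ h).2⟩

theorem SkewClan.symbol_eq_num_rev {γ : SkewClan n} {i j : Fin (2 * n)} :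
    γ.symbol i = ClanSymbol.num j.rev ↔ γ.symbol j = ClanSymbol.num i.rev := by
  rw [← symbol_rev_eq_num, symbol_eq_num_comm]

/-- This is the skew-symmetry of the clan: reversal carries a pair of equal numbers to a pair of
equal numbers and exchanges first and second occurrences. -/
theorem SkewClan.firstToSecond_isSymm (γ : SkewClan n) :
    (Omega n * γ.toClan.firstToSecond).IsSymm := by
  ext i j
  rw [Matrix.transpose_apply, Omega_mul_apply, Omega_mul_apply]
  simp only [Clan.firstToSecond, Matrix.of_apply]
  have h : γ.symbol i = ClanSymbol.num j.rev ∧ i < j.rev ↔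
      γ.symbol j = ClanSymbol.num i.rev ∧ j < i.rev := by
    rw [symbol_eq_num_rev, ← Fin.rev_lt_rev, Fin.rev_rev]
  by_cases hi : γ.symbol i = ClanSymbol.num j.rev ∧ i < j.rev
  · rw [if_pos hi, if_pos (h.mp hi)]; ring
  · rw [if_neg hi, if_neg (fun h' => hi (h.mpr h')), mul_zero, mul_zero]

theorem SkewClan.secondToFirst_isSymm (γ : SkewClan n) :
    (Omega n * γ.toClan.secondToFirst).IsSymm := by
  ext i j
  rw [Matrix.transpose_apply, Omega_mul_apply, Omega_mul_apply]
  simp only [Clan.secondToFirst, Matrix.of_apply, halfSign_rev]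
  have h : γ.symbol i = ClanSymbol.num j.rev ∧ j.rev < i ↔
      γ.symbol j = ClanSymbol.num i.rev ∧ i.rev < j := by
    rw [symbol_eq_num_rev, ← Fin.rev_lt_rev, Fin.rev_rev]
  by_cases hi : γ.symbol i = ClanSymbol.num j.rev ∧ j.rev < i
  · rw [if_pos hi, if_pos (h.mp hi), neg_neg, neg_neg, halfSign_mul_self, halfSign_mul_self]
  · rw [if_neg hi, if_neg (fun h' => hi (h.mpr h')), mul_zero, mul_zero]

theorem isSymm_Omega_mul_smul {D : Matrix (Fin (2 * n)) (Fin (2 * n)) ℂ}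
    (h : (Omega n * D).IsSymm) (c : ℂ) : (Omega n * (c • D)).IsSymm := by
  rw [Matrix.mul_smul]; exact h.smul c

theorem CellIndex.Upper.smul {I : CellIndex n} {D} (h : I.Upper D) (c : ℂ) : I.Upper (c • D) :=
  fun i j hij => h i j (right_ne_zero_of_mul (a := c) hij)

/-- The representative of a clan in the normal form over its Schubert cell. -/
theorem SkewClan.mk_rep_inv {γ : SkewClan n} {I : CellIndex n} (hγ : γ ∈ sect I) :
    ((γ.rep⁻¹ : Sp n) : Sp n ⧸ L n) =
      ((unip _ γ.secondToFirst_isSymm (SkewClan.secondToFirst_lower hγ).mul_self *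
        unip _ (isSymm_Omega_mul_smul γ.firstToSecond_isSymm (-1 / 2))
          ((SkewClan.firstToSecond_upper hγ).smul _).mul_self * I.w : Sp n) : Sp n ⧸ L n) := by
  rw [mk_eq_mk_iff, γ.invol_rep_inv, mul_assoc, invol_mul,
    ((SkewClan.firstToSecond_upper hγ).smul _).invol_unip, mat_unip, mat_unip_inv,
    ← SkewClan.conj_involMat hγ]
  congr 2
  -- D = -E/2 is the choice for which `I.invol` - 2D becomes `I.invol` + E.
  have : (2 : ℕ) • ((-1 / 2 : ℂ) • γ.toClan.firstToSecond) = -γ.toClan.firstToSecond := by module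
  rw [this, sub_neg_eq_add]

theorem SkewClan.secondToFirst_mem_B {γ : SkewClan n} {I : CellIndex n} (hγ : γ ∈ sect I) :
    unip _ γ.secondToFirst_isSymm (SkewClan.secondToFirst_lower hγ).mul_self ∈ B n :=
  unip_mem_B _ _ _ fun _ _ h => (Clan.secondToFirst_ne_zero h).2

/-- First occurrences precede second ones, so 1 + F is in B and is absorbed by the orbit; 1 + D
stays in the fibre over V_I. -/
theorem SkewClan.orbit_subset {γ : SkewClan n} {I : CellIndex n} (hγ : γ ∈ sect I) :
    γ.orbit ⊆ proj n ⁻¹' schubertCell I := by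
  intro x hx
  obtain ⟨b, hb, rfl⟩ := (mem_orbit_iff γ x).mp hx
  have h : ((b * γ.rep⁻¹ : Sp n) : Sp n ⧸ L n) = b • ((γ.rep⁻¹ : Sp n) : Sp n ⧸ L n) := rfl
  rw [h, SkewClan.mk_rep_inv hγ, MulAction.Quotient.smul_mk, smul_eq_mul, ← mul_assoc, ← mul_assoc]
  exact mk_mem_preimage_of_mem_B ((B n).mul_mem hb (SkewClan.secondToFirst_mem_B hγ))
    ((SkewClan.firstToSecond_upper hγ).smul _)

/-! ### Congruence of symmetric matrices under upper triangular matrices -/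

theorem transpose_mul_mul_apply {ι : Type} [Fintype ι] {h S : Matrix ι ι ℂ} (a b : ι) :
    (hᵀ * S * h) a b = ((fun i => h i a) ᵥ* S ᵥ* h) b := by
  rw [Matrix.mul_apply, Matrix.vecMul, dotProduct]
  rfl

section Congruence

variable {ι : Type} [Fintype ι] [LinearOrder ι]

/-- Upper triangular invertible matrices that differ from the identity only at the places with
both indices in a given set. -/
structure IsBorelOn (R : Finset ι) (h : Matrix ι ι ℂ) : Prop where
  upper : ∀ i j, j < i → h i j = 0
  det_ne_zero : h.det ≠ 0
  row : ∀ i j, i ∉ R → h i j = (1 : Matrix ι ι ℂ) i j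
  col : ∀ i j, j ∉ R → h i j = (1 : Matrix ι ι ℂ) i j

theorem IsBorelOn.one (R : Finset ι) : IsBorelOn R (1 : Matrix ι ι ℂ) where
  upper _ _ h := Matrix.one_apply_ne h.ne'
  det_ne_zero := by rw [Matrix.det_one]; exact one_ne_zero
  row _ _ _ := rfl
  col _ _ _ := rfl

theorem IsBorelOn.mono {R R' : Finset ι} (hR : R ⊆ R') {h : Matrix ι ι ℂ} (H : IsBorelOn R h) :
    IsBorelOn R' h where
  upper := H.upper
  det_ne_zero := H.det_ne_zero
  row i j hi := H.row i j fun h' => hi (hR h')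
  col i j hj := H.col i j fun h' => hj (hR h')

theorem IsBorelOn.mul {R : Finset ι} {h k : Matrix ι ι ℂ} (H : IsBorelOn R h)
    (K : IsBorelOn R k) : IsBorelOn R (h * k) where
  upper i j hij := by
    have h1 : h.BlockTriangular id := fun i j h' => H.upper i j h'
    have h2 : k.BlockTriangular id := fun i j h' => K.upper i j h'
    exact (h1.mul h2) hij
  det_ne_zero := by rw [Matrix.det_mul]; exact mul_ne_zero H.det_ne_zero K.det_ne_zero
  row i j hi := by
    have : h i = (1 : Matrix ι ι ℂ) i := funext fun l => H.row i l hi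
    rw [← K.row i j hi, Matrix.mul_apply, this, ← Matrix.mul_apply, Matrix.one_mul]
  col i j hj := by
    have : ∀ l, k l j = (1 : Matrix ι ι ℂ) l j := fun l => K.col l j hj
    rw [← H.col i j hj, Matrix.mul_apply]
    simp only [this]
    rw [← Matrix.mul_apply, Matrix.mul_one]

theorem IsBorelOn.of_diag {R : Finset ι} {h : Matrix ι ι ℂ} (upper : ∀ i j, j < i → h i j = 0)
    (diag : ∀ i, h i i ≠ 0) (row : ∀ i j, i ∉ R → h i j = (1 : Matrix ι ι ℂ) i j)
    (col : ∀ i j, j ∉ R → h i j = (1 : Matrix ι ι ℂ) i j) : IsBorelOn R h where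
  upper := upper
  det_ne_zero := by
    have h1 : h.BlockTriangular id := fun i j h' => upper i j h'
    rw [Matrix.det_of_isUpperTriangular h1]
    exact Finset.prod_ne_zero_iff.mpr fun i _ => diag i
  row := row
  col := col

/-- A matrix whose nonzero entries are the values of `c` at the pairs of a partial matching, which
is given by an involution `τ` of a finite set `T`. -/
def IsMatching (c : ι → ι → ℂ) (R : Finset ι) (S : Matrix ι ι ℂ) : Prop :=
  ∃ (T : Finset ι) (τ : ι → ι), T ⊆ R ∧ (∀ a ∈ T, τ a ∈ T ∧ τ (τ a) = a) ∧
    ∀ a b, S a b = if a ∈ T ∧ b = τ a then c a b else 0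

/-- One step of the elimination splits off a pair of indices. -/
theorem exists_matching_of_step {c : ι → ι → ℂ} {R : Finset ι} {S : Matrix ι ι ℂ} (hS : S.IsSymm)
    {r j : ι} (hr : r ∈ R) (hj : j ∈ R) {h₀ : Matrix ι ι ℂ} (H₀ : IsBorelOn R h₀)
    (h1 : ∀ b, (h₀ᵀ * S * h₀) r b = if b = j then c r b else 0)
    (h2 : ∀ b, (h₀ᵀ * S * h₀) j b = if b = r then c j b else 0)
    (hsupp : ∀ a b, (h₀ᵀ * S * h₀) a b ≠ 0 → a ∈ R)
    (ih : ∀ S' : Matrix ι ι ℂ, S'.IsSymm → (∀ a b, S' a b ≠ 0 → a ∈ (R.erase r).erase j) →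
      ∃ h, IsBorelOn ((R.erase r).erase j) h ∧ IsMatching c ((R.erase r).erase j) (hᵀ * S' * h)) :
    ∃ h, IsBorelOn R h ∧ IsMatching c R (hᵀ * S * h) := by
  set S₁ := h₀ᵀ * S * h₀ with hS₁
  have hs : ∀ a b, S₁ a b = S₁ b a := by
    intro a b
    have : S₁.IsSymm := by
      rw [Matrix.IsSymm, hS₁, Matrix.transpose_mul, Matrix.transpose_mul, Matrix.transpose_transpose,
        hS.eq, Matrix.mul_assoc]
    exact this.apply b a
  -- Q is the part of S₁ in the rows, and by symmetry the columns, r and j. The induction hypothesis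
  -- applies to S₁ - Q.
  let Q : Matrix ι ι ℂ := Matrix.of fun a b => if a = r ∨ a = j then S₁ a b else 0
  have hQ0 : ∀ a b, Q a b ≠ 0 → (a = r ∧ b = j) ∨ (a = j ∧ b = r) := by
    intro a b hab
    simp only [Q, Matrix.of_apply] at hab
    split_ifs at hab with h
    · rcases h with rfl | rfl
      · rw [h1] at hab
        left; refine ⟨rfl, ?_⟩; by_contra H; exact hab (if_neg H)
      · rw [h2] at hab
        right; refine ⟨rfl, ?_⟩; by_contra H; exact hab (if_neg H)
    · exact absurd rfl hab
  have hQs : ∀ a b, Q a b = Q b a := by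
    have key : ∀ a b, Q a b ≠ 0 → Q a b = Q b a := by
      intro a b hab
      have h3 : Q a b = S₁ a b ∧ Q b a = S₁ b a := by
        rcases hQ0 a b hab with ⟨rfl, rfl⟩ | ⟨rfl, rfl⟩ <;>
          exact ⟨if_pos (by tauto), if_pos (by tauto)⟩
      rw [h3.1, h3.2, hs]
    intro a b
    by_cases hab : Q a b = 0
    · by_cases hba : Q b a = 0
      · rw [hab, hba]
      · exact (key b a hba).symm
    · exact key a b hab
  have hcol : ∀ a b, b = r ∨ b = j → Q a b = S₁ a b := by
    intro a b hb
    rw [hQs, hs]; exact if_pos hb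
  obtain ⟨k, K, T, τ, hT, hτ, hk⟩ := ih (S₁ - Q) (by
    ext a b
    rw [Matrix.transpose_apply, Matrix.sub_apply, Matrix.sub_apply, hs, hQs]) (by
    intro a b hab
    rw [Matrix.sub_apply] at hab
    have h3 : ¬ (a = r ∨ a = j) := fun h => hab (by
      rw [show Q a b = S₁ a b from if_pos h, sub_self])
    rw [show Q a b = 0 from if_neg h3, sub_zero] at hab
    rw [Finset.mem_erase, Finset.mem_erase]
    exact ⟨fun h => h3 (Or.inr h), fun h => h3 (Or.inl h), hsupp a b hab⟩)
  -- k agrees with the identity in the rows r and j, so the later elimination does not disturb the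
  -- pair that was split off.
  have hQk : Q * k = Q := by
    ext a b
    have : ∀ l, Q a l * k l b = Q a l * (1 : Matrix ι ι ℂ) l b := by
      intro l
      by_cases hl : Q a l = 0
      · rw [hl, zero_mul, zero_mul]
      · rw [K.row]
        rcases hQ0 a l hl with ⟨_, rfl⟩ | ⟨_, rfl⟩ <;> simp
    rw [Matrix.mul_apply, Finset.sum_congr rfl fun l _ => this l, ← Matrix.mul_apply, Matrix.mul_one]
  have hkQ : kᵀ * Q = Q := by
    have hQt : Qᵀ = Q := by ext a b; exact hQs b a
    rw [← hQt, ← Matrix.transpose_mul, hQk]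
  have hsub : (R.erase r).erase j ⊆ R :=
    (Finset.erase_subset _ _).trans (Finset.erase_subset _ _)
  have hTr : ∀ a ∈ T, a ≠ r ∧ a ≠ j := by
    intro a ha
    have := hT ha
    rw [Finset.mem_erase, Finset.mem_erase] at this
    exact ⟨this.2.1, this.1⟩
  -- The pair r, j is added to the matching; if r = j it becomes a fixed point of τ.
  refine ⟨h₀ * k, H₀.mul (K.mono hsub), insert r (insert j T),
    fun a => if a = r then j else if a = j then r else τ a, ?_, ?_, ?_⟩
  · intro a ha
    rw [Finset.mem_insert, Finset.mem_insert] at ha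
    rcases ha with rfl | rfl | ha
    · exact hr
    · exact hj
    · exact hsub (hT ha)
  · intro a ha
    rw [Finset.mem_insert, Finset.mem_insert] at ha
    by_cases ar : a = r
    · subst ar
      by_cases aj : j = a <;> simp [aj]
    · by_cases aj : a = j
      · subst aj; simp [ar]
      · have haT : a ∈ T := by tauto
        obtain ⟨h3, h4⟩ := hτ a haT
        have := hTr _ h3
        simp [ar, aj, this, h3, h4]
  · intro a b
    have e1 : (h₀ * k)ᵀ * S * (h₀ * k) = kᵀ * (S₁ - Q) * k + Q := by
      rw [Matrix.mul_sub, Matrix.sub_mul, hkQ, hQk, sub_add_cancel, hS₁, Matrix.transpose_mul]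
      simp only [Matrix.mul_assoc]
    rw [e1, Matrix.add_apply, hk]
    by_cases ar : a = r
    · subst ar
      have h3 : a ∉ T := fun h => (hTr a h).1 rfl
      have h4 : Q a b = S₁ a b := if_pos (Or.inl rfl)
      rw [h4, h1]; simp [h3]
    · by_cases aj : a = j
      · subst aj
        have h3 : a ∉ T := fun h => (hTr a h).2 rfl
        have h4 : Q a b = S₁ a b := if_pos (Or.inr rfl)
        rw [h4, h2]; simp [h3, ar]
      · have h4 : Q a b = 0 := if_neg (by tauto)
        rw [h4]; simp [ar, aj]

/-- A complex symmetric matrix is congruent, under upper triangular invertible matrices, to the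
matrix of a partial matching with prescribed nonzero entries. -/
theorem exists_congruence_isMatching {c : ι → ι → ℂ} (hc : ∀ a b, c a b = c b a)
    (hc0 : ∀ a b, c a b ≠ 0) (R : Finset ι) : ∀ S : Matrix ι ι ℂ, S.IsSymm →
      (∀ a b, S a b ≠ 0 → a ∈ R) →
        ∃ h, IsBorelOn R h ∧ IsMatching c R (hᵀ * S * h) := by
  induction R using Finset.strongInduction with | _ R ih =>
  intro S hS hsupp
  have hs : ∀ a b, S a b = S b a := fun a b => hS.apply b a
  have hsupp' : ∀ a b, a ∉ R → S a b = 0 := fun a b ha => by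
    by_contra H; exact ha (hsupp a b H)
  rcases R.eq_empty_or_nonempty with rfl | hne
  · refine ⟨1, IsBorelOn.one _, ∅, id, subset_rfl, by simp, fun a b => ?_⟩
    rw [Matrix.transpose_one, Matrix.one_mul, Matrix.mul_one, hsupp' a b (by simp)]
    simp
  -- The pivot row is the least remaining index, and j below is its first nonzero column. With these
  -- choices all column operations go upwards, so they are upper triangular.
  set r := R.min' hne with hr_def
  have hr : r ∈ R := R.min'_mem hne
  have hmin : ∀ a ∈ R, r ≤ a := fun a ha => R.min'_le a ha
  by_cases hz : ∀ b, S r b = 0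
  · obtain ⟨h, H, T, τ, hT, hτ, hh⟩ := ih (R.erase r) (Finset.erase_ssubset hr) S hS fun a b hab =>
      Finset.mem_erase.mpr ⟨by rintro rfl; exact hab (hz b), hsupp a b hab⟩
    exact ⟨h, H.mono (Finset.erase_subset _ _), T, τ, hT.trans (Finset.erase_subset _ _), hτ, hh⟩
  push Not at hz
  have hne' : (R.filter fun b => S r b ≠ 0).Nonempty := by
    obtain ⟨b, hb⟩ := hz
    refine ⟨b, Finset.mem_filter.mpr ⟨?_, hb⟩⟩
    exact hsupp b r (by rwa [hs])
  set j := (R.filter fun b => S r b ≠ 0).min' hne'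
  obtain ⟨hjR, hj0⟩ := Finset.mem_filter.mp ((R.filter fun b => S r b ≠ 0).min'_mem hne')
  change j ∈ R at hjR
  change S r j ≠ 0 at hj0
  have hjmin : ∀ b, b < j → S r b = 0 := by
    intro b hb
    by_contra H
    have : j ≤ b := Finset.min'_le _ _ (Finset.mem_filter.mpr ⟨hsupp b r (by rwa [hs]), H⟩)
    exact absurd hb this.not_gt
  have hss : (R.erase r).erase j ⊂ R :=
    lt_of_le_of_lt (Finset.erase_subset _ _) (Finset.erase_ssubset hr)
  have hfin : ∀ h₀ : Matrix ι ι ℂ, IsBorelOn R h₀ → ∀ a b, (h₀ᵀ * S * h₀) a b ≠ 0 → a ∈ R := by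
    intro h₀ H₀ a b hab
    by_contra ha
    apply hab
    have : (fun i => h₀ i a) ᵥ* S = 0 := by
      ext b
      rw [Matrix.vecMul, dotProduct]
      refine Finset.sum_eq_zero fun i _ => ?_
      rw [H₀.col i a ha, Matrix.one_apply]
      split_ifs with hia
      · rw [hia, hsupp' a b ha, mul_zero]
      · rw [zero_mul]
    rw [transpose_mul_mul_apply, this, Matrix.zero_vecMul]; rfl
  by_cases hjr : j = r
  · rw [hjr] at hj0
    -- A diagonal pivot scales by α², so a complex square root normalizes it.
    obtain ⟨α, hα⟩ := IsAlgClosed.exists_pow_nat_eq (c r r / S r r) (n := 2) (by norm_num)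
    have hα0 : α ≠ 0 := by
      rintro rfl
      have := div_ne_zero (hc0 r r) hj0
      rw [← hα] at this
      norm_num at this
    -- Column r is scaled by α; from every other basis vector the multiple of the r-th one is
    -- subtracted that clears row r.
    let h₀ : Matrix ι ι ℂ := Matrix.of fun i k =>
      if k = r then (if i = r then α else 0)
      else (if i = k then 1 else 0) - (if i = r then S r k / S r r else 0)
    have hv : ∀ (v : ι → ℂ) b, (v ᵥ* h₀) b =
        if b = r then v r * α else v b - v r * (S r b / S r r) := by
      intro v b
      rw [Matrix.vecMul, dotProduct]
      by_cases hb : b = r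
      · simp [h₀, hb]
      · simp [h₀, hb, mul_sub, Finset.sum_sub_distrib]
    have H₀ : IsBorelOn R h₀ := by
      refine IsBorelOn.of_diag ?_ ?_ ?_ ?_
      · intro i k hki
        simp only [h₀, Matrix.of_apply]
        by_cases hk : k = r
        · rw [if_pos hk, if_neg]; rintro rfl; exact hki.ne hk
        · rw [if_neg hk, if_neg hki.ne']
          by_cases hi : i = r
          · have : k ∉ R := fun h => absurd (hmin k h) (by rw [← hi]; exact hki.not_ge)
            rw [if_pos hi, hs, hsupp' _ _ this]; simp
          · simp [hi]
      · intro i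
        by_cases hi : i = r <;> simp [h₀, hi, hα0]
      · intro i k hi
        have : i ≠ r := by rintro rfl; exact hi hr
        by_cases hk : k = r
        · subst hk; simp [h₀, this]
        · simp [h₀, hk, this, Matrix.one_apply]
      · intro i k hk
        have : k ≠ r := by rintro rfl; exact hk hr
        have h0 : S r k = 0 := by rw [hs, hsupp' _ _ hk]
        simp [h₀, this, h0, Matrix.one_apply]
    have hrow : ∀ b, (h₀ᵀ * S * h₀) r b = if b = r then c r b else 0 := by
      intro b
      have : (fun i => h₀ i r) ᵥ* S = α • S r := by
        ext b
        simp [h₀, Matrix.vecMul, dotProduct]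
      rw [transpose_mul_mul_apply, this, hv]
      by_cases hb : b = r
      · rw [if_pos hb, if_pos hb, hb]
        simp only [Pi.smul_apply, smul_eq_mul]
        have : α ^ 2 * S r r = c r r := by rw [hα]; field_simp
        linear_combination this
      · rw [if_neg hb, if_neg hb]
        simp only [Pi.smul_apply, smul_eq_mul]
        field_simp
        ring
    refine exists_matching_of_step hS hr hr H₀ hrow hrow (hfin h₀ H₀) fun S' hS' hsupp' =>
      ih _ ?_ S' hS' hsupp'
    exact lt_of_le_of_lt (Finset.erase_subset _ _) (Finset.erase_ssubset hr)
  · have hrj : r < j := lt_of_le_of_ne (hmin j hjR) (Ne.symm hjr)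
    have hrr : S r r = 0 := hjmin r hrj
    have hjr0 : S j r ≠ 0 := by rwa [hs]
    -- α normalizes the pivot, t cancels the diagonal entry at j, y k clears the place (r, k), and x
    -- k then clears the place (j, k). No square root is needed, as only one of the two vectors is
    -- scaled.
    let α := c r j / S r j
    let t := -S j j / (2 * S r j)
    let y : ι → ℂ := fun k => S r k / S r j
    let x : ι → ℂ := fun k => (S j k - y k * S j j) / S r j
    have hy : ∀ k, y k * S r j = S r k := fun k => div_mul_cancel₀ _ hj0
    have hx : ∀ k, x k * S r j = S j k - y k * S j j := fun k => div_mul_cancel₀ _ hj0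
    have ht : 2 * t * S r j = -S j j := by simp only [t]; field_simp
    have hα : α * S r j = c r j := div_mul_cancel₀ _ hj0
    have hα0 : α ≠ 0 := div_ne_zero (hc0 r j) hj0
    have hy0 : ∀ k, k ∉ R → y k = 0 := fun k hk => by
      simp only [y]; rw [hs, hsupp' _ _ hk, zero_div]
    have hx0 : ∀ k, k ∉ R → x k = 0 := fun k hk => by
      simp only [x]; rw [hs, hsupp' _ _ hk, hy0 k hk]; simp
    let h₀ : Matrix ι ι ℂ := Matrix.of fun i k =>
      if k = r then (if i = r then α else 0)
      else if k = j then (if i = j then 1 else 0) + (if i = r then t else 0)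
      else (if i = k then 1 else 0) - (if i = r then x k else 0) - (if i = j then y k else 0)
    have hv : ∀ (v : ι → ℂ) b, (v ᵥ* h₀) b =
        if b = r then v r * α else if b = j then v j + v r * t
        else v b - v r * x b - v j * y b := by
      intro v b
      rw [Matrix.vecMul, dotProduct]
      by_cases hb : b = r
      · simp [h₀, hb]
      · by_cases hb' : b = j
        · simp [h₀, hb', hjr, mul_add, Finset.sum_add_distrib]
        · simp [h₀, hb, hb', mul_sub, Finset.sum_sub_distrib]
    have H₀ : IsBorelOn R h₀ := by
      refine IsBorelOn.of_diag ?_ ?_ ?_ ?_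
      · intro i k hki
        simp only [h₀, Matrix.of_apply]
        by_cases hk : k = r
        · rw [if_pos hk, if_neg]; rintro rfl; exact hki.ne hk
        · rw [if_neg hk]
          by_cases hk' : k = j
          · have h3 : i ≠ j := fun h => hki.ne (hk'.trans h.symm)
            have h4 : i ≠ r := fun h => absurd hki (by rw [h, hk']; exact hrj.not_gt)
            simp [hk', h3, h4]
          · rw [if_neg hk', if_neg hki.ne']
            have h3 : (if i = r then x k else 0) = 0 := by
              split_ifs with hi
              · exact hx0 k fun h => absurd (hmin k h) (by rw [← hi]; exact hki.not_ge)
              · rfl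
            -- For k < j the entry of S at (r, k) vanishes by the choice of j.
            have h4 : (if i = j then y k else 0) = 0 := by
              split_ifs with hi
              · simp only [y]; rw [hjmin k (by rw [← hi]; exact hki), zero_div]
              · rfl
            rw [h3, h4]; simp
      · intro i
        by_cases hi : i = r
        · simp [h₀, hi, hα0]
        · by_cases hi' : i = j
          · simp [h₀, hi', hjr]
          · simp [h₀, hi, hi']
      · intro i k hi
        have h3 : i ≠ r := by rintro rfl; exact hi hr
        have h4 : i ≠ j := by rintro rfl; exact hi hjR
        by_cases hk : k = r
        · subst hk; simp [h₀, h3]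
        · by_cases hk' : k = j
          · simp [h₀, hk', hjr, h3, h4]
          · simp [h₀, hk, hk', h3, h4, Matrix.one_apply]
      · intro i k hk
        have h3 : k ≠ r := by rintro rfl; exact hk hr
        have h4 : k ≠ j := by rintro rfl; exact hk hjR
        simp [h₀, h3, h4, hx0 k hk, hy0 k hk, Matrix.one_apply]
    refine exists_matching_of_step hS hr hjR H₀ ?_ ?_ (hfin h₀ H₀) fun S' hS' hsupp' =>
      ih _ hss S' hS' hsupp'
    · intro b
      have : (fun i => h₀ i r) ᵥ* S = α • S r := by
        ext b
        simp [h₀, Matrix.vecMul, dotProduct]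
      rw [transpose_mul_mul_apply, this, hv]
      simp only [Pi.smul_apply, smul_eq_mul]
      by_cases hb : b = r
      · have : r ≠ j := Ne.symm hjr
        simp [hb, this, hrr]
      · by_cases hb' : b = j
        · simp [hb', hjr, hrr, hα]
        · simp only [hb, hb', if_false]
          rw [hrr]; linear_combination -α * hy b
    · intro b
      have : (fun i => h₀ i j) ᵥ* S = S j + t • S r := by
        ext b
        simp [h₀, hjr, Matrix.vecMul, dotProduct, add_mul, Finset.sum_add_distrib]
      rw [transpose_mul_mul_apply, this, hv]
      simp only [Pi.smul_apply, Pi.add_apply, smul_eq_mul]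
      have hsr := hs j r
      by_cases hb : b = r
      · simp only [hb, if_true]
        rw [hrr, hsr, hc j r]; linear_combination hα
      · by_cases hb' : b = j
        · simp only [hb', hjr, if_true, if_false]
          rw [hrr, hsr]; linear_combination ht
        · simp only [hb, hb', if_false]
          rw [hrr, hsr]; linear_combination -hx b - t * hy b

end Congruence

/-! ### Normal form under the Borel subgroup of the Levi subgroup of the stabilizer of `V_I` -/

/-- The adjoint of a matrix with respect to the symplectic form. -/
def adj (h : Matrix (Fin (2 * n)) (Fin (2 * n)) ℂ) : Matrix (Fin (2 * n)) (Fin (2 * n)) ℂ :=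
  -(Omega n * hᵀ * Omega n)

theorem adj_apply (h : Matrix (Fin (2 * n)) (Fin (2 * n)) ℂ) (i j) :
    adj h i j = halfSign n i * halfSign n j * h j.rev i.rev := by
  rw [adj, Matrix.neg_apply, mul_Omega_apply, Omega_mul_apply, Matrix.transpose_apply]
  ring

theorem Omega_mul_adj (h : Matrix (Fin (2 * n)) (Fin (2 * n)) ℂ) :
    Omega n * adj h = hᵀ * Omega n := by
  rw [adj, Matrix.mul_neg, Matrix.mul_assoc, Omega_mul_Omega_mul, neg_neg]

/-- `adj` reverses products, is involutive, and inverts exactly the symplectic matrices. For m =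
adj(h) k this gives adj(m) m = adj(k) h adj(h) k = adj(k) adj(h) h k = adj(hk) = 1. -/
theorem adj_mul_inv_symplectic {h k : Matrix (Fin (2 * n)) (Fin (2 * n)) ℂ} (hk : h * k = 1)
    (hc : h * adj h = adj h * h) : (adj h * k)ᵀ * Omega n * (adj h * k) = Omega n := by
  have h1 : (adj h)ᵀ * Omega n = Omega n * h := by
    rw [adj, Matrix.transpose_neg, Matrix.transpose_mul, Matrix.transpose_mul, Omega_transpose,
      Matrix.transpose_transpose]
    simp only [Matrix.neg_mul, Matrix.mul_neg, neg_neg, Matrix.mul_assoc, Omega_mul_Omega]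
    simp
  have h2 : kᵀ * hᵀ = 1 := by rw [← Matrix.transpose_mul, hk, Matrix.transpose_one]
  calc (adj h * k)ᵀ * Omega n * (adj h * k) = kᵀ * ((adj h)ᵀ * Omega n) * adj h * k := by
        simp only [Matrix.transpose_mul, Matrix.mul_assoc]
    _ = kᵀ * Omega n * (h * adj h) * k := by rw [h1]; simp only [Matrix.mul_assoc]
    _ = kᵀ * (Omega n * adj h) * (h * k) := by rw [hc]; simp only [Matrix.mul_assoc]
    _ = kᵀ * hᵀ * Omega n := by rw [hk, Omega_mul_adj, Matrix.mul_one, Matrix.mul_assoc]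
    _ = Omega n := by rw [h2, Matrix.one_mul]

/-- The prescribed entries of the normal form. -/
def pairValue (n : ℕ) (a b : Fin (2 * n)) : ℂ := halfSign n a * halfSign n b / 2

/-- An upper triangular h on the complement of V_I extends to the Levi element m = adj(h) h⁻¹ of B,
which acts by adj(h) on V_I and by h⁻¹ on the complement. Conjugation by m turns D into adj(h) D h,
hence ΩD into hᵀ(ΩD)h, so the normal form for congruence applies. -/
theorem exists_levi_normal_form {I : CellIndex n} {D : Matrix (Fin (2 * n)) (Fin (2 * n)) ℂ}
    (hD : (Omega n * D).IsSymm) (hu : I.Upper D) :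
    ∃ m ∈ B n, ∃ (D' : _) (hD' : (Omega n * D').IsSymm) (hu' : I.Upper D'),
      IsMatching (pairValue n) I.valᶜ (Omega n * D') ∧
        ((m * (unip D hD hu.mul_self * I.w) : Sp n) : Sp n ⧸ L n) =
          ((unip D' hD' hu'.mul_self * I.w : Sp n) : Sp n ⧸ L n) := by
  obtain ⟨h, H, hM⟩ := exists_congruence_isMatching (c := pairValue n)
    (fun a b => by rw [pairValue, pairValue, mul_comm (halfSign n a)])
    (fun a b => div_ne_zero (mul_ne_zero (halfSign_ne_zero a) (halfSign_ne_zero b)) two_ne_zero)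
    I.valᶜ (Omega n * D) hD (fun a b hab => by
      rw [Omega_mul_apply] at hab
      rw [Finset.mem_compl]
      exact (I.mem_rev a).mp (hu _ _ (right_ne_zero_of_mul hab)).1)
  have hk : h * h⁻¹ = 1 := Matrix.mul_nonsing_inv _ (isUnit_iff_ne_zero.mpr H.det_ne_zero)
  have hk' : h⁻¹ * h = 1 := Matrix.nonsing_inv_mul _ (isUnit_iff_ne_zero.mpr H.det_ne_zero)
  have hI1 : I.ind * h = I.ind := by
    ext i j
    rw [I.ind_mul_apply]
    split_ifs with hi
    · rw [H.row i j (by simpa using hi)]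
      simp [CellIndex.ind, Matrix.one_apply, Matrix.diagonal_apply, hi]
    · simp [CellIndex.ind, Matrix.diagonal_apply, hi]
  have hI2 : h * I.ind = I.ind := by
    ext i j
    rw [I.mul_ind_apply]
    split_ifs with hj
    · rw [H.col i j (by simpa using hj)]
      by_cases hij : i = j
      · subst hij; simp [CellIndex.ind, hj]
      · simp [CellIndex.ind, hij]
    · by_cases hij : i = j
      · subst hij; simp [CellIndex.ind, hj]
      · simp [CellIndex.ind, hij]
  -- `adj` transposes along the antidiagonal, which exchanges I and its complement; so adj(h)
  -- differs from the identity only in the block on I.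
  have hs1 : ∀ i j, i ∉ I.val → adj h i j = (1 : Matrix _ _ ℂ) i j := by
    intro i j hi
    have : i.rev ∈ I.val := (I.mem_rev i).mpr hi
    rw [adj_apply, H.col _ _ (by simpa using this)]
    by_cases hij : i = j
    · subst hij; simp [halfSign_mul_self]
    · have : j ≠ i := Ne.symm hij
      simp [hij, this]
  have hs2 : ∀ i j, j ∉ I.val → adj h i j = (1 : Matrix _ _ ℂ) i j := by
    intro i j hj
    have : j.rev ∈ I.val := (I.mem_rev j).mpr hj
    rw [adj_apply, H.row _ _ (by simpa using this)]
    by_cases hij : i = j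
    · subst hij; simp [halfSign_mul_self]
    · have : j ≠ i := Ne.symm hij
      simp [hij, this]
  set G := adj h - 1 with hG
  have hadj : adj h = 1 + G := by rw [hG]; abel
  have hG1 : I.ind * G = G := by
    ext i j
    rw [I.ind_mul_apply]
    split_ifs with hi
    · rfl
    · rw [hG, Matrix.sub_apply, hs1 i j hi, sub_self]
  have hG2 : G * I.ind = G := by
    ext i j
    rw [I.mul_ind_apply]
    split_ifs with hj
    · rfl
    · rw [hG, Matrix.sub_apply, hs2 i j hj, sub_self]
  have hI3 : I.ind * adj h = adj h * I.ind := by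
    rw [hadj, Matrix.mul_add, Matrix.add_mul, hG1, hG2, Matrix.mul_one, Matrix.one_mul]
  have hcomm : h * adj h = adj h * h := by
    have e1 : h * G = G := by
      calc h * G = (h * I.ind) * G := by rw [Matrix.mul_assoc, hG1]
        _ = G := by rw [hI2, hG1]
    have e2 : G * h = G := by
      calc G * h = G * (I.ind * h) := by rw [← Matrix.mul_assoc, hG2]
        _ = G := by rw [hI1, hG2]
    rw [hadj, Matrix.mul_add, Matrix.add_mul, e1, e2, Matrix.mul_one, Matrix.one_mul]
  have hkI1 : I.ind * h⁻¹ = I.ind := by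
    rw [← hI1, Matrix.mul_assoc, hk, Matrix.mul_one, hI1]
  have hkI2 : h⁻¹ * I.ind = I.ind := by
    rw [← hI2, ← Matrix.mul_assoc, hk', Matrix.one_mul, hI2]
  let m : Sp n := ofMat (adj h * h⁻¹) (adj_mul_inv_symplectic hk hcomm)
  have hm : mat m = adj h * h⁻¹ := rfl
  have hmB : m ∈ B n := by
    have h1 : h.BlockTriangular id := fun i j hij => H.upper i j hij
    have h2 : (adj h).BlockTriangular id := fun i j hij => by
      rw [adj_apply, H.upper j.rev i.rev (Fin.rev_lt_rev.mpr hij), mul_zero]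
    have := Matrix.invertibleOfIsUnitDet h (isUnit_iff_ne_zero.mpr H.det_ne_zero)
    exact fun i j hij => (h2.mul (Matrix.blockTriangular_inv_of_blockTriangular h1)) hij
  have hΩ : Omega n * (adj h * D * h) = hᵀ * (Omega n * D) * h := by
    simp only [← Matrix.mul_assoc, Omega_mul_adj]
  have hD' : (Omega n * (adj h * D * h)).IsSymm := by
    rw [hΩ, Matrix.IsSymm, Matrix.transpose_mul, Matrix.transpose_mul, Matrix.transpose_transpose,
      hD.eq]
    simp only [Matrix.mul_assoc]
  have hu' : I.Upper (adj h * D * h) := by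
    have e1 : I.ind * (adj h * D * h) = adj h * D * h := by
      rw [← Matrix.mul_assoc, ← Matrix.mul_assoc, hI3, Matrix.mul_assoc (adj h), hu.ind_mul]
    have e2 : adj h * D * h * I.ind = 0 := by
      rw [Matrix.mul_assoc, hI2, Matrix.mul_assoc, hu.mul_ind, Matrix.mul_zero]
    intro i j hij
    constructor
    · by_contra hi
      apply hij
      rw [← e1, I.ind_mul_apply, if_neg hi]
    · intro hj
      apply hij
      have := congrFun (congrFun e2 i) j
      rwa [I.mul_ind_apply, if_pos hj] at this
  refine ⟨m, hmB, adj h * D * h, hD', hu', ?_, ?_⟩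
  · rw [hΩ]; exact hM
  · rw [mk_eq_mk_iff, invol_mul, hu.invol_unip, hu'.invol_unip]
    have e1 : mat m * I.invol = I.invol * mat m := by
      have h3 : mat m * I.ind = I.ind * mat m := by
        rw [hm, Matrix.mul_assoc, hkI2, ← Matrix.mul_assoc, hI3, Matrix.mul_assoc, hkI1]
      rw [CellIndex.invol, Matrix.mul_sub, Matrix.sub_mul, two_mul I.ind, Matrix.mul_add, Matrix.add_mul,
        h3, Matrix.mul_one, Matrix.one_mul]
    -- h⁻¹ is trivial on the image V_I of D, and D does not see the factor adj(h) on its right.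
    -- Since h and adj(h) commute, the claim follows.
    have e2 : mat m * D = adj h * D * h * mat m := by
      have h3 : h⁻¹ * D = D := by
        calc h⁻¹ * D = h⁻¹ * I.ind * D := by rw [Matrix.mul_assoc, hu.ind_mul]
          _ = D := by rw [hkI2, hu.ind_mul]
      have h4 : D * adj h = D := by
        have : D * G = 0 := by rw [← hG1, ← Matrix.mul_assoc, hu.mul_ind, Matrix.zero_mul]
        rw [hadj, Matrix.mul_add, this, Matrix.mul_one, add_zero]
      calc mat m * D = adj h * D := by rw [hm, Matrix.mul_assoc, h3]
        _ = adj h * (D * adj h) * (h * h⁻¹) := by rw [hk, h4, Matrix.mul_one]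
        _ = adj h * D * (adj h * h) * h⁻¹ := by simp only [Matrix.mul_assoc]
        _ = _ := by rw [← hcomm, hm]; simp only [Matrix.mul_assoc]
    have e3 : mat m * (I.invol - 2 • D) = (I.invol - 2 • (adj h * D * h)) * mat m := by
      rw [Matrix.mul_sub, Matrix.sub_mul, e1, Matrix.mul_smul, Matrix.smul_mul, e2]
    rw [e3, Matrix.mul_assoc, mat_mul_mat_inv, Matrix.mul_one]

/-! ### The clan of a matching -/

section Matching

variable (I : CellIndex n) (T : Finset (Fin (2 * n))) (τ : Fin (2 * n) → Fin (2 * n))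

/-- The pairing of positions that is defined by a matching of the complement of `I`. -/
def matchMate (k : Fin (2 * n)) : Fin (2 * n) :=
  if k.rev ∈ T ∧ τ k.rev < k then τ k.rev
  else if k ∈ T ∧ k < (τ k).rev then (τ k).rev else k

variable {I T τ}

theorem rev_not_mem_of_mem (hT : T ⊆ I.valᶜ) {k : Fin (2 * n)} (hk : k ∈ T) : k.rev ∉ T := by
  intro h
  have h1 := Finset.mem_compl.mp (hT hk)
  have h2 := Finset.mem_compl.mp (hT h)
  rw [I.mem_rev] at h2
  exact h2 h1

theorem matchMate_of_first (hT : T ⊆ I.valᶜ) {k : Fin (2 * n)} (hk : k ∈ T)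
    (h : k < (τ k).rev) : matchMate T τ k = (τ k).rev := by
  rw [matchMate, if_neg fun h' => rev_not_mem_of_mem hT hk h'.1, if_pos ⟨hk, h⟩]

theorem matchMate_of_second {k : Fin (2 * n)} (hk : k.rev ∈ T) (h : τ k.rev < k) :
    matchMate T τ k = τ k.rev := if_pos ⟨hk, h⟩

theorem matchMate_cases (k : Fin (2 * n)) : (k ∈ T ∧ k < (τ k).rev) ∨ (k.rev ∈ T ∧ τ k.rev < k) ∨
    (¬ (k ∈ T ∧ k < (τ k).rev) ∧ ¬ (k.rev ∈ T ∧ τ k.rev < k) ∧ matchMate T τ k = k) := by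
  by_cases h1 : k ∈ T ∧ k < (τ k).rev
  · exact Or.inl h1
  · by_cases h2 : k.rev ∈ T ∧ τ k.rev < k
    · exact Or.inr (Or.inl h2)
    · exact Or.inr (Or.inr ⟨h1, h2, by rw [matchMate, if_neg h2, if_neg h1]⟩)

theorem matchMate_matchMate (hT : T ⊆ I.valᶜ) (hτ : ∀ a ∈ T, τ a ∈ T ∧ τ (τ a) = a)
    (k : Fin (2 * n)) : matchMate T τ (matchMate T τ k) = k := by
  rcases matchMate_cases (T := T) (τ := τ) k with ⟨h1, h2⟩ | ⟨h1, h2⟩ | ⟨_, _, h3⟩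
  · obtain ⟨h3, h4⟩ := hτ k h1
    rw [matchMate_of_first hT h1 h2, matchMate_of_second] <;> rw [Fin.rev_rev]
    · exact h4
    · exact h3
    · rwa [h4]
  · obtain ⟨h3, h4⟩ := hτ _ h1
    rw [matchMate_of_second h1 h2, matchMate_of_first hT h3] <;> rw [h4, Fin.rev_rev]
    exact h2
  · rw [h3, h3]

/-- A number pair consists of a in T and (τ a).rev; its reversal consists of τ a and a.rev. The
defining conditions are invariant under reversal, which makes the clan skew-symmetric. -/
theorem matchMate_rev (hT : T ⊆ I.valᶜ) (k : Fin (2 * n)) : matchMate T τ k.rev = (matchMate T τ k).rev := by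
  rcases matchMate_cases (T := T) (τ := τ) k with ⟨h1, h2⟩ | ⟨h1, h2⟩ | ⟨h1, h2, h3⟩
  · rw [matchMate_of_first hT h1 h2, matchMate_of_second] <;> rw [Fin.rev_rev]
    · rw [Fin.rev_rev]
    · exact h1
    · rwa [← Fin.rev_lt_rev, Fin.rev_rev]
  · rw [matchMate_of_second h1 h2, matchMate_of_first hT h1]
    rwa [Fin.rev_lt_rev]
  · rw [h3, matchMate, if_neg, if_neg]
    · rwa [Fin.rev_lt_rev]
    · rw [Fin.rev_rev]
      intro h
      exact h1 ⟨h.1, by rw [← Fin.rev_lt_rev, Fin.rev_rev]; exact h.2⟩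

/-- The clan of a matching of the complement of `I`. -/
def matchClan (I : CellIndex n) (T : Finset (Fin (2 * n))) (τ : Fin (2 * n) → Fin (2 * n))
    (hT : T ⊆ I.valᶜ) (hτ : ∀ a ∈ T, τ a ∈ T ∧ τ (τ a) = a) : Clan (2 * n) where
  symbol k := if matchMate T τ k ≠ k then ClanSymbol.num (matchMate T τ k) else
    if k ∈ I.val then ClanSymbol.plus else ClanSymbol.minus
  matching i j h := by
    have h0 : matchMate T τ i ≠ i ∧ matchMate T τ i = j := by
      split_ifs at h with h1
      exact ⟨h1, ClanSymbol.num.inj h⟩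
    obtain ⟨h1, rfl⟩ := h0
    have h2 := matchMate_matchMate hT hτ i
    refine ⟨h1, ?_⟩
    rw [h2, if_pos h1.symm]

theorem matchClan_rev_neg (hT : T ⊆ I.valᶜ) (hτ : ∀ a ∈ T, τ a ∈ T ∧ τ (τ a) = a)
    (k : Fin (2 * n)) :
    (matchClan I T τ hT hτ).symbol k.rev = ((matchClan I T τ hT hτ).symbol k).rev.neg := by
  have h1 := matchMate_rev (τ := τ) hT k
  have h2 := I.mem_rev k
  simp only [matchClan, h1, ne_eq, Fin.rev_inj, h2]
  by_cases h : matchMate T τ k = k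
  · by_cases hk : k ∈ I.val <;> simp [h, hk, ClanSymbol.rev, ClanSymbol.neg]
  · simp [h, ClanSymbol.rev, ClanSymbol.neg]

/-- The skew-symmetric clan of a matching of the complement of `I`. -/
def matchSkewClan (I : CellIndex n) (T : Finset (Fin (2 * n))) (τ : Fin (2 * n) → Fin (2 * n))
    (hT : T ⊆ I.valᶜ) (hτ : ∀ a ∈ T, τ a ∈ T ∧ τ (τ a) = a) : SkewClan n where
  toClan := matchClan I T τ hT hτ
  isPQ := by
    refine ⟨two_mul n, ?_⟩
    rw [sub_self, sub_eq_zero, Nat.cast_inj]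
    -- Reversal is a bijection between the plus signs and the minus signs.
    refine Nat.card_congr (Equiv.subtypeEquiv Fin.revPerm fun k => ?_)
    rw [Fin.revPerm_apply, matchClan_rev_neg hT hτ]
    cases (matchClan I T τ hT hτ).symbol k <;> simp [ClanSymbol.rev, ClanSymbol.neg]
  skew := by
    apply Clan.ext
    funext k
    have := matchClan_rev_neg hT hτ k.rev
    rw [Fin.rev_rev] at this
    exact this

/-- First occurrences are in T, hence outside I, and second ones are reversals of elements of T,
hence in I. -/
theorem matchSkewClan_mem_sect (hT : T ⊆ I.valᶜ) (hτ : ∀ a ∈ T, τ a ∈ T ∧ τ (τ a) = a) :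
    matchSkewClan I T τ hT hτ ∈ sect I := by
  rw [mem_sect_iff]
  intro k
  change k ∈ I.val ↔ (matchClan I T τ hT hτ).SigPlus k
  have hs : (matchClan I T τ hT hτ).symbol k =
    if matchMate T τ k ≠ k then ClanSymbol.num (matchMate T τ k) else
      if k ∈ I.val then ClanSymbol.plus else ClanSymbol.minus := rfl
  unfold Clan.SigPlus
  rw [hs]
  rcases matchMate_cases (T := T) (τ := τ) k with ⟨h1, h2⟩ | ⟨h1, h2⟩ | ⟨_, _, h3⟩
  · have h3 := Finset.mem_compl.mp (hT h1)
    rw [matchMate_of_first hT h1 h2, if_pos h2.ne']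
    simp only [h3, false_iff, not_lt]
    exact h2.le
  · have h3 := Finset.mem_compl.mp (hT h1)
    rw [I.mem_rev, not_not] at h3
    rw [matchMate_of_second h1 h2, if_pos h2.ne]
    simp only [h3, true_iff]
    exact h2
  · rw [h3, if_neg (not_not.mpr rfl)]
    by_cases hk : k ∈ I.val <;> simp [hk]

/-- Identifies the support of `firstToSecond` with the places below the diagonal at which the matrix
D' with matching ΩD' is nonzero. -/
theorem matchSkewClan_symbol (hT : T ⊆ I.valᶜ) (hτ : ∀ a ∈ T, τ a ∈ T ∧ τ (τ a) = a)
    (k i : Fin (2 * n)) :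
    (matchSkewClan I T τ hT hτ).symbol i = ClanSymbol.num k ∧ i < k ↔
      i < k ∧ k.rev ∈ T ∧ i = τ k.rev := by
  have hs : (matchSkewClan I T τ hT hτ).symbol i =
    if matchMate T τ i ≠ i then ClanSymbol.num (matchMate T τ i) else
      if i ∈ I.val then ClanSymbol.plus else ClanSymbol.minus := rfl
  rw [hs]
  constructor
  · rintro ⟨h, hik⟩
    have h0 : matchMate T τ i = k := by
      split_ifs at h
      exact ClanSymbol.num.inj h
    rcases matchMate_cases (T := T) (τ := τ) i with ⟨h1, h2⟩ | ⟨h1, h2⟩ | ⟨_, _, h3⟩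
    · obtain ⟨h3, h4⟩ := hτ i h1
      rw [matchMate_of_first hT h1 h2] at h0
      subst h0
      rw [Fin.rev_rev]
      exact ⟨hik, h3, h4.symm⟩
    · rw [matchMate_of_second h1 h2] at h0
      exact absurd hik (by rw [← h0]; exact h2.not_gt)
    · exact absurd hik (by rw [← h0, h3]; exact lt_irrefl i)
  · rintro ⟨hik, hk, rfl⟩
    obtain ⟨h3, h4⟩ := hτ _ hk
    have h5 : matchMate T τ (τ k.rev) = k := by
      rw [matchMate_of_first hT h3] <;> rw [h4, Fin.rev_rev]
      exact hik
    rw [h5, if_pos hik.ne']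
    exact ⟨rfl, hik⟩

end Matching

/-! ### Every orbit is the orbit of a clan -/

/-- After reduction to a matching, D' splits into a strictly upper triangular part, whose unipotent
is in B, and a part below the diagonal, which is -E/2 for the clan of the matching. Pairs of the
matching above the diagonal thus leave no trace in the clan. -/
theorem exists_mem_orbit {x : Sp n ⧸ L n} {I : CellIndex n} (hx : x ∈ proj n ⁻¹' schubertCell I) :
    ∃ γ ∈ sect I, x ∈ γ.orbit := by
  obtain ⟨g, rfl⟩ := QuotientGroup.mk_surjective x
  obtain ⟨A, hA, hl, hlt, D, hD, hu, hg⟩ := exists_normal_form_of_mem hx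
  obtain ⟨m, hm, D', hD', hu', ⟨T, τ, hT, hτ, hM⟩, hmD⟩ := exists_levi_normal_form hD hu
  have hγ := matchSkewClan_mem_sect hT hτ
  set γ := matchSkewClan I T τ hT hτ with hγ_def
  let D₂ : Matrix (Fin (2 * n)) (Fin (2 * n)) ℂ := Matrix.of fun i j => if i < j then D' i j else 0
  have hu₂ : I.Upper D₂ := by
    intro i j hij
    refine hu' i j fun h => hij ?_
    simp [D₂, h]
  have hlt₂ : ∀ i j, D₂ i j ≠ 0 → i < j := by
    intro i j hij
    by_contra h; exact hij (if_neg h)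
  have hD₂ : (Omega n * D₂).IsSymm := by
    ext i j
    have h1 := hD'.apply i j
    rw [Omega_mul_apply, Omega_mul_apply] at h1
    rw [Matrix.transpose_apply, Omega_mul_apply, Omega_mul_apply]
    have h2 : i.rev < j ↔ j.rev < i := by rw [← Fin.rev_lt_rev, Fin.rev_rev]
    simp only [D₂, Matrix.of_apply]
    by_cases h : i.rev < j
    · rw [if_pos h, if_pos (h2.mp h), h1]
    · rw [if_neg h, if_neg fun h' => h (h2.mpr h'), mul_zero, mul_zero]
  have hsplit : D' = D₂ + (-1 / 2 : ℂ) • γ.toClan.firstToSecond := by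
    ext i j
    have h1 := hM i.rev j
    rw [Omega_mul_apply, Fin.rev_rev, halfSign_rev, pairValue, halfSign_rev] at h1
    -- The values `pairValue` are chosen to give `halfSign n j / 2` here, which is -1/2 times the
    -- entry of `firstToSecond`.
    have h2 : D' i j = if i.rev ∈ T ∧ j = τ i.rev then halfSign n j / 2 else 0 := by
      have h3 := halfSign_mul_self i
      split_ifs at h1 ⊢ with h
      · linear_combination -halfSign n i * h1 - (D' i j - halfSign n j / 2) * h3
      · linear_combination -halfSign n i * h1 - D' i j * h3
    have h3 := matchSkewClan_symbol hT hτ i j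
    rw [← hγ_def] at h3
    rw [Matrix.add_apply, Matrix.smul_apply]
    simp only [D₂, Matrix.of_apply, Clan.firstToSecond]
    by_cases hij : i < j
    · rw [if_pos hij, if_neg fun h => absurd h.2 hij.not_gt, smul_zero, add_zero]
    · rw [if_neg hij, zero_add]
      by_cases h : i.rev ∈ T ∧ j = τ i.rev
      · have hne : j ≠ i := by
          rintro rfl
          have h4 : D' j j ≠ 0 := by
            rw [h2, if_pos h]
            exact div_ne_zero (halfSign_ne_zero j) two_ne_zero
          exact (hu' j j h4).2 (hu' j j h4).1
        have hji : j < i := lt_of_le_of_ne (not_lt.mp hij) hne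
        rw [h2, if_pos h, if_pos (h3.mpr ⟨hji, h⟩), smul_eq_mul]
        ring
      · rw [h2, if_neg h, if_neg fun h' => h (h3.mp h').2, smul_zero]
  have hE := (SkewClan.firstToSecond_upper hγ).smul (-1 / 2)
  have hEs := isSymm_Omega_mul_smul γ.firstToSecond_isSymm (-1 / 2)
  -- Two upper matrices for the same I have product zero, so sums become products of unipotents.
  have hmul : unip D' hD' hu'.mul_self = unip D₂ hD₂ hu₂.mul_self * unip _ hEs hE.mul_self := by
    apply mat_injective
    have h0 : D₂ * ((-1 / 2 : ℂ) • γ.toClan.firstToSecond) = 0 := by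
      rw [← hE.ind_mul, ← Matrix.mul_assoc, hu₂.mul_ind, Matrix.zero_mul]
    rw [mat_mul, mat_unip, mat_unip, mat_unip, Matrix.add_mul, Matrix.mul_add D₂, h0,
      Matrix.one_mul, Matrix.mul_one, add_zero, hsplit]
    abel
  set u := unip A hA hl.mul_self
  set F := unip _ γ.secondToFirst_isSymm (SkewClan.secondToFirst_lower hγ).mul_self
  refine ⟨γ, hγ, (mem_orbit_iff γ _).mpr
    ⟨u * m⁻¹ * unip D₂ hD₂ hu₂.mul_self * F⁻¹, ?_, ?_⟩⟩
  · exact (B n).mul_mem ((B n).mul_mem ((B n).mul_mem (unip_mem_B _ _ _ hlt) ((B n).inv_mem hm))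
      (unip_mem_B _ _ _ hlt₂)) ((B n).inv_mem (SkewClan.secondToFirst_mem_B hγ))
  · have key : ∀ a b : Sp n, ((a * b : Sp n) : Sp n ⧸ L n) = a • (b : Sp n ⧸ L n) :=
      fun _ _ => rfl
    rw [hmul] at hmD
    rw [hg, key (u * m⁻¹ * _ * F⁻¹), SkewClan.mk_rep_inv hγ, ← key]
    have h1 : u * m⁻¹ * unip D₂ hD₂ hu₂.mul_self * F⁻¹ * (F * unip _ hEs hE.mul_self * I.w) =
        (u * m⁻¹) * (unip D₂ hD₂ hu₂.mul_self * unip _ hEs hE.mul_self * I.w) := by group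
    rw [h1, key (u * m⁻¹), ← hmD, ← key]
    congr 1
    group

theorem preimage_schubertCell (I : CellIndex n) :
    proj n ⁻¹' schubertCell I = ⋃ γ ∈ sect I, γ.orbit := by
  apply Set.Subset.antisymm
  · intro x hx
    obtain ⟨γ, hγ, h⟩ := exists_mem_orbit hx
    exact Set.mem_iUnion₂.mpr ⟨γ, hγ, h⟩
  · exact Set.iUnion₂_subset fun γ hγ => SkewClan.orbit_subset hγ

instance : Finite (CellIndex n) := Subtype.finite

end CI

end

theorem mainTheorem2 (n : ℕ) (hn : 0 < n) :
    (∀ I : CI.CellIndex n,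
      CI.proj n ⁻¹' CI.schubertCell I = ⋃ γ ∈ CI.sect I, γ.orbit ∧
        (CI.sect I).PairwiseDisjoint CI.SkewClan.orbit) ∧
      CI.IsCellDecomposition (fun I : CI.CellIndex n => ⋃ γ ∈ CI.sect I, γ.orbit) := by
  refine ⟨fun I => ⟨CI.preimage_schubertCell I, CI.sect_pairwiseDisjoint I⟩, ?_⟩
  -- By (1) the cells are preimages of Schubert cells, so (2) no longer involves clans.
  simp only [← CI.preimage_schubertCell]
  refine ⟨inferInstance, ?_, ?_, CI.isAffineCell_preimage, fun I => CI.weight I.enum,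
    CI.weight_enum_injective, CI.isZariskiClosed_union⟩
  · intro I J hne
    exact Set.disjoint_left.mpr fun x hI hJ => hne (CI.cellIndex_unique hI hJ)
  · exact Set.eq_univ_of_forall fun x =>
      Set.mem_iUnion.mpr (CI.exists_mem_preimage_schubertCell x)
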